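/- Let $M\ge 1$, let $m_1,\dots,m_M\in\mathbb{Z}_{\ge 1}$, put $N=m_1+\dots+m_M$, and let $t_1,\dots,t_M\in\mathbb{C}$ be such that $0,1,t_1,\dots,t_M$ are mutually distinct. For $\gamma,\delta,s_0,\dots,s_M\in\mathbb{C}$ set $$\tilde L=\frac{d^2}{dz^2}+\Bigl(\frac{\gamma}{z}+\frac{\delta}{z-1}-\sum_{k=1}^M\frac{m_k}{z-t_k}\Bigr)\frac{d}{dz}+\frac{s_Mz^M+\dots+s_0}{z(z-1)(z-t_1)\cdots(z-t_M)}.$$ Assume that each singularity $z=t_k$ of $\tilde L y=0$ (whose exponents are $0$ and $m_k+1$) is apparent, i.e. the equation has a basis of local solutions $f(z)=\sum_{j\ge0}c_j(z-t_k)^j$, $c_0\ne0$, and $g(z)=(z-t_k)^{m_k+1}\sum_{j\ge0}c'_j(z-t_k)^j$, $c'_0\neq 0$, so that no logarithmic term occurs. Assume moreover that one of the following holds: (i) $M=1$ and $m_1\le5$; (ii) $M=2$ and $m_1+m_2\le4$; (iii) $M=3$ and $m_1=m_2=m_3=1$. For $a_1,\dots,a_{q+1},b_1,\dots,b_q\in\mathbb{C}$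 let $L_{a_1,\dots,a_{q+1};b_1,\dots,b_q}$ be the monic generalized hypergeometric differential operator of order $q+1$, that is, $\frac{1}{z^q(1-z)}$ times $$\frac{d}{dz}\Bigl(z\frac{d}{dz}+b_1-1\Bigr)\cdots\Bigl(z\frac{d}{dz}+b_q-1\Bigr)-\Bigl(z\frac{d}{dz}+a_1\Bigr)\cdots\Bigl(z\frac{d}{dz}+a_{q+1}\Bigr).$$ Then there exist $\alpha,\beta\in\mathbb{C}$ with $s_M=\alpha\beta$ and $\delta=\alpha+\beta-\gamma+N+1$, numbers $e_1,\dots,e_N\in\mathbb{C}$, and a differential operator $\tilde D$ of order $N$ with rational function coefficients such that $$L_{\alpha,\beta,e_1+1,\dots,e_N+1;\gamma,e_1,\dots,e_N}=\tilde D\,\tilde L .$$ -/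

import Mathlib

open Filter Topology Polynomial

noncomputable section

namespace Fuchsian

/-! ### The derivation `d/dz` on the field `ℂ(z)` of rational functions -/

/-- The quotient rule, on the numerator and denominator in lowest terms. -/
def ratDerivFun (f : RatFunc ℂ) : RatFunc ℂ :=
  (algebraMap ℂ[X] (RatFunc ℂ) (derivative f.num) * algebraMap ℂ[X] (RatFunc ℂ) f.denom
      - algebraMap ℂ[X] (RatFunc ℂ) f.num * algebraMap ℂ[X] (RatFunc ℂ) (derivative f.denom))
    / algebraMap ℂ[X] (RatFunc ℂ) f.denom ^ 2

/-- The quotient rule holds for every representation of a rational function as a fraction. -/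
theorem ratDerivFun_div (p q : ℂ[X]) (hq : q ≠ 0) :
    ratDerivFun (algebraMap ℂ[X] (RatFunc ℂ) p / algebraMap ℂ[X] (RatFunc ℂ) q) =
      (algebraMap ℂ[X] (RatFunc ℂ) (derivative p) * algebraMap ℂ[X] (RatFunc ℂ) q
        - algebraMap ℂ[X] (RatFunc ℂ) p * algebraMap ℂ[X] (RatFunc ℂ) (derivative q))
      / algebraMap ℂ[X] (RatFunc ℂ) q ^ 2 := by
  set f : RatFunc ℂ := algebraMap ℂ[X] (RatFunc ℂ) p / algebraMap ℂ[X] (RatFunc ℂ) q with hf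
  have hq' : algebraMap ℂ[X] (RatFunc ℂ) q ≠ 0 := RatFunc.algebraMap_ne_zero hq
  have hd' : algebraMap ℂ[X] (RatFunc ℂ) f.denom ≠ 0 :=
    RatFunc.algebraMap_ne_zero f.denom_ne_zero
  have h1 : f.num * q = p * f.denom := by
    apply RatFunc.algebraMap_injective ℂ
    have h2 : algebraMap ℂ[X] (RatFunc ℂ) f.num / algebraMap ℂ[X] (RatFunc ℂ) f.denom
        = algebraMap ℂ[X] (RatFunc ℂ) p / algebraMap ℂ[X] (RatFunc ℂ) q := by
      rw [RatFunc.num_div_denom, hf]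
    rw [div_eq_div_iff hd' hq'] at h2
    simpa using h2
  have h3 := congrArg (fun r => algebraMap ℂ[X] (RatFunc ℂ) (derivative r)) h1
  have h4 := congrArg (fun r => algebraMap ℂ[X] (RatFunc ℂ) r) h1
  simp only [derivative_mul, map_add, map_mul] at h3 h4
  unfold ratDerivFun
  rw [div_eq_div_iff (pow_ne_zero 2 hd') (pow_ne_zero 2 hq')]
  linear_combination (algebraMap ℂ[X] (RatFunc ℂ) f.denom * algebraMap ℂ[X] (RatFunc ℂ) q) * h3
    - (algebraMap ℂ[X] (RatFunc ℂ) (derivative f.denom) * algebraMap ℂ[X] (RatFunc ℂ) q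
      + algebraMap ℂ[X] (RatFunc ℂ) f.denom * algebraMap ℂ[X] (RatFunc ℂ) (derivative q)) * h4

theorem ratDerivFun_add (f g : RatFunc ℂ) :
    ratDerivFun (f + g) = ratDerivFun f + ratDerivFun g := by
  induction f using RatFunc.induction_on with
  | f p q hq =>
  induction g using RatFunc.induction_on with
  | f r s hs =>
  have hq' : algebraMap ℂ[X] (RatFunc ℂ) q ≠ 0 := RatFunc.algebraMap_ne_zero hq
  have hs' : algebraMap ℂ[X] (RatFunc ℂ) s ≠ 0 := RatFunc.algebraMap_ne_zero hs
  rw [div_add_div _ _ hq' hs', ← map_mul, ← map_mul, ← map_mul, ← map_add,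
    ratDerivFun_div _ _ (mul_ne_zero hq hs), ratDerivFun_div _ _ hq, ratDerivFun_div _ _ hs]
  simp only [derivative_mul, map_add, map_mul]
  field_simp
  ring

theorem ratDerivFun_mul (f g : RatFunc ℂ) :
    ratDerivFun (f * g) = f * ratDerivFun g + g * ratDerivFun f := by
  induction f using RatFunc.induction_on with
  | f p q hq =>
  induction g using RatFunc.induction_on with
  | f r s hs =>
  have hq' : algebraMap ℂ[X] (RatFunc ℂ) q ≠ 0 := RatFunc.algebraMap_ne_zero hq
  have hs' : algebraMap ℂ[X] (RatFunc ℂ) s ≠ 0 := RatFunc.algebraMap_ne_zero hs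
  rw [div_mul_div_comm, ← map_mul, ← map_mul,
    ratDerivFun_div _ _ (mul_ne_zero hq hs), ratDerivFun_div _ _ hq, ratDerivFun_div _ _ hs]
  simp only [derivative_mul, map_add, map_mul]
  field_simp
  ring

theorem ratDerivFun_C (c : ℂ) : ratDerivFun (RatFunc.C c) = 0 := by
  have h := ratDerivFun_div (Polynomial.C c) 1 one_ne_zero
  simpa using h

/-- The operator `d/dz` on `ℂ(z)`. -/
def ddz : Module.End ℂ (RatFunc ℂ) where
  toFun := ratDerivFun
  map_add' := ratDerivFun_add
  map_smul' c f := by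
    rw [RatFunc.smul_eq_C_mul, ratDerivFun_mul, ratDerivFun_C]
    simp [RatFunc.smul_eq_C_mul]

/-! ### Differential operators with rational coefficients

A differential operator with coefficients in `ℂ(z)` is represented by its action on `ℂ(z)`.
The representation is faithful (a non-zero operator of order `n` cannot annihilate all of
`1, z, …, z ^ n`), and the product of operators is composition. -/

/-- Multiplication by a rational function, the differential operator of order zero. -/
def mulOp (f : RatFunc ℂ) : Module.End ℂ (RatFunc ℂ) := LinearMap.mulLeft ℂ f

/-- `D = v_n (d/dz)^n + ⋯ + v_1 (d/dz) + v_0` with rational `v_j` and `v_n ≠ 0`. -/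
def IsDiffOpOfOrder (n : ℕ) (D : Module.End ℂ (RatFunc ℂ)) : Prop :=
  ∃ v : Fin (n + 1) → RatFunc ℂ, v (Fin.last n) ≠ 0 ∧
    D = ∑ j : Fin (n + 1), mulOp (v j) * ddz ^ (j : ℕ)

/-- The Euler operator `z d/dz` plus the constant `c`. -/
def eulerAdd (c : ℂ) : Module.End ℂ (RatFunc ℂ) :=
  mulOp RatFunc.X * ddz + mulOp (RatFunc.C c)

/-- `d/dz (z d/dz + b_1 - 1) ⋯ (z d/dz + b_q - 1) - (z d/dz + a_1) ⋯ (z d/dz + a_p)`. -/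
def ghgRaw (a b : List ℂ) : Module.End ℂ (RatFunc ℂ) :=
  ddz * (b.map fun c => eulerAdd (c - 1)).prod - (a.map fun c => eulerAdd c).prod

/-- The monic generalized hypergeometric operator `L_{a_1, …, a_{q+1}; b_1, …, b_q}`. For
`p = q + 1` the leading coefficient of `ghgRaw a b` is `z ^ q - z ^ (q + 1) = z ^ q (1 - z)`. -/
def ghgOp (a b : List ℂ) : Module.End ℂ (RatFunc ℂ) :=
  mulOp ((RatFunc.X ^ b.length * (1 - RatFunc.X))⁻¹) * ghgRaw a b

/-- The operator `d²/dz² + P d/dz + Q`. -/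
def secondOrderOp (P Q : RatFunc ℂ) : Module.End ℂ (RatFunc ℂ) :=
  ddz ^ 2 + mulOp P * ddz + mulOp Q

/-- `γ / z + δ / (z - 1) - ∑ m_k / (z - t_k)`. -/
def coeffP {M : ℕ} (γ δ : ℂ) (m : Fin M → ℕ) (t : Fin M → ℂ) : RatFunc ℂ :=
  RatFunc.C γ / RatFunc.X + RatFunc.C δ / (RatFunc.X - 1)
    - ∑ k, (m k : RatFunc ℂ) / (RatFunc.X - RatFunc.C (t k))

/-- `(s_M z ^ M + ⋯ + s_0) / (z (z - 1) (z - t_1) ⋯ (z - t_M))`. -/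
def coeffQ {M : ℕ} (s : Fin (M + 1) → ℂ) (t : Fin M → ℂ) : RatFunc ℂ :=
  (∑ i : Fin (M + 1), RatFunc.C (s i) * RatFunc.X ^ (i : ℕ))
    / (RatFunc.X * (RatFunc.X - 1) * ∏ k, (RatFunc.X - RatFunc.C (t k)))

/-! ### Apparent singularities -/

/-- `y'' + P y' + Q y = 0` on a punctured neighbourhood of `t`. -/
def SolvesNear (P Q : RatFunc ℂ) (t : ℂ) (y : ℂ → ℂ) : Prop :=
  ∀ᶠ z in 𝓝[≠] t, deriv (deriv y) z + P.eval (RingHom.id ℂ) z * deriv y z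
    + Q.eval (RingHom.id ℂ) z * y z = 0

/-- The singularity `t`, with exponents `0` and `m + 1`, of `y'' + P y' + Q y = 0` is apparent:
there is a basis of local solutions `f = ∑ c_j (z - t) ^ j` with `c_0 ≠ 0`, free of a
logarithmic term, and `g = (z - t) ^ (m + 1) * ∑ c'_j (z - t) ^ j` with `c'_0 ≠ 0`. -/
def IsApparentAt (P Q : RatFunc ℂ) (t : ℂ) (m : ℕ) : Prop :=
  (∃ f : ℂ → ℂ, AnalyticAt ℂ f t ∧ f t ≠ 0 ∧ SolvesNear P Q t f) ∧
    ∃ h : ℂ → ℂ, AnalyticAt ℂ h t ∧ h t ≠ 0 ∧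
      SolvesNear P Q t fun z => (z - t) ^ (m + 1) * h z

end Fuchsian

end

/-!
Let `y` be the class of `1` in `V = ℂ(z)[d/dz] / ℂ(z)[d/dz] L`, and write `θ = z d/dz`,
`E = ∏ (X + e_i)`. A left multiple of `L` is an operator that kills `y`, so the factorization says
`θ (θ + γ - 1) E(θ - 1) y = z (θ + α) (θ + β) E(θ + 1) y`. This holds if `y = E(θ) F` for some `F`
with `θ (θ + γ - 1) F = z (θ + α) (θ + β) F`, the Gauss hypergeometric equation.

For generic `α, β, γ` the operator `L` is irreducible, because its Riccati equation has no rational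
solution. Since the `t_k` are apparent, the Riccati equation has a polynomial solution modulo a
multiple of `∏ (z - t_k) ^ m_k * (z - 1) ^ N`. This congruence cuts out a lattice of polynomial
vectors in `V`, in which counting dimensions yields first `F ≠ 0` and then `E ≠ 0` of degree at most
`N` such that `E(θ) F` is a multiple of `y`; irreducibility makes the multiple nonzero.

For other parameters, deform `L` by moving the exponents along the line `(α + x, β + x, γ + 3 x)`
and letting the accessory parameters `η_k` vary. The logarithmic obstruction at `t_k` is a
polynomial in `x` and the `η_j` with leading form a multiple of `η_k ^ (m_k + 1)`, so the equations
with apparent `t_k` form a family finite over the `x`-line and cut out by `M` equations in an affine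
space of dimension `M + 1`. Hence every such equation is a limit of generic ones. The conditions on
`E` are linear, and injectivity of a linear system is an open property, so a nonzero solution `E`
persists in the limit. The indicial polynomial, which belongs to the linear conditions, forces `E`
to have degree `N`.
-/

noncomputable section

namespace Fuchsian

theorem ddz_mul (f g : RatFunc ℂ) : ddz (f * g) = f * ddz g + g * ddz f := ratDerivFun_mul f g

theorem ddz_algebraMap (p : ℂ[X]) :
    ddz (algebraMap ℂ[X] (RatFunc ℂ) p) = algebraMap ℂ[X] (RatFunc ℂ) (derivative p) := by
  change ratDerivFun _ = _
  have h := ratDerivFun_div p 1 one_ne_zero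
  simpa using h

theorem ddz_C (c : ℂ) : ddz (RatFunc.C c) = 0 := ratDerivFun_C c

theorem ddz_one : ddz (1 : RatFunc ℂ) = 0 := by simpa using ddz_C 1

theorem ddz_X : ddz (RatFunc.X : RatFunc ℂ) = 1 := by
  rw [← RatFunc.algebraMap_X, ddz_algebraMap, derivative_X, map_one]

/-- `d/dz` bundled as a derivation, which gives access to the quotient rule of the library. -/
def ddzDerivation : Derivation ℂ (RatFunc ℂ) (RatFunc ℂ) := Derivation.mk' ddz ddz_mul

theorem ddz_div (f g : RatFunc ℂ) : ddz (f / g) = (g * ddz f - f * ddz g) / g ^ 2 := by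
  rw [div_eq_inv_mul _ (g ^ 2), ← inv_pow]
  exact ddzDerivation.leibniz_div f g

theorem mulOp_apply (f g : RatFunc ℂ) : mulOp f g = f * g := rfl

theorem mulOp_zero : mulOp 0 = 0 := by
  ext h; simp [mulOp_apply]

theorem mulOp_add (f g : RatFunc ℂ) : mulOp (f + g) = mulOp f + mulOp g := by
  ext h; simp [mulOp_apply, add_mul]

theorem mulOp_sub (f g : RatFunc ℂ) : mulOp (f - g) = mulOp f - mulOp g := by
  ext h; simp [mulOp_apply, sub_mul]

theorem mulOp_mul (f g : RatFunc ℂ) : mulOp (f * g) = mulOp f * mulOp g := by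
  ext h; simp [mulOp_apply, mul_assoc]

theorem ddz_mul_mulOp (f : RatFunc ℂ) : ddz * mulOp f = mulOp f * ddz + mulOp (ddz f) := by
  ext g
  simp only [Module.End.mul_apply, mulOp_apply, ddz_mul, LinearMap.add_apply]
  ring

theorem ddz_mul_eulerAdd (a : ℂ) : ddz * eulerAdd a = eulerAdd (a + 1) * ddz := by
  ext g
  simp only [eulerAdd, Module.End.mul_apply, LinearMap.add_apply, mulOp_apply, map_add, ddz_mul,
    ddz_X, ddz_C, map_one]
  ring

/-! ### Division by an operator of order two -/

section Module

variable (P Q : RatFunc ℂ)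

/-- The action of `d/dz` on the module `ℂ(z)[d/dz] / ℂ(z)[d/dz] L`, `L = d²/dz² + P d/dz + Q`.
The module has the basis `y, y'` with `y'' = - P y' - Q y`, and the pair `(a, b)` encodes
`a y + b y'`. -/
def nabla : Module.End ℂ (RatFunc ℂ × RatFunc ℂ) where
  toFun w := (ddz w.1 - Q * w.2, w.1 + ddz w.2 - P * w.2)
  map_add' v w := by
    ext <;> simp <;> ring
  map_smul' c w := by
    ext <;> simp [smul_sub, smul_add]

theorem nabla_apply (w : RatFunc ℂ × RatFunc ℂ) :
    nabla P Q w = (ddz w.1 - Q * w.2, w.1 + ddz w.2 - P * w.2) := rfl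

theorem nabla_smul (f : RatFunc ℂ) (w : RatFunc ℂ × RatFunc ℂ) :
    nabla P Q (f • w) = ddz f • w + f • nabla P Q w := by
  ext <;> simp [nabla_apply, ddz_mul] <;> ring

/-- The action of the Euler operator `z d/dz` on pairs. -/
def theta : Module.End ℂ (RatFunc ℂ × RatFunc ℂ) where
  toFun w := RatFunc.X (K := ℂ) • nabla P Q w
  map_add' v w := by rw [map_add, smul_add]
  map_smul' c w := by rw [map_smul, smul_comm, RingHom.id_apply]

theorem theta_apply (w : RatFunc ℂ × RatFunc ℂ) : theta P Q w = RatFunc.X (K := ℂ) • nabla P Q w :=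
  rfl

theorem theta_smul (f : RatFunc ℂ) (w : RatFunc ℂ × RatFunc ℂ) :
    theta P Q (f • w) = (RatFunc.X * ddz f) • w + f • theta P Q w := by
  simp only [theta_apply, nabla_smul, smul_add, smul_smul, mul_comm f]

theorem aeval_theta_X_add_C_apply (c : ℂ) (w : RatFunc ℂ × RatFunc ℂ) :
    aeval (theta P Q) (X + C c) w = theta P Q w + RatFunc.C c • w := by
  rw [map_add, aeval_X, aeval_C, LinearMap.add_apply, Module.algebraMap_end_apply]
  ext <;> simp [RatFunc.smul_eq_C_mul]

theorem aeval_theta_X_add_C_mul_apply (c : ℂ) (p : ℂ[X]) (w : RatFunc ℂ × RatFunc ℂ) :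
    aeval (theta P Q) ((X + C c) * p) w =
      theta P Q (aeval (theta P Q) p w) + RatFunc.C c • aeval (theta P Q) p w := by
  rw [map_mul, Module.End.mul_apply, aeval_theta_X_add_C_apply]

theorem nabla_aeval_theta_X_add_C_mul (c : ℂ) (p : ℂ[X]) (w : RatFunc ℂ × RatFunc ℂ) :
    nabla P Q (aeval (theta P Q) ((X + C c) * p) w) =
      theta P Q (nabla P Q (aeval (theta P Q) p w)) +
        RatFunc.C (c + 1) • nabla P Q (aeval (theta P Q) p w) := by
  rw [aeval_theta_X_add_C_mul_apply, map_add, theta_apply, theta_apply, nabla_smul, nabla_smul,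
    ddz_X, ddz_C, map_add, map_one, add_smul, one_smul, zero_smul]
  abel

end Module

/-- `D = c (d/dz)^n + lower order terms`. -/
def HasLeadingTerm (n : ℕ) (c : RatFunc ℂ) (D : Module.End ℂ (RatFunc ℂ)) : Prop :=
  ∃ v : ℕ → RatFunc ℂ, v n = c ∧ D = ∑ j ∈ Finset.range (n + 1), mulOp (v j) * ddz ^ j

namespace HasLeadingTerm

variable {n : ℕ} {c c' : RatFunc ℂ} {D D' : Module.End ℂ (RatFunc ℂ)}

theorem isDiffOpOfOrder (h : HasLeadingTerm n c D) (hc : c ≠ 0) : IsDiffOpOfOrder n D := by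
  obtain ⟨v, hv, rfl⟩ := h
  refine ⟨fun j => v j, by simpa [hv] using hc, ?_⟩
  rw [Finset.sum_range]

theorem mulOp (c : RatFunc ℂ) : HasLeadingTerm 0 c (mulOp c) := ⟨fun _ => c, rfl, by simp⟩

theorem sub (h : HasLeadingTerm n c D) (h' : HasLeadingTerm n c' D') :
    HasLeadingTerm n (c - c') (D - D') := by
  obtain ⟨v, hv, rfl⟩ := h
  obtain ⟨v', hv', rfl⟩ := h'
  refine ⟨fun j => v j - v' j, by simp only [hv, hv'], ?_⟩
  simp only [mulOp_sub, sub_mul, Finset.sum_sub_distrib]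

theorem mulOp_mul (h : HasLeadingTerm n c D) (f : RatFunc ℂ) :
    HasLeadingTerm n (f * c) (Fuchsian.mulOp f * D) := by
  obtain ⟨v, hv, rfl⟩ := h
  refine ⟨fun j => f * v j, by simp only [hv], ?_⟩
  simp only [Finset.mul_sum, Fuchsian.mulOp_mul, mul_assoc]

theorem add_lower (h : HasLeadingTerm (n + 1) c D) (h' : HasLeadingTerm n c' D') :
    HasLeadingTerm (n + 1) c (D + D') := by
  obtain ⟨v, hv, rfl⟩ := h
  obtain ⟨w, -, rfl⟩ := h'
  refine ⟨fun j => v j + if j = n + 1 then 0 else w j, by simp [hv], ?_⟩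
  simp only [mulOp_add, add_mul, Finset.sum_add_distrib]
  rw [Finset.sum_range_succ (fun j => Fuchsian.mulOp (if j = n + 1 then 0 else w j) * ddz ^ j)]
  simp only [if_true, mulOp_zero, zero_mul, add_zero]
  refine congrArg _ (Finset.sum_congr rfl fun j hj => ?_)
  rw [if_neg (Finset.mem_range.1 hj).ne]

theorem add_mulOp (h : HasLeadingTerm (n + 1) c D) (f : RatFunc ℂ) :
    HasLeadingTerm (n + 1) c (D + Fuchsian.mulOp f) := by
  obtain ⟨v, hv, rfl⟩ := h
  refine ⟨fun j => v j + if j = 0 then f else 0, by simp [hv], ?_⟩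
  simp only [mulOp_add, add_mul, Finset.sum_add_distrib]
  congr 1
  rw [Finset.sum_eq_single 0] <;> simp +contextual [mulOp_zero]

theorem ddz_mul (h : HasLeadingTerm n c D) : HasLeadingTerm (n + 1) c (ddz * D) := by
  obtain ⟨v, hv, rfl⟩ := h
  have hshift : HasLeadingTerm (n + 1) c
      (∑ j ∈ Finset.range (n + 1), Fuchsian.mulOp (v j) * ddz ^ (j + 1)) := by
    refine ⟨fun j => if j = 0 then 0 else v (j - 1), by simp [hv], ?_⟩
    rw [Finset.sum_range_succ' _ (n + 1)]
    simp [mulOp_zero]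
  have hlower : HasLeadingTerm n (ddz (v n))
      (∑ j ∈ Finset.range (n + 1), Fuchsian.mulOp (ddz (v j)) * ddz ^ j) := ⟨_, rfl, rfl⟩
  convert hshift.add_lower hlower using 1
  simp only [Finset.mul_sum, ← mul_assoc, ddz_mul_mulOp, add_mul, Finset.sum_add_distrib, pow_succ']

theorem eulerAdd_mul (h : HasLeadingTerm n c D) (a : ℂ) :
    HasLeadingTerm (n + 1) (RatFunc.X * c) (eulerAdd a * D) := by
  rw [eulerAdd, add_mul, mul_assoc]
  exact (h.ddz_mul.mulOp_mul _).add_lower (h.mulOp_mul _)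

end HasLeadingTerm

/-- Division of `D` by `L = d²/dz² + P d/dz + Q`: the quotient has order `n` and leading
coefficient `c`, and the remainder is `r.1 + r.2 d/dz`. -/
def DividesWithRem (P Q : RatFunc ℂ) (n : ℕ) (c : RatFunc ℂ) (D : Module.End ℂ (RatFunc ℂ))
    (r : RatFunc ℂ × RatFunc ℂ) : Prop :=
  ∃ D', HasLeadingTerm n c D' ∧ D = D' * secondOrderOp P Q + (mulOp r.2 * ddz + mulOp r.1)

theorem ddz_mul_remainder (P Q : RatFunc ℂ) (r : RatFunc ℂ × RatFunc ℂ) :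
    ddz * (mulOp r.2 * ddz + mulOp r.1) = mulOp r.2 * secondOrderOp P Q
      + (mulOp (nabla P Q r).2 * ddz + mulOp (nabla P Q r).1) := by
  ext g
  simp only [secondOrderOp, nabla_apply, mulOp_apply, ddz_mul, pow_two, Module.End.mul_apply,
    LinearMap.add_apply, map_add]
  ring

namespace DividesWithRem

variable {P Q : RatFunc ℂ} {n : ℕ} {c c' : RatFunc ℂ} {D D' : Module.End ℂ (RatFunc ℂ)}
  {r r' : RatFunc ℂ × RatFunc ℂ}

theorem mulOp_mul (h : DividesWithRem P Q n c D r) (f : RatFunc ℂ) :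
    DividesWithRem P Q n (f * c) (mulOp f * D) (f • r) := by
  obtain ⟨D', hD', rfl⟩ := h
  refine ⟨mulOp f * D', hD'.mulOp_mul f, ?_⟩
  simp only [Prod.smul_fst, Prod.smul_snd, smul_eq_mul, Fuchsian.mulOp_mul, mul_add, mul_assoc]

theorem sub (h : DividesWithRem P Q n c D r) (h' : DividesWithRem P Q n c' D' r') :
    DividesWithRem P Q n (c - c') (D - D') (r - r') := by
  obtain ⟨D₁, hD₁, rfl⟩ := h
  obtain ⟨D₂, hD₂, rfl⟩ := h'
  refine ⟨D₁ - D₂, hD₁.sub hD₂, ?_⟩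
  simp only [Prod.fst_sub, Prod.snd_sub, mulOp_sub, sub_mul]
  abel

theorem eulerAdd_mul (h : DividesWithRem P Q n c D r) (a : ℂ) :
    DividesWithRem P Q (n + 1) (RatFunc.X * c) (eulerAdd a * D)
      (theta P Q r + RatFunc.C a • r) := by
  obtain ⟨D', hD', rfl⟩ := h
  refine ⟨eulerAdd a * D' + mulOp (RatFunc.X * r.2), (hD'.eulerAdd_mul a).add_mulOp _, ?_⟩
  rw [mul_add, eulerAdd, add_mul _ _ (mulOp r.2 * ddz + mulOp r.1), mul_assoc (mulOp RatFunc.X),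
    ddz_mul_remainder P Q]
  simp only [theta_apply, Prod.fst_add, Prod.snd_add, Prod.smul_fst, Prod.smul_snd, smul_eq_mul,
    mulOp_add, Fuchsian.mulOp_mul, mul_add, add_mul, mul_assoc]
  abel

end DividesWithRem

section

variable (P Q : RatFunc ℂ)

theorem dividesWithRem_eulerAdd_prod {n : ℕ} {l : List ℂ} (hl : l.length = n + 2) :
    DividesWithRem P Q n (RatFunc.X ^ (n + 2)) (l.map eulerAdd).prod
      (aeval (theta P Q) (l.map fun c => X + C c).prod (1, 0)) := by
  induction n generalizing l with
  | zero =>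
    obtain ⟨a, b, rfl⟩ := List.length_eq_two.1 hl
    refine ⟨mulOp (RatFunc.X ^ 2), .mulOp _, ?_⟩
    simp only [List.map_cons, List.map_nil, List.prod_cons, List.prod_nil, mul_one,
      aeval_theta_X_add_C_mul_apply, aeval_theta_X_add_C_apply, theta_apply, nabla_apply]
    ext g
    simp [eulerAdd, secondOrderOp, mulOp_apply, ddz_mul, ddz_X, ddz_C, ddz_one, pow_two]
    ring
  | succ n ih =>
    obtain ⟨a, l, rfl⟩ := List.exists_cons_of_length_eq_add_one hl
    simp only [List.map_cons, List.prod_cons, aeval_theta_X_add_C_mul_apply,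
      pow_succ' _ (n + 2)]
    exact (ih (by simpa using hl)).eulerAdd_mul a

theorem dividesWithRem_ddz_mul_eulerAdd_prod {n : ℕ} {l : List ℂ} (hl : l.length = n + 1) :
    DividesWithRem P Q n (RatFunc.X ^ (n + 1)) (ddz * (l.map eulerAdd).prod)
      (nabla P Q (aeval (theta P Q) (l.map fun c => X + C c).prod (1, 0))) := by
  induction n generalizing l with
  | zero =>
    obtain ⟨a, rfl⟩ := List.length_eq_one_iff.1 hl
    refine ⟨mulOp RatFunc.X, by simpa using .mulOp _, ?_⟩
    simp only [List.map_cons, List.map_nil, List.prod_cons, List.prod_nil, mul_one,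
      aeval_theta_X_add_C_apply, theta_apply, nabla_apply]
    ext g
    simp [eulerAdd, secondOrderOp, mulOp_apply, ddz_mul, ddz_X, ddz_C, ddz_one, pow_two]
    ring
  | succ n ih =>
    obtain ⟨a, l, rfl⟩ := List.exists_cons_of_length_eq_add_one hl
    simp only [List.map_cons, List.prod_cons, nabla_aeval_theta_X_add_C_mul,
      pow_succ' _ (n + 1), ← mul_assoc, ddz_mul_eulerAdd]
    rw [mul_assoc]
    exact (ih (by simpa using hl)).eulerAdd_mul (a + 1)

theorem exists_ghgOp_eq_mul {n : ℕ} {a b : List ℂ} (ha : a.length = n + 2) (hb : b.length = n + 1)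
    (h : nabla P Q (aeval (theta P Q) (b.map fun c => X + C (c - 1)).prod (1, 0)) =
      aeval (theta P Q) (a.map fun c => X + C c).prod (1, 0)) :
    ∃ D, IsDiffOpOfOrder n D ∧ ghgOp a b = D * secondOrderOp P Q := by
  have hquot : DividesWithRem P Q n (RatFunc.X ^ (n + 1) - RatFunc.X ^ (n + 2)) (ghgRaw a b) 0 := by
    have hdiv := (dividesWithRem_ddz_mul_eulerAdd_prod P Q (n := n)
      (l := b.map fun c => c - 1) (by simpa using hb)).sub (dividesWithRem_eulerAdd_prod P Q ha)
    simpa only [List.map_map, Function.comp_def, h, sub_self, ghgRaw] using hdiv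
  obtain ⟨D, hD, heq⟩ := hquot.mulOp_mul (RatFunc.X ^ b.length * (1 - RatFunc.X))⁻¹
  refine ⟨D, hD.isDiffOpOfOrder ?_, ?_⟩
  swap
  · rw [smul_zero, Prod.fst_zero, Prod.snd_zero, mulOp_zero, zero_mul, add_zero, add_zero] at heq
    exact heq
  have hX : (RatFunc.X : RatFunc ℂ) ≠ 0 := RatFunc.X_ne_zero
  have h1X : (1 - RatFunc.X : RatFunc ℂ) ≠ 0 := by
    rw [← RatFunc.algebraMap_X, ← map_one (algebraMap ℂ[X] (RatFunc ℂ)), ← map_sub]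
    exact RatFunc.algebraMap_ne_zero (by simpa using sub_ne_zero.2 (X_ne_C (R := ℂ) 1).symm)
  rw [hb, show (RatFunc.X : RatFunc ℂ) ^ (n + 1) - RatFunc.X ^ (n + 2)
    = RatFunc.X ^ (n + 1) * (1 - RatFunc.X) by ring]
  exact mul_ne_zero (inv_ne_zero (mul_ne_zero (pow_ne_zero _ hX) h1X))
    (mul_ne_zero (pow_ne_zero _ hX) h1X)

end

/-! ### Rational solutions of a Riccati equation -/

section Riccati

variable {K : Type*} [Field K] {q p S n e w : K[X]} {d : ℕ}

/-- The fraction `n / e` solves the Riccati equation `q (v' + v²) + p v + S = 0`, with the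
denominators cleared. -/
def SolvesRiccati (q p S n e : K[X]) : Prop :=
  q * (derivative n * e - n * derivative e + n ^ 2) + p * n * e + S * e ^ 2 = 0

theorem SolvesRiccati.natDegree_lt (H : SolvesRiccati q p S n e) (hq : q.Monic)
    (hp : p.natDegree < q.natDegree) (hS : S.natDegree < q.natDegree) (hn : n ≠ 0) :
    n.natDegree < e.natDegree := by
  by_contra! hle
  set N := n.natDegree
  have hderiv {f : K[X]} (hf : f.natDegree ≤ N) : (derivative f).coeff N = 0 := by
    rw [coeff_derivative, coeff_eq_zero_of_natDegree_lt (hf.trans_lt N.lt_succ_self), zero_mul]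
  have hderiv_le {f : K[X]} (hf : f.natDegree ≤ N) : (derivative f).natDegree ≤ N :=
    (natDegree_derivative_le f).trans ((Nat.sub_le _ _).trans hf)
  have hhigh : (derivative n * e - n * derivative e + n ^ 2).coeff (N + N) =
      n.leadingCoeff ^ 2 := by
    rw [coeff_add, coeff_sub, coeff_mul_add_eq_of_natDegree_le (hderiv_le le_rfl) hle,
      coeff_mul_add_eq_of_natDegree_le le_rfl (hderiv_le hle), hderiv le_rfl, hderiv hle,
      ← two_mul, coeff_pow_mul_natDegree, zero_mul, mul_zero, sub_zero, zero_add]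
  have hhigh_le : (derivative n * e - n * derivative e + n ^ 2).natDegree ≤ N + N := by
    refine natDegree_add_le_of_degree_le ((natDegree_sub_le _ _).trans (max_le ?_ ?_)) ?_
    · exact natDegree_mul_le_of_le (hderiv_le le_rfl) hle
    · exact natDegree_mul_le_of_le le_rfl (hderiv_le hle)
    · exact (natDegree_pow_le).trans (two_mul N).le
  have hlow : (p * n * e + S * e ^ 2).natDegree < q.natDegree + (N + N) := by
    refine (natDegree_add_le _ _).trans_lt (max_lt ?_ ?_)
    · have hpne := natDegree_mul_le_of_le (natDegree_mul_le_of_le le_rfl le_rfl) hle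
        (p := p * n)
      omega
    · have hSe := natDegree_mul_le_of_le le_rfl (natDegree_pow_le_of_le 2 hle) (p := S)
      omega
  have htop := congrArg (coeff · (q.natDegree + (N + N))) H
  simp only [add_assoc, coeff_zero] at htop
  rw [coeff_add, coeff_mul_add_eq_of_natDegree_le le_rfl hhigh_le, hhigh,
    coeff_eq_zero_of_natDegree_lt hlow, hq.coeff_natDegree, one_mul, add_zero] at htop
  exact hn (leadingCoeff_eq_zero.1 (pow_eq_zero_iff two_ne_zero |>.1 htop))

theorem SolvesRiccati.exists_mul_eq (H : SolvesRiccati q p S n e) (he : e ≠ 0)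
    (hne : IsCoprime n e) :
    ∃ w, q * (n - derivative e) = e * w ∧ q * derivative n + n * (w + p) + S * e = 0 := by
  unfold SolvesRiccati at H
  obtain ⟨w, hw⟩ : e ∣ q * (n - derivative e) := by
    refine hne.symm.dvd_of_dvd_mul_left ⟨-(q * derivative n + p * n + S * e), ?_⟩
    linear_combination H
  exact ⟨w, hw, mul_left_cancel₀ he (by linear_combination H - n * hw)⟩

theorem coeff_derivative_of_monic (he : e.Monic) (hd : e.natDegree = d + 1) :
    (derivative e).coeff d = d + 1 := by
  rw [coeff_derivative, ← hd, he.coeff_natDegree, one_mul]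

section

variable {D : ℕ} (hq : q.Monic) (hqD : q.natDegree = D + 1) (he : e.Monic)
  (hed : e.natDegree = d + 1) (hnd : n.natDegree ≤ d) (hw : q * (n - derivative e) = e * w)

include hed hnd in
theorem natDegree_sub_derivative_le : (n - derivative e).natDegree ≤ d :=
  (natDegree_sub_le _ _).trans (max_le hnd ((natDegree_derivative_le e).trans (hed ▸ le_rfl)))

include hqD he hed hnd hw in
theorem natDegree_le_of_mul_sub_derivative_eq : w.natDegree ≤ D := by
  by_cases hw0 : w = 0
  · simp [hw0]
  have hdeg := natDegree_mul_le_of_le hqD.le (natDegree_sub_derivative_le hed hnd)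
  rw [hw, he.natDegree_mul' hw0, hed] at hdeg
  omega

include hq hqD he hed hnd hw in
theorem coeff_of_mul_sub_derivative_eq : w.coeff D = n.coeff d - (d + 1) := by
  have hcoeff := congrArg (coeff · (D + 1 + d)) hw
  rw [coeff_mul_add_eq_of_natDegree_le hqD.le (natDegree_sub_derivative_le hed hnd),
    show D + 1 + d = d + 1 + D by omega, coeff_mul_add_eq_of_natDegree_le hed.le
      (natDegree_le_of_mul_sub_derivative_eq hqD he hed hnd hw), coeff_sub, ← hed,
    he.coeff_natDegree, ← hqD, hq.coeff_natDegree, coeff_derivative_of_monic he hed] at hcoeff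
  simpa using hcoeff.symm

end

theorem natDegree_X_mul_derivative_le (f : K[X]) : (X * derivative f).natDegree ≤ f.natDegree := by
  by_cases hf : f.natDegree = 0
  · simp [derivative_of_natDegree_zero hf]
  · refine natDegree_mul_le.trans ?_
    have := natDegree_derivative_le f
    rw [natDegree_X]
    omega

theorem coeff_X_mul_derivative (f : K[X]) (k : ℕ) : (X * derivative f).coeff k = k * f.coeff k := by
  cases k with
  | zero => simp
  | succ k => rw [coeff_X_mul, coeff_derivative]; push_cast; ring

theorem indicial_of_mul_sub_derivative_eq {D : ℕ} (hq : q.Monic) (hqD : q.natDegree = D + 2)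
    (hp : p.natDegree ≤ D + 1) (hS : S.natDegree ≤ D) (he : e.Monic) (hed : e.natDegree = d + 1)
    (hnd : n.natDegree ≤ d) (hw : q * (n - derivative e) = e * w)
    (h : q * derivative n + n * (w + p) + S * e = 0) :
    n.coeff d ^ 2 + (p.coeff (D + 1) - 1) * n.coeff d + S.coeff D = 0 := by
  have hwD := natDegree_le_of_mul_sub_derivative_eq hqD he hed hnd hw
  have hwp : (X * (w + p)).natDegree ≤ D + 2 :=
    (natDegree_mul_le_of_le natDegree_X_le (natDegree_add_le_of_degree_le hwD hp)).trans (by omega)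
  have hXS : (X * S).natDegree ≤ D + 1 :=
    (natDegree_mul_le_of_le natDegree_X_le hS).trans (by omega)
  have htop : (q * (X * derivative n) + n * (X * (w + p)) + X * S * e).coeff (D + 2 + d) = 0 := by
    rw [show q * (X * derivative n) + n * (X * (w + p)) + X * S * e = 0 by
      linear_combination X * h, coeff_zero]
  rw [coeff_add, coeff_add, coeff_mul_add_eq_of_natDegree_le hqD.le
      ((natDegree_X_mul_derivative_le n).trans hnd), coeff_X_mul_derivative,
    add_comm (D + 2), coeff_mul_add_eq_of_natDegree_le hnd hwp, coeff_X_mul, coeff_add,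
    coeff_of_mul_sub_derivative_eq hq hqD he hed hnd hw, show d + (D + 2) = D + 1 + (d + 1) by ring,
    coeff_mul_add_eq_of_natDegree_le hXS hed.le, coeff_X_mul, ← hqD, hq.coeff_natDegree, ← hed,
    he.coeff_natDegree] at htop
  linear_combination htop

theorem eval_eq_zero_or_of_mul_sub_derivative_eq {c : K} (hqc : q.eval c = 0)
    (hne : IsCoprime n e) (hw : q * (n - derivative e) = e * w)
    (h : q * derivative n + n * (w + p) + S * e = 0) : w.eval c = 0 ∨ w.eval c = -p.eval c := by
  have hc := congrArg (eval c) h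
  have hew : e.eval c * w.eval c = 0 := by rw [← eval_mul, ← hw, eval_mul, hqc, zero_mul]
  rcases mul_eq_zero.1 hew with hec | hwc
  · obtain ⟨a, b, hab⟩ := hne
    have hnc : n.eval c ≠ 0 := fun hnc => by simpa [hec, hnc] using congrArg (eval c) hab
    exact .inr (eq_neg_of_add_eq_zero_left (by simpa [hqc, hec, hnc] using hc))
  · exact .inl hwc

/-- In terms of the Fuchsian equation, `-r` is an exponent at infinity, and `x c` or `x c + 1` is an
exponent at `c`. -/
theorem SolvesRiccati.exists_exponents [DecidableEq K] {s : Finset K} {D : ℕ} (hs : s.card = D + 2)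
    (hp : p.natDegree ≤ D + 1) (hS : S.natDegree ≤ D) (he : e.Monic) (hne : IsCoprime n e)
    (H : SolvesRiccati (∏ c ∈ s, (X - C c)) p S n e) :
    ∃ (r : K) (k : ℕ) (x : K → K), r ^ 2 + (p.coeff (D + 1) - 1) * r + S.coeff D = 0 ∧
      (∀ c ∈ s, x c = 0 ∨ x c = -p.eval c / ∏ j ∈ s.erase c, (c - j)) ∧ r = k + ∑ c ∈ s, x c := by
  by_cases hn0 : n = 0
  · have hS0 : S = 0 := by simpa [SolvesRiccati, hn0, he.ne_zero] using H
    exact ⟨0, 0, 0, by simp [hS0], by simp, by simp⟩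
  set q : K[X] := ∏ c ∈ s, (X - C c) with hq
  have hqm : q.Monic := monic_prod_of_monic _ _ fun c _ => monic_X_sub_C c
  have hqD : q.natDegree = D + 2 := by
    rw [hq, natDegree_prod_of_monic _ _ fun c _ => monic_X_sub_C c]; simp [hs]
  have hlt := H.natDegree_lt hqm (by omega) (by omega) hn0
  obtain ⟨d, hed⟩ := Nat.exists_eq_add_one.2 (Nat.zero_lt_of_lt hlt)
  have hnd : n.natDegree ≤ d := by omega
  obtain ⟨w, hw, hw'⟩ := H.exists_mul_eq he.ne_zero hne
  refine ⟨n.coeff d, d + 1, fun c => w.eval c / ∏ j ∈ s.erase c, (c - j),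
    indicial_of_mul_sub_derivative_eq hqm hqD hp hS he hed hnd hw hw', fun c hc => ?_, ?_⟩
  · have hqc : q.eval c = 0 := by
      rw [hq, eval_prod]; exact Finset.prod_eq_zero hc (by simp)
    rcases eval_eq_zero_or_of_mul_sub_derivative_eq hqc hne hw hw' with h | h <;> simp [h]
  · have hdeg : w.degree < s.card := (natDegree_le_iff_degree_le.1
      (natDegree_le_of_mul_sub_derivative_eq hqD he hed hnd hw)).trans_lt
        (by rw [hs]; exact_mod_cast (D + 1).lt_succ_self)
    have hlagrange := Lagrange.coeff_eq_sum (v := id) Function.injective_id.injOn hdeg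
    rw [hs, show D + 2 - 1 = D + 1 by omega,
      coeff_of_mul_sub_derivative_eq hqm hqD he hed hnd hw] at hlagrange
    simp only [id] at hlagrange
    rw [← hlagrange]
    push_cast
    ring

end Riccati

/-! ### The parameters of the equation -/

/-- The parameters of the equation `q y'' + p y' + S y = 0` with `q = z (z - 1) ∏ (z - t_k)`, over
a ring `A`, with exponents `α, β` at infinity. The accessory parameters are normalized by
`S / T = α β + ∑ η_k / (z - t_k)`, where `T = ∏ (z - t_k)`. -/
structure Datum (M : ℕ) (A : Type*) where
  t : Fin M → A
  m : Fin M → ℕ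
  α : A
  β : A
  γ : A
  η : Fin M → A

namespace Datum

variable {M : ℕ} {A : Type*} [CommRing A]

/-- The sum of the `m_k`. -/
def N (d : Datum M A) : ℕ := ∑ k, d.m k

/-- The exponent parameter at `z = 1`, determined by the Fuchs relation. -/
def δ (d : Datum M A) : A := d.α + d.β - d.γ + d.N + 1

/-- The product of all `z - t_k`. -/
def T (d : Datum M A) : A[X] := ∏ k, (X - C (d.t k))

/-- The product of all `z - t_j` with `j ≠ k`. -/
def Tk (d : Datum M A) (k : Fin M) : A[X] := ∏ j ∈ Finset.univ.erase k, (X - C (d.t j))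

/-- `∑ m_k ∏_{j ≠ k} (z - t_j)`. -/
def mT (d : Datum M A) : A[X] := ∑ k, C (d.m k : A) * d.Tk k

/-- The leading coefficient `z (z - 1) ∏ (z - t_k)`. -/
def q (d : Datum M A) : A[X] := X * (X - 1) * d.T

/-- The coefficient of `d/dz`. -/
def p (d : Datum M A) : A[X] :=
  C d.γ * (X - 1) * d.T + C d.δ * X * d.T - X * (X - 1) * d.mT

/-- The coefficient of order zero. -/
def S (d : Datum M A) : A[X] := C (d.α * d.β) * d.T + ∑ k, C (d.η k) * d.Tk k

theorem X_sub_C_mul_Tk (d : Datum M A) (k : Fin M) : (X - C (d.t k)) * d.Tk k = d.T :=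
  Finset.mul_prod_erase Finset.univ (fun j => X - C (d.t j)) (Finset.mem_univ k)

theorem monic_T (d : Datum M A) : d.T.Monic :=
  monic_prod_of_monic _ _ fun _ _ => monic_X_sub_C _

theorem natDegree_T [Nontrivial A] (d : Datum M A) : d.T.natDegree = M := by
  rw [T, natDegree_prod_of_monic _ _ fun k _ => monic_X_sub_C _]; simp

theorem coeff_T [Nontrivial A] (d : Datum M A) : d.T.coeff M = 1 := by
  have := d.monic_T
  rwa [Monic, leadingCoeff, natDegree_T] at this

theorem monic_Tk (d : Datum M A) (k : Fin M) : (d.Tk k).Monic :=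
  monic_prod_of_monic _ _ fun _ _ => monic_X_sub_C _

theorem natDegree_Tk [Nontrivial A] (d : Datum M A) (k : Fin M) : (d.Tk k).natDegree = M - 1 := by
  rw [Tk, natDegree_prod_of_monic _ _ fun k _ => monic_X_sub_C _]; simp

theorem coeff_Tk [Nontrivial A] (d : Datum M A) (k : Fin M) : (d.Tk k).coeff (M - 1) = 1 := by
  have := d.monic_Tk k
  rwa [Monic, leadingCoeff, natDegree_Tk] at this

theorem natDegree_mT_le [Nontrivial A] (d : Datum M A) : d.mT.natDegree ≤ M - 1 :=
  natDegree_sum_le_of_forall_le _ _ fun k _ => by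
    refine (natDegree_C_mul_le _ _).trans (d.natDegree_Tk k).le

theorem coeff_mT [Nontrivial A] (d : Datum M A) : d.mT.coeff (M - 1) = (d.N : A) := by
  simp [mT, coeff_Tk, N]

theorem natDegree_S_le [Nontrivial A] (d : Datum M A) : d.S.natDegree ≤ M := by
  refine (natDegree_add_le _ _).trans (max_le ?_ ?_)
  · exact (natDegree_C_mul_le _ _).trans d.natDegree_T.le
  · refine natDegree_sum_le_of_forall_le _ _ fun k _ => ?_
    refine (natDegree_C_mul_le _ _).trans ((d.natDegree_Tk k).le.trans (Nat.sub_le _ _))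

theorem coeff_S [Nontrivial A] (d : Datum M A) : d.S.coeff M = d.α * d.β := by
  rw [S, coeff_add, coeff_C_mul, coeff_T, finsetSum_coeff, Finset.sum_eq_zero, mul_one, add_zero]
  intro k _
  rw [coeff_C_mul, coeff_eq_zero_of_natDegree_lt, mul_zero]
  rw [natDegree_Tk]
  have := k.pos
  omega

theorem natDegree_X_mul_X_sub_one_mul_mT_le [Nontrivial A] (d : Datum M A) :
    (X * (X - 1) * d.mT).natDegree ≤ M + 1 := by
  rcases M.eq_zero_or_pos with rfl | hM
  · simp [mT]
  · have hX1 : (X - 1 : A[X]).natDegree ≤ 1 := by simpa using natDegree_X_sub_C_le (1 : A)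
    exact (natDegree_mul_le_of_le (natDegree_mul_le_of_le natDegree_X_le hX1)
      d.natDegree_mT_le).trans (by omega)

theorem natDegree_p_le [Nontrivial A] (d : Datum M A) : d.p.natDegree ≤ M + 1 := by
  have hX1 : (X - 1 : A[X]).natDegree ≤ 1 := by simpa using natDegree_X_sub_C_le (1 : A)
  rw [p, mul_assoc, mul_assoc]
  refine (natDegree_sub_le _ _).trans (max_le ((natDegree_add_le _ _).trans (max_le ?_ ?_))
    d.natDegree_X_mul_X_sub_one_mul_mT_le) <;> refine (natDegree_C_mul_le _ _).trans ?_
  · exact (natDegree_mul_le_of_le hX1 d.natDegree_T.le).trans (add_comm 1 M).le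
  · exact (natDegree_mul_le_of_le natDegree_X_le d.natDegree_T.le).trans (add_comm 1 M).le

theorem coeff_p [Nontrivial A] (d : Datum M A) : d.p.coeff (M + 1) = d.α + d.β + 1 := by
  have hX1 : (X - 1 : A[X]).natDegree ≤ 1 := by simpa using natDegree_X_sub_C_le (1 : A)
  have hT₁ : ((X - 1) * d.T).coeff (1 + M) = 1 := by
    rw [coeff_mul_add_eq_of_natDegree_le hX1 d.natDegree_T.le, coeff_T]; simp [coeff_one]
  have hT₂ : (X * d.T).coeff (M + 1) = 1 := by rw [coeff_X_mul, coeff_T]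
  have hmT : (X * (X - 1) * d.mT).coeff (M + 1) = (d.N : A) := by
    rcases M.eq_zero_or_pos with rfl | hM
    · simp [mT, N]
    · have := coeff_mul_add_eq_of_natDegree_le hX1 d.natDegree_mT_le
      rw [show M + 1 = (1 + (M - 1)) + 1 by omega, mul_assoc, coeff_X_mul, this, coeff_mT]
      simp [coeff_one]
  rw [p, coeff_sub, coeff_add, mul_assoc, mul_assoc, coeff_C_mul, coeff_C_mul, add_comm M 1, hT₁,
    add_comm 1 M, hT₂, hmT, δ]
  ring

/-- The coefficient of `d/dz` in monic form. -/
def P (d : Datum M ℂ) : RatFunc ℂ := algebraMap ℂ[X] _ d.p / algebraMap ℂ[X] _ d.q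

/-- The coefficient of order zero in monic form. -/
def Q (d : Datum M ℂ) : RatFunc ℂ := algebraMap ℂ[X] _ d.S / algebraMap ℂ[X] _ d.q

/-- The points `0, 1, t_1, …, t_M` are distinct. -/
structure Distinct (d : Datum M ℂ) : Prop where
  inj : Function.Injective d.t
  ne_zero : ∀ k, d.t k ≠ 0
  ne_one : ∀ k, d.t k ≠ 1

/-- The exponents are so generic that the equation is irreducible and nonresonant at `1`. -/
structure Generic (d : Datum M ℂ) : Prop where
  α_ne : ∀ n : ℤ, d.α ≠ n
  β_ne : ∀ n : ℤ, d.β ≠ n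
  αγ_ne : ∀ n : ℤ, d.α - d.γ ≠ n
  βγ_ne : ∀ n : ℤ, d.β - d.γ ≠ n
  δ_ne : ∀ n : ℤ, d.δ ≠ n

theorem monic_q (d : Datum M A) : d.q.Monic :=
  (monic_X.mul (by simpa using monic_X_sub_C (1 : A))).mul d.monic_T

theorem algebraMap_q_ne_zero (d : Datum M ℂ) : algebraMap ℂ[X] (RatFunc ℂ) d.q ≠ 0 :=
  RatFunc.algebraMap_ne_zero d.monic_q.ne_zero

/-- The set of singular points in `ℂ`. -/
def nodes (d : Datum M ℂ) : Finset ℂ := insert 0 (insert 1 (Finset.univ.image d.t))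

theorem prod_nodes (d : Datum M ℂ) (hd : d.Distinct) {B : Type*} [CommMonoid B] (f : ℂ → B) :
    ∏ c ∈ d.nodes, f c = f 0 * f 1 * ∏ k, f (d.t k) := by
  rw [nodes, Finset.prod_insert, Finset.prod_insert, Finset.prod_image hd.inj.injOn, mul_assoc]
  · simpa using fun k => hd.ne_one k
  · simpa using fun k => hd.ne_zero k

theorem card_nodes (d : Datum M ℂ) (hd : d.Distinct) : d.nodes.card = M + 2 := by
  rw [nodes, Finset.card_insert_of_notMem, Finset.card_insert_of_notMem,
    Finset.card_image_of_injective _ hd.inj, Finset.card_univ, Fintype.card_fin]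
  · simpa using fun k => hd.ne_one k
  · simpa using fun k => hd.ne_zero k

theorem prod_erase_eq_eval_derivative (s : Finset ℂ) (c : ℂ) (hc : c ∈ s) :
    ∏ j ∈ s.erase c, (c - j) = (derivative (∏ j ∈ s, (X - C j))).eval c := by
  rw [← Finset.mul_prod_erase _ _ hc, derivative_mul]
  simp [eval_prod]

theorem q_eq_prod_nodes (d : Datum M ℂ) (hd : d.Distinct) : d.q = ∏ c ∈ d.nodes, (X - C c) := by
  rw [prod_nodes d hd]; simp [q, T]

theorem eval_Tk_self_ne_zero (d : Datum M ℂ) (ht : Function.Injective d.t) (k : Fin M) :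
    (d.Tk k).eval (d.t k) ≠ 0 := by
  rw [Tk, eval_prod]
  refine Finset.prod_ne_zero_iff.2 fun j hj => ?_
  simpa [sub_eq_zero] using fun h => (Finset.mem_erase.1 hj).1 (ht h).symm

theorem eval_Tk_of_ne (d : Datum M A) {j k : Fin M} (h : j ≠ k) :
    (d.Tk k).eval (d.t j) = 0 := by
  rw [Tk, eval_prod]
  exact Finset.prod_eq_zero (Finset.mem_erase.2 ⟨h, Finset.mem_univ _⟩) (by simp)

theorem eval_T_t (d : Datum M A) (k : Fin M) : d.T.eval (d.t k) = 0 := by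
  rw [← d.X_sub_C_mul_Tk k]; simp

theorem eval_S_t (d : Datum M A) (k : Fin M) :
    d.S.eval (d.t k) = d.η k * (d.Tk k).eval (d.t k) := by
  rw [S, eval_add, eval_mul, eval_T_t, mul_zero, zero_add, eval_finsetSum, Finset.sum_eq_single k]
  · simp
  · intro j _ hj; simp [d.eval_Tk_of_ne hj.symm]
  · simp

theorem eval_mT_t (d : Datum M A) (k : Fin M) :
    d.mT.eval (d.t k) = d.m k * (d.Tk k).eval (d.t k) := by
  rw [mT, eval_finsetSum, Finset.sum_eq_single k]
  · simp
  · intro j _ hj; simp [d.eval_Tk_of_ne hj.symm]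
  · simp

theorem eval_T_ne_zero (d : Datum M ℂ) {c : ℂ} (h : ∀ k, d.t k ≠ c) : d.T.eval c ≠ 0 := by
  rw [T, eval_prod]
  refine Finset.prod_ne_zero_iff.2 fun j _ => ?_
  simpa [sub_eq_zero] using (h j).symm

theorem exponent_zero (d : Datum M ℂ) (hd : d.Distinct) :
    -d.p.eval 0 / d.q.derivative.eval 0 = -d.γ := by
  have := d.eval_T_ne_zero hd.ne_zero
  simp only [p, eval_sub, eval_add, eval_mul, eval_C, eval_X, eval_one, zero_sub, mul_neg, mul_one,
    neg_mul, mul_zero, zero_mul, add_zero, neg_zero, sub_zero, neg_neg, q, derivative_mul,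
    derivative_X, one_mul, derivative_sub, derivative_one]
  field_simp

theorem exponent_one (d : Datum M ℂ) (hd : d.Distinct) :
    -d.p.eval 1 / d.q.derivative.eval 1 = -d.δ := by
  have := d.eval_T_ne_zero hd.ne_one
  simp only [p, eval_sub, eval_add, eval_mul, eval_C, eval_X, eval_one, sub_self, mul_zero,
    zero_mul, mul_one, zero_add, sub_zero, q, derivative_mul, derivative_X, one_mul, derivative_sub,
    derivative_one, add_zero]
  field_simp

theorem exponent_t (d : Datum M ℂ) (hd : d.Distinct) (k : Fin M) :
    -d.p.eval (d.t k) / d.q.derivative.eval (d.t k) = d.m k := by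
  have h1 := d.eval_Tk_self_ne_zero hd.inj k
  have h2 := hd.ne_zero k
  have h3 := sub_ne_zero.2 (hd.ne_one k)
  have hT' : d.T.derivative.eval (d.t k) = (d.Tk k).eval (d.t k) := by
    rw [← d.X_sub_C_mul_Tk k, derivative_mul]; simp
  simp only [p, eval_sub, eval_add, eval_mul, eval_C, eval_X, eval_one, eval_T_t,
    mul_zero, add_zero, eval_mT_t, zero_sub, neg_neg, q, derivative_mul, derivative_X, one_mul,
    derivative_sub, derivative_one, sub_zero, mul_one, hT', zero_add]
  field_simp

theorem solvesRiccati_num_denom (d : Datum M ℂ) {v : RatFunc ℂ}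
    (hv : ddz v + v ^ 2 + d.P * v + d.Q = 0) : SolvesRiccati d.q d.p d.S v.num v.denom := by
  have he0 : algebraMap ℂ[X] (RatFunc ℂ) v.denom ≠ 0 :=
    RatFunc.algebraMap_ne_zero v.denom_ne_zero
  have hq0 := d.algebraMap_q_ne_zero
  apply RatFunc.algebraMap_injective ℂ
  rw [← RatFunc.num_div_denom v, ddz_div, ddz_algebraMap, ddz_algebraMap, P, Q] at hv
  simp only [map_add, map_mul, map_sub, map_pow, map_zero]
  field_simp at hv
  linear_combination hv

theorem exists_exponents_of_riccati (d : Datum M ℂ) (hd : d.Distinct) {v : RatFunc ℂ}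
    (hv : ddz v + v ^ 2 + d.P * v + d.Q = 0) :
    ∃ (r x₀ x₁ : ℂ) (k : ℕ), (r + d.α) * (r + d.β) = 0 ∧ (x₀ = 0 ∨ x₀ = -d.γ) ∧
      (x₁ = 0 ∨ x₁ = -d.δ) ∧ r = k + x₀ + x₁ := by
  have H := d.solvesRiccati_num_denom hv
  rw [d.q_eq_prod_nodes hd] at H
  obtain ⟨r, k, x, hr, hx, hk⟩ := H.exists_exponents (d.card_nodes hd) d.natDegree_p_le
    d.natDegree_S_le v.monic_denom v.isCoprime_num_denom
  rw [coeff_p, coeff_S] at hr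
  have hx' : ∀ c ∈ d.nodes, x c = 0 ∨ x c = -d.p.eval c / d.q.derivative.eval c := by
    intro c hc
    rw [d.q_eq_prod_nodes hd, ← prod_erase_eq_eval_derivative _ _ hc]
    exact hx c hc
  have hsum : ∑ c ∈ d.nodes, x c = x 0 + x 1 + ∑ k, x (d.t k) :=
    d.prod_nodes hd (B := Multiplicative ℂ) (fun c => Multiplicative.ofAdd (x c))
  have hnat : ∀ k, ∃ j : ℕ, x (d.t k) = j := fun k => by
    rcases hx' (d.t k) (by simp [nodes]) with h | h
    · exact ⟨0, by simpa using h⟩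
    · exact ⟨d.m k, by rw [h, d.exponent_t hd]⟩
  choose j hj using hnat
  refine ⟨r, x 0, x 1, k + ∑ k, j k, by linear_combination hr, ?_, ?_, ?_⟩
  · simpa only [d.exponent_zero hd] using hx' 0 (by simp [nodes])
  · simpa only [d.exponent_one hd] using hx' 1 (by simp [nodes])
  · rw [hk, hsum]
    simp only [hj]
    push_cast
    ring

theorem riccati_ne_zero (d : Datum M ℂ) (hd : d.Distinct) (hg : d.Generic) (v : RatFunc ℂ) :
    ddz v + v ^ 2 + d.P * v + d.Q ≠ 0 := by
  intro hv
  obtain ⟨r, x₀, x₁, k, hr, h0, h1, hk⟩ := d.exists_exponents_of_riccati hd hv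
  have hδ : d.δ = d.α + d.β - d.γ + d.N + 1 := rfl
  rcases mul_eq_zero.1 hr with h | h <;> rcases h0 with rfl | rfl <;> rcases h1 with rfl | rfl
  · exact hg.α_ne (-k) (by push_cast; linear_combination h - hk)
  · exact hg.βγ_ne (k - d.N - 1) (by push_cast; linear_combination hk - h - hδ)
  · exact hg.αγ_ne (-k) (by push_cast; linear_combination h - hk)
  · exact hg.β_ne (k - d.N - 1) (by push_cast; linear_combination hk - h - hδ)
  · exact hg.β_ne (-k) (by push_cast; linear_combination h - hk)
  · exact hg.αγ_ne (k - d.N - 1) (by push_cast; linear_combination hk - h - hδ)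
  · exact hg.βγ_ne (-k) (by push_cast; linear_combination h - hk)
  · exact hg.α_ne (k - d.N - 1) (by push_cast; linear_combination hk - h - hδ)

/-- For generic parameters no line in the differential module is invariant. -/
theorem wedge_nabla_ne_zero (d : Datum M ℂ) (hd : d.Distinct) (hg : d.Generic)
    {w : RatFunc ℂ × RatFunc ℂ} (hw : w ≠ 0) :
    w.1 * (nabla d.P d.Q w).2 - w.2 * (nabla d.P d.Q w).1 ≠ 0 := by
  obtain ⟨a, b⟩ := w
  simp only [nabla_apply]
  intro h
  by_cases hb : b = 0
  · subst hb
    have ha : a ≠ 0 := fun ha => hw (by simp [ha])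
    simp [ha] at h
  · apply d.riccati_ne_zero hd hg (-a / b)
    rw [ddz_div, map_neg]
    field_simp
    linear_combination h

end Datum

namespace Datum

variable {M : ℕ}

/-! ### The Riccati equation modulo powers of local parameters -/

/-- The linear polynomial `γ (z - 1) + δ z - 2 z + 1`. -/
def lin (d : Datum M ℂ) : ℂ[X] := C d.γ * (X - 1) + C d.δ * X - 2 * X + 1

/-- The product of all `(z - t_k) ^ m_k`. -/
def Pi (d : Datum M ℂ) : ℂ[X] := ∏ k, (X - C (d.t k)) ^ d.m k

/-- The Riccati expression of `z (z - 1) y' / y`, with denominators cleared. -/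
def ric (d : Datum M ℂ) (U : ℂ[X]) : ℂ[X] :=
  d.T * (X * (X - 1) * derivative U + U ^ 2 + d.lin * U) + X * (X - 1) * (d.S - U * d.mT)

/-- The singularity `t_k` is apparent: there is an approximate polynomial solution which does not
vanish there. -/
def ApparentAt (d : Datum M ℂ) (k : Fin M) : Prop :=
  ∃ f : ℂ[X], f.eval (d.t k) ≠ 0 ∧ (X - C (d.t k)) ^ (d.m k + 1) ∣
    d.q * derivative (derivative f) + d.p * derivative f + d.S * f

theorem p_eq_lin (d : Datum M ℂ) : d.p = (d.lin + 2 * X - 1) * d.T - X * (X - 1) * d.mT := by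
  rw [p, lin]; ring

theorem eval_lin_one (d : Datum M ℂ) : d.lin.eval 1 = d.δ - 1 := by
  simp only [lin, eval_add, eval_sub, eval_mul, eval_C, eval_X, eval_one, eval_ofNat]
  ring

theorem eval_q_t (d : Datum M ℂ) (k : Fin M) : d.q.eval (d.t k) = 0 := by
  rw [q, eval_mul, eval_T_t, mul_zero]

theorem eval_q_one (d : Datum M ℂ) : d.q.eval 1 = 0 := by simp [q]

theorem X_sub_C_pow_dvd_mul_derivative {K : Type*} [CommRing K] {q f : K[X]} {c : K} {n : ℕ}
    (hq : q.eval c = 0) (hf : (X - C c) ^ n ∣ f) : (X - C c) ^ n ∣ q * derivative f := by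
  cases n with
  | zero => simp
  | succ n =>
    have hf' : (X - C c) ^ n ∣ derivative f := by
      simpa only [Nat.add_sub_cancel] using pow_sub_one_dvd_derivative_of_pow_dvd hf
    rw [pow_succ']
    exact mul_dvd_mul (dvd_iff_isRoot.2 hq) hf'

theorem isCoprime_X_sub_C_pow {K : Type*} [Field K] {f : K[X]} {c : K} (hf : f.eval c ≠ 0)
    (n : ℕ) : IsCoprime ((X - C c) ^ n) f := by
  have hirr : Irreducible (X - C c) := irreducible_X_sub_C c
  exact IsCoprime.pow_left (hirr.coprime_iff_not_dvd.2 fun h => hf (dvd_iff_isRoot.1 h))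

theorem X_sub_C_pow_dvd_ric_sub_ric (d : Datum M ℂ) {U V : ℂ[X]} {c : ℂ} {n : ℕ}
    (hc : d.q.eval c = 0) (h : (X - C c) ^ n ∣ U - V) : (X - C c) ^ n ∣ d.ric U - d.ric V := by
  have heq : d.ric U - d.ric V = d.q * derivative (U - V)
      + (U - V) * (d.T * (U + V + d.lin) - X * (X - 1) * d.mT) := by
    rw [ric, ric, q, derivative_sub]; ring
  rw [heq]
  exact dvd_add (X_sub_C_pow_dvd_mul_derivative hc h) (h.mul_right _)

theorem ApparentAt.exists_pow_dvd_ric {d : Datum M ℂ} {k : Fin M} (h : d.ApparentAt k) :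
    ∃ U, (X - C (d.t k)) ^ (d.m k + 1) ∣ d.ric U := by
  obtain ⟨f, hf, hL⟩ := h
  have hcop := isCoprime_X_sub_C_pow hf (d.m k + 1)
  obtain ⟨U, hU⟩ : ∃ U, (X - C (d.t k)) ^ (d.m k + 1) ∣ f * U - X * (X - 1) * derivative f := by
    obtain ⟨a, b, hab⟩ := hcop
    refine ⟨b * (X * (X - 1) * derivative f), -(a * (X * (X - 1) * derivative f)), ?_⟩
    linear_combination X * (X - 1) * derivative f * hab
  refine ⟨U, IsCoprime.dvd_of_dvd_mul_left (hcop.pow_right (n := 2)) ?_⟩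
  -- `U` approximates `z (z - 1) f' / f`, for which the identity below has only its first summand.
  have heq : f ^ 2 * d.ric U
      = X * (X - 1) * f * (d.q * derivative (derivative f) + d.p * derivative f + d.S * f)
        + f * (d.q * derivative (f * U - X * (X - 1) * derivative f))
        + (f * U - X * (X - 1) * derivative f) * (-d.q * derivative f
          + d.T * (f * U + X * (X - 1) * derivative f + d.lin * f) - X * (X - 1) * f * d.mT) := by
    simp only [ric, q, p_eq_lin, derivative_sub, derivative_mul, derivative_X, derivative_one]
    ring
  rw [heq]
  exact dvd_add (dvd_add (hL.mul_left _)
    ((X_sub_C_pow_dvd_mul_derivative (d.eval_q_t k) hU).mul_left _)) (hU.mul_right _)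

theorem ric_add_C_mul_X_sub_one_pow (d : Datum M ℂ) (U : ℂ[X]) (c : ℂ) (n : ℕ) :
    d.ric (U + C c * (X - 1) ^ (n + 1)) = d.ric U + (X - 1) ^ (n + 1) *
      (C c * d.T * (((n : ℂ[X]) + 1) * X + 2 * U + C c * (X - 1) ^ (n + 1) + d.lin)
        - C c * X * (X - 1) * d.mT) := by
  have hderiv : derivative ((X - 1 : ℂ[X]) ^ (n + 1)) = ((n : ℂ[X]) + 1) * (X - 1) ^ n := by
    simpa using derivative_X_sub_C_pow (1 : ℂ) (n + 1)
  rw [ric, ric, derivative_add, derivative_C_mul, hderiv]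
  ring

theorem exists_X_sub_one_pow_dvd_ric (d : Datum M ℂ) (hd : d.Distinct) (hδ : ∀ n : ℤ, d.δ ≠ n)
    (n : ℕ) : ∃ U : ℂ[X], U.eval 1 = 1 - d.δ ∧ (X - C 1) ^ (n + 1) ∣ d.ric U := by
  have hT : d.T.eval 1 ≠ 0 := d.eval_T_ne_zero hd.ne_one
  induction n with
  | zero =>
    refine ⟨C (1 - d.δ), by simp, ?_⟩
    rw [zero_add, pow_one, dvd_iff_isRoot, IsRoot.def]
    simp only [ric, eval_add, eval_mul, eval_sub, eval_X, eval_one, eval_pow, eval_C, eval_lin_one,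
      sub_self, mul_zero, zero_mul, add_zero, zero_add]
    ring
  | succ n ih =>
    obtain ⟨U, hU, s, hs⟩ := ih
    have hne : (n : ℂ) + 2 - d.δ ≠ 0 := fun h =>
      hδ (n + 2) (by push_cast; linear_combination -h)
    set c := -s.eval 1 / (d.T.eval 1 * ((n : ℂ) + 2 - d.δ)) with hc
    refine ⟨U + C c * (X - 1) ^ (n + 1), by simp [hU], ?_⟩
    rw [ric_add_C_mul_X_sub_one_pow, hs, map_one, ← mul_add, pow_succ _ (n + 1)]
    refine mul_dvd_mul_left _ ?_
    rw [← map_one C, dvd_iff_isRoot, IsRoot.def]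
    simp only [map_one, eval_add, eval_sub, eval_mul, eval_X, eval_one, sub_self, mul_zero,
      zero_mul, sub_zero, eval_C, eval_pow, eval_lin_one, hU, eval_natCast, eval_ofNat]
    rw [zero_pow (by omega), hc]
    field_simp
    ring

theorem exists_forall_X_sub_C_pow_dvd_sub {K ι : Type*} [Field K] [Finite ι] {c : ι → K}
    (hc : Function.Injective c) (e : ι → ℕ) (g : ι → K[X]) :
    ∃ U, ∀ i, (X - C (c i)) ^ e i ∣ U - g i := by
  obtain ⟨U, hU⟩ := Ideal.exists_forall_sub_mem_ideal
    (I := fun i => Ideal.span {(X - C (c i)) ^ e i})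
    (fun i j hij => (Ideal.isCoprime_span_singleton_iff _ _).2
      (pairwise_coprime_X_sub_C hc hij).pow) g
  exact ⟨U, fun i => Ideal.mem_span_singleton.1 (hU i)⟩

theorem exists_ric_eq_mul (d : Datum M ℂ) (hd : d.Distinct) (hδ : ∀ n : ℤ, d.δ ≠ n)
    (ha : ∀ k, d.ApparentAt k) :
    ∃ U V : ℂ[X], U.eval 1 = 1 - d.δ ∧ d.ric U = d.T * (d.Pi * (X - 1) ^ d.N) * V := by
  choose u hu using fun k => (ha k).exists_pow_dvd_ric
  obtain ⟨U₁, hU₁, hr₁⟩ := d.exists_X_sub_one_pow_dvd_ric hd hδ d.N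
  let c : Option (Fin M) → ℂ := fun o => o.elim 1 d.t
  let e : Option (Fin M) → ℕ := fun o => o.elim (d.N + 1) fun k => d.m k + 1
  let g : Option (Fin M) → ℂ[X] := fun o => o.elim U₁ u
  have hc : Function.Injective c := by
    rintro (_ | i) (_ | j) h
    · rfl
    · exact absurd h.symm (hd.ne_one j)
    · exact absurd h (hd.ne_one i)
    · exact congrArg _ (hd.inj h)
  have hqc : ∀ o, d.q.eval (c o) = 0 := fun o => o.casesOn d.eval_q_one d.eval_q_t
  have hg : ∀ o, (X - C (c o)) ^ e o ∣ d.ric (g o) := fun o => o.casesOn hr₁ hu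
  obtain ⟨U, hU⟩ := exists_forall_X_sub_C_pow_dvd_sub hc e g
  have hdvd : ∏ o, (X - C (c o)) ^ e o ∣ d.ric U :=
    Finset.prod_dvd_of_coprime
      (fun i _ j _ hij => (pairwise_coprime_X_sub_C hc hij).pow) fun o _ => by
        simpa using dvd_add (d.X_sub_C_pow_dvd_ric_sub_ric (hqc o) (hU o)) (hg o)
  have hprod : ∏ o, (X - C (c o)) ^ e o = d.T * (d.Pi * (X - 1) ^ d.N) * (X - 1) := by
    simp only [Fintype.prod_option, c, e, Option.elim, map_one, T, Pi, pow_succ,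
      Finset.prod_mul_distrib]
    ring
  obtain ⟨V, hV⟩ := (Dvd.intro _ hprod.symm).trans hdvd
  refine ⟨U, V, ?_, hV⟩
  have hroot := dvd_iff_isRoot.1 ((dvd_pow_self _ d.N.succ_ne_zero).trans (hU none))
  rw [IsRoot.def, eval_sub, sub_eq_zero] at hroot
  exact hroot.trans hU₁

end Datum

namespace Datum

variable {M : ℕ}

/-! ### A polynomial lattice in the module -/

theorem monic_Pi (d : Datum M ℂ) : d.Pi.Monic :=
  monic_prod_of_monic _ _ fun _ _ => (monic_X_sub_C _).pow _

theorem natDegree_Pi (d : Datum M ℂ) : d.Pi.natDegree = d.N := by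
  rw [Pi, natDegree_prod_of_monic _ _ fun _ _ => (monic_X_sub_C _).pow _]
  simp [N]

theorem T_mul_derivative_Pi (d : Datum M ℂ) : d.T * derivative d.Pi = d.mT * d.Pi := by
  rw [Pi, derivative_prod_finset, Finset.mul_sum, mT, Finset.sum_mul]
  refine Finset.sum_congr rfl fun k _ => ?_
  rw [← d.X_sub_C_mul_Tk k, derivative_X_sub_C_pow,
    ← Finset.mul_prod_erase _ _ (Finset.mem_univ k)]
  cases d.m k with
  | zero => simp
  | succ n =>
    rw [Nat.add_sub_cancel, pow_succ, map_natCast]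
    ring

theorem X_sub_one_mul_derivative_pow (i : ℕ) :
    (X - 1) * derivative ((X - 1 : ℂ[X]) ^ i) = (i : ℂ[X]) * (X - 1) ^ i := by
  have h := derivative_X_sub_C_pow (1 : ℂ) i
  rw [map_one] at h
  cases i with
  | zero => simp
  | succ n =>
    rw [h, Nat.add_sub_cancel, map_natCast]
    ring

theorem monic_X_sub_one : (X - 1 : ℂ[X]).Monic := by simpa using monic_X_sub_C (1 : ℂ)

theorem natDegree_X_sub_one : (X - 1 : ℂ[X]).natDegree = 1 := by
  simpa using natDegree_X_sub_C (1 : ℂ)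

theorem X_sub_one_ne_zero : (X - 1 : ℂ[X]) ≠ 0 := monic_X_sub_one.ne_zero

theorem ratFunc_X_sub_one_ne_zero : (RatFunc.X - 1 : RatFunc ℂ) ≠ 0 := by
  simpa using RatFunc.algebraMap_ne_zero X_sub_one_ne_zero

/-- The element `A y / Π + z (z - 1) B y' / Π` of the module. -/
def iota (d : Datum M ℂ) (A B : ℂ[X]) : RatFunc ℂ × RatFunc ℂ :=
  (algebraMap ℂ[X] (RatFunc ℂ) A / algebraMap ℂ[X] (RatFunc ℂ) d.Pi,
    algebraMap ℂ[X] (RatFunc ℂ) (X * (X - 1) * B) / algebraMap ℂ[X] (RatFunc ℂ) d.Pi)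

theorem iota_add (d : Datum M ℂ) (A B A' B' : ℂ[X]) :
    d.iota (A + A') (B + B') = d.iota A B + d.iota A' B' := by
  ext <;> simp [iota] <;> ring

theorem iota_mul (d : Datum M ℂ) (f A B : ℂ[X]) :
    d.iota (f * A) (f * B) = algebraMap ℂ[X] (RatFunc ℂ) f • d.iota A B := by
  ext
  · simp only [iota, map_mul, Prod.smul_fst, smul_eq_mul, mul_div_assoc]
  · simp only [iota, map_mul, Prod.smul_snd, smul_eq_mul]
    ring

theorem iota_ne_zero (d : Datum M ℂ) {A B : ℂ[X]} (h : A ≠ 0 ∨ B ≠ 0) : d.iota A B ≠ 0 := by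
  intro h0
  have hPi := RatFunc.algebraMap_ne_zero d.monic_Pi.ne_zero
  have h1 := congrArg Prod.fst h0
  have h2 := congrArg Prod.snd h0
  simp only [iota, Prod.fst_zero, Prod.snd_zero, div_eq_zero_iff, hPi, or_false,
    map_eq_zero_iff _ (RatFunc.algebraMap_injective ℂ), mul_eq_zero, X_ne_zero,
    X_sub_one_ne_zero, false_or] at h1 h2
  tauto

/-- `z (z - 1) d/dz` sends `iota A B` to `iota A' B'`. -/
structure IsStep (d : Datum M ℂ) (A B A' B' : ℂ[X]) : Prop where
  fst : d.T * A' = d.T * (X * (X - 1) * derivative A) - X * (X - 1) * d.mT * A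
    - X * (X - 1) * d.S * B
  snd : B' = A + X * (X - 1) * derivative B - d.lin * B

theorem ddz_div_Pi (d : Datum M ℂ) (f : ℂ[X]) :
    ddz (algebraMap ℂ[X] (RatFunc ℂ) f / algebraMap ℂ[X] (RatFunc ℂ) d.Pi)
      = algebraMap ℂ[X] (RatFunc ℂ) (d.T * derivative f - d.mT * f)
        / (algebraMap ℂ[X] (RatFunc ℂ) d.T * algebraMap ℂ[X] (RatFunc ℂ) d.Pi) := by
  have hPi := RatFunc.algebraMap_ne_zero d.monic_Pi.ne_zero
  have hT := RatFunc.algebraMap_ne_zero d.monic_T.ne_zero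
  have hderiv := congrArg (algebraMap ℂ[X] (RatFunc ℂ)) d.T_mul_derivative_Pi
  rw [map_mul, map_mul] at hderiv
  rw [ddz_div, ddz_algebraMap, ddz_algebraMap, map_sub, map_mul, map_mul]
  field_simp
  linear_combination -algebraMap ℂ[X] (RatFunc ℂ) f * hderiv

theorem IsStep.fst_nabla_iota {d : Datum M ℂ} {A B A' B' : ℂ[X]} (h : d.IsStep A B A' B') :
    algebraMap ℂ[X] (RatFunc ℂ) (X * (X - 1)) * (nabla d.P d.Q (d.iota A B)).1
      = (d.iota A' B').1 := by
  have hPi := RatFunc.algebraMap_ne_zero d.monic_Pi.ne_zero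
  have hT := RatFunc.algebraMap_ne_zero d.monic_T.ne_zero
  have he := RatFunc.algebraMap_ne_zero (mul_ne_zero X_ne_zero X_sub_one_ne_zero)
  have hfst := congrArg (algebraMap ℂ[X] (RatFunc ℂ)) h.fst
  simp only [nabla_apply, iota, ddz_div_Pi, Q, q]
  generalize X * (X - 1 : ℂ[X]) = e at he hfst ⊢
  simp only [map_mul, map_sub] at hfst ⊢
  field_simp
  linear_combination -hfst

theorem IsStep.snd_nabla_iota {d : Datum M ℂ} {A B A' B' : ℂ[X]} (h : d.IsStep A B A' B') :
    algebraMap ℂ[X] (RatFunc ℂ) (X * (X - 1)) * (nabla d.P d.Q (d.iota A B)).2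
      = (d.iota A' B').2 := by
  have hPi := RatFunc.algebraMap_ne_zero d.monic_Pi.ne_zero
  have hT := RatFunc.algebraMap_ne_zero d.monic_T.ne_zero
  have he := RatFunc.algebraMap_ne_zero (mul_ne_zero X_ne_zero X_sub_one_ne_zero)
  have hderiv : derivative (X * (X - 1) * B) = (2 * X - 1) * B + X * (X - 1) * derivative B := by
    simp only [derivative_mul, derivative_sub, derivative_X, derivative_one]
    ring
  simp only [nabla_apply, iota, ddz_div_Pi, hderiv, h.snd, P, q, p_eq_lin]
  generalize X * (X - 1 : ℂ[X]) = e at he ⊢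
  simp only [map_mul, map_sub, map_add]
  field_simp
  ring

theorem IsStep.nabla_iota {d : Datum M ℂ} {A B A' B' : ℂ[X]} (h : d.IsStep A B A' B') :
    algebraMap ℂ[X] (RatFunc ℂ) (X * (X - 1)) • nabla d.P d.Q (d.iota A B) = d.iota A' B' :=
  Prod.ext h.fst_nabla_iota h.snd_nabla_iota

/-- The pairs `(A, B)` with `A + U B` divisible by `Π (z - 1) ^ i` are stable under
`z (z - 1) d/dz`, and `D` is the quotient. -/
theorem exists_isStep (d : Datum M ℂ) {U V : ℂ[X]} {i : ℕ}
    (hV : d.ric U = d.T * (d.Pi * (X - 1) ^ i) * V) {A B D : ℂ[X]}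
    (hA : A = d.Pi * (X - 1) ^ i * D - U * B) :
    ∃ A' B' D', d.IsStep A B A' B' ∧ A' = d.Pi * (X - 1) ^ i * D' - U * B' ∧
      D' = X * (X - 1) * derivative D + (U + (i : ℂ[X]) * X) * D - V * B := by
  refine ⟨_, _, _, ⟨?_, rfl⟩, rfl, rfl⟩
  have h1 := d.T_mul_derivative_Pi
  have h2 := X_sub_one_mul_derivative_pow i
  subst hA
  rw [ric] at hV
  simp only [derivative_sub, derivative_mul]
  linear_combination B * hV - (X * (X - 1) * (X - 1) ^ i * D) * h1 - d.T * X * d.Pi * D * h2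

theorem lin_eq (d : Datum M ℂ) : d.lin = C (d.γ + d.δ - 2) * X + C (1 - d.γ) := by
  simp only [lin, map_sub, map_add, C_ofNat, map_one]
  ring

theorem natDegree_lin_le (d : Datum M ℂ) : d.lin.natDegree ≤ 1 :=
  d.lin_eq ▸ natDegree_linear_le

theorem coeff_lin (d : Datum M ℂ) : d.lin.coeff 1 = d.α + d.β + d.N - 1 := by
  rw [lin_eq, coeff_add, coeff_C_mul, coeff_X_one, coeff_C_of_ne_zero one_ne_zero, δ]
  ring

theorem natDegree_X_mul_X_sub_one_le : (X * (X - 1) : ℂ[X]).natDegree ≤ 2 :=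
  natDegree_mul_le_of_le natDegree_X_le natDegree_X_sub_one.le

theorem coeff_X_mul_X_sub_one : (X * (X - 1) : ℂ[X]).coeff 2 = 1 := by
  rw [show 2 = 1 + 1 from rfl, coeff_X_mul]
  simp [coeff_one]

theorem natDegree_X_mul_X_sub_one_mul_derivative_le {A : ℂ[X]} {n : ℕ} (hA : A.natDegree ≤ n) :
    (X * (X - 1) * derivative A).natDegree ≤ n + 1 := by
  rcases n.eq_zero_or_pos with rfl | hn
  · rw [derivative_of_natDegree_zero (Nat.le_zero.1 hA)]
    simp
  · have h := (natDegree_derivative_le A).trans (Nat.sub_le_sub_right hA 1)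
    exact (natDegree_mul_le_of_le natDegree_X_mul_X_sub_one_le h).trans (by omega)

theorem coeff_X_mul_X_sub_one_mul_derivative {A : ℂ[X]} {n : ℕ} (hA : A.natDegree ≤ n) :
    (X * (X - 1) * derivative A).coeff (n + 1) = n * A.coeff n := by
  cases n with
  | zero =>
    rw [derivative_of_natDegree_zero (Nat.le_zero.1 hA)]
    simp
  | succ n =>
    have h : (derivative A).natDegree ≤ n :=
      (natDegree_derivative_le A).trans (Nat.sub_le_sub_right hA 1)
    rw [show n + 1 + 1 = 2 + n by ring,
      coeff_mul_add_eq_of_natDegree_le natDegree_X_mul_X_sub_one_le h, coeff_X_mul_X_sub_one,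
      coeff_derivative]
    push_cast
    ring

theorem coeff_X_mul_X_sub_one_mul_mT (d : Datum M ℂ) :
    (X * (X - 1) * d.mT).coeff (M + 1) = (d.N : ℂ) := by
  cases M with
  | zero => simp [mT, N]
  | succ M =>
    have h : d.mT.natDegree ≤ M := d.natDegree_mT_le
    rw [show M + 1 + 1 = 2 + M by ring,
      coeff_mul_add_eq_of_natDegree_le natDegree_X_mul_X_sub_one_le h,
      coeff_X_mul_X_sub_one, one_mul]
    exact d.coeff_mT

theorem natDegree_X_mul_X_sub_one_mul_S_le (d : Datum M ℂ) :
    (X * (X - 1) * d.S).natDegree ≤ M + 2 :=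
  (natDegree_mul_le_of_le natDegree_X_mul_X_sub_one_le d.natDegree_S_le).trans (add_comm 2 M).le

theorem coeff_X_mul_X_sub_one_mul_S (d : Datum M ℂ) :
    (X * (X - 1) * d.S).coeff (M + 2) = d.α * d.β := by
  rw [add_comm M 2, coeff_mul_add_eq_of_natDegree_le natDegree_X_mul_X_sub_one_le
    d.natDegree_S_le, coeff_X_mul_X_sub_one, coeff_S, one_mul]

section IsStep

variable {d : Datum M ℂ} {A B A' B' : ℂ[X]} {n : ℕ}

theorem IsStep.natDegree_snd_le (h : d.IsStep A B A' B') (hA : A.natDegree ≤ n + 1)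
    (hB : B.natDegree ≤ n) : B'.natDegree ≤ n + 1 := by
  rw [h.snd]
  refine (natDegree_sub_le _ _).trans (max_le ((natDegree_add_le _ _).trans (max_le hA
    (natDegree_X_mul_X_sub_one_mul_derivative_le hB))) ?_)
  exact (natDegree_mul_le_of_le d.natDegree_lin_le hB).trans (add_comm 1 n).le

theorem IsStep.coeff_snd (h : d.IsStep A B A' B') (hB : B.natDegree ≤ n) :
    B'.coeff (n + 1) = A.coeff (n + 1) + (n - (d.α + d.β + d.N - 1)) * B.coeff n := by
  rw [h.snd, coeff_sub, coeff_add, coeff_X_mul_X_sub_one_mul_derivative hB, add_comm n 1,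
    coeff_mul_add_eq_of_natDegree_le d.natDegree_lin_le hB, coeff_lin]
  ring

theorem IsStep.natDegree_fst_le (h : d.IsStep A B A' B') (hA : A.natDegree ≤ n + 1)
    (hB : B.natDegree ≤ n) : A'.natDegree ≤ n + 2 := by
  have hT : (d.T * A').natDegree ≤ M + (n + 2) := by
    have hderiv := natDegree_X_mul_X_sub_one_mul_derivative_le hA
    have hTdeg := d.natDegree_T
    have hmT := d.natDegree_X_mul_X_sub_one_mul_mT_le
    have hS := d.natDegree_X_mul_X_sub_one_mul_S_le
    rw [h.fst]
    refine (natDegree_sub_le _ _).trans (max_le ((natDegree_sub_le _ _).trans (max_le ?_ ?_)) ?_)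
      <;> exact natDegree_mul_le.trans (by omega)
  by_cases h0 : A' = 0
  · simp [h0]
  · rw [d.monic_T.natDegree_mul' h0, natDegree_T] at hT
    omega

theorem IsStep.coeff_fst (h : d.IsStep A B A' B') (hA : A.natDegree ≤ n + 1)
    (hB : B.natDegree ≤ n) :
    A'.coeff (n + 2) = (n + 1 - d.N) * A.coeff (n + 1) - d.α * d.β * B.coeff n := by
  have hc := congrArg (fun f => coeff f (M + (n + 2))) h.fst
  simp only [coeff_sub] at hc
  rw [coeff_mul_add_eq_of_natDegree_le d.natDegree_T.le (h.natDegree_fst_le hA hB),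
    coeff_mul_add_eq_of_natDegree_le d.natDegree_T.le
      (natDegree_X_mul_X_sub_one_mul_derivative_le hA),
    coeff_X_mul_X_sub_one_mul_derivative hA, coeff_T,
    show M + (n + 2) = (M + 1) + (n + 1) by ring,
    coeff_mul_add_eq_of_natDegree_le d.natDegree_X_mul_X_sub_one_mul_mT_le hA,
    coeff_X_mul_X_sub_one_mul_mT, show M + 1 + (n + 1) = (M + 2) + n by ring,
    coeff_mul_add_eq_of_natDegree_le d.natDegree_X_mul_X_sub_one_mul_S_le hB,
    coeff_X_mul_X_sub_one_mul_S] at hc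
  push_cast at hc
  linear_combination hc

end IsStep

theorem finrank_degreeLT (n : ℕ) : Module.finrank ℂ (degreeLT ℂ n) = n := by
  rw [(degreeLTEquiv ℂ n).finrank_eq, Module.finrank_fin_fun]

theorem mem_degreeLT_succ_iff {n : ℕ} {A : ℂ[X]} : A ∈ degreeLT ℂ (n + 1) ↔ A.natDegree ≤ n := by
  rw [degreeLT_succ_eq_degreeLE, mem_degreeLE, natDegree_le_iff_degree_le]

/-- The residues modulo `Om` form a space of dimension `2 (n + 1)`, one less than that of the
pairs `(A, B)`. -/
theorem exists_eq_mul_sub_mul {Om : ℂ[X]} (U : ℂ[X]) (hOm : Om.Monic) {n : ℕ}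
    (hdeg : Om.natDegree = 2 * (n + 1)) :
    ∃ A B D : ℂ[X], (A ≠ 0 ∨ B ≠ 0) ∧ A.natDegree ≤ n + 1 ∧ B.natDegree ≤ n ∧
      A = Om * D - U * B := by
  let φ : (degreeLT ℂ (n + 2) × degreeLT ℂ (n + 1)) →ₗ[ℂ] degreeLT ℂ (2 * (n + 1)) :=
    LinearMap.codRestrict _ ((modByMonicHom Om).comp
      ((degreeLT ℂ (n + 2)).subtype.coprod
        ((LinearMap.mulLeft ℂ U).comp (degreeLT ℂ (n + 1)).subtype))) fun w => by
      rw [mem_degreeLT, ← hdeg, ← degree_eq_natDegree hOm.ne_zero]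
      exact degree_modByMonic_lt _ hOm
  have hker : LinearMap.ker φ ≠ ⊥ := LinearMap.ker_ne_bot_of_finrank_lt (by
    rw [Module.finrank_prod, finrank_degreeLT, finrank_degreeLT, finrank_degreeLT]
    omega)
  obtain ⟨⟨A, B⟩, hw, hne⟩ := (Submodule.ne_bot_iff _).1 hker
  have hmod : (A.1 + U * B.1) %ₘ Om = 0 := congrArg Subtype.val (LinearMap.mem_ker.1 hw)
  obtain ⟨D, hD⟩ := (modByMonic_eq_zero_iff_dvd hOm).1 hmod
  refine ⟨A.1, B.1, D, ?_, mem_degreeLT_succ_iff.1 A.2, mem_degreeLT_succ_iff.1 B.2, ?_⟩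
  · by_contra! h
    exact hne (Prod.ext (Subtype.ext h.1) (Subtype.ext h.2))
  · linear_combination hD

theorem X_mul_X_sub_one_dvd {f : ℂ[X]} (h0 : f.eval 0 = 0) (h1 : f.eval 1 = 0) :
    X * (X - 1) ∣ f := by
  have hc : IsCoprime (X - C (0 : ℂ)) (X - C (1 : ℂ)) :=
    isCoprime_X_sub_C_of_isUnit_sub (by simp)
  simpa using hc.mul_dvd (dvd_iff_isRoot.2 h0) (dvd_iff_isRoot.2 h1)

end Datum

namespace Datum

variable {M : ℕ}

/-! ### The hypergeometric section -/

/-- The action of `z d/dz` on the module of `d`. -/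
abbrev θ (d : Datum M ℂ) : Module.End ℂ (RatFunc ℂ × RatFunc ℂ) := theta d.P d.Q

theorem IsStep.θ_iota {d : Datum M ℂ} {A B A' B' : ℂ[X]} (h : d.IsStep A B A' B') :
    (RatFunc.X - 1 : RatFunc ℂ) • d.θ (d.iota A B) = d.iota A' B' := by
  rw [← h.nabla_iota, theta_apply, smul_smul, map_mul, map_sub, map_one, RatFunc.algebraMap_X,
    mul_comm]

theorem IsStep.mul_sub_mul_ne_zero {d : Datum M ℂ} (hd : d.Distinct) (hg : d.Generic)
    {A B A' B' : ℂ[X]} (h : d.IsStep A B A' B') (hne : A ≠ 0 ∨ B ≠ 0) :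
    A * B' - A' * B ≠ 0 := by
  intro h0
  refine d.wedge_nabla_ne_zero hd hg (d.iota_ne_zero hne) ?_
  have he := RatFunc.algebraMap_ne_zero (mul_ne_zero X_ne_zero X_sub_one_ne_zero)
  have h1 := congrArg (algebraMap ℂ[X] (RatFunc ℂ)) h0
  have hfst := h.fst_nabla_iota
  have hsnd := h.snd_nabla_iota
  refine mul_left_cancel₀ he ?_
  simp only [iota] at hfst hsnd ⊢
  generalize X * (X - 1 : ℂ[X]) = e at he hfst hsnd ⊢
  simp only [map_sub, map_mul, map_zero] at h1 hfst hsnd ⊢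
  linear_combination (algebraMap ℂ[X] (RatFunc ℂ) A / algebraMap ℂ[X] (RatFunc ℂ) d.Pi) * hsnd
    - (algebraMap ℂ[X] (RatFunc ℂ) e * algebraMap ℂ[X] (RatFunc ℂ) B
      / algebraMap ℂ[X] (RatFunc ℂ) d.Pi) * hfst
    + (algebraMap ℂ[X] (RatFunc ℂ) e / algebraMap ℂ[X] (RatFunc ℂ) d.Pi ^ 2) * h1

theorem aeval_θ_ne_zero (d : Datum M ℂ) (hd : d.Distinct) (hg : d.Generic) {g : ℂ[X]}
    (hg0 : g ≠ 0) {w : RatFunc ℂ × RatFunc ℂ} (hw : w ≠ 0) : aeval d.θ g w ≠ 0 := by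
  induction hn : g.natDegree generalizing g with
  | zero =>
    obtain ⟨c, rfl⟩ := natDegree_eq_zero.1 hn
    rw [aeval_C, Module.algebraMap_end_apply]
    exact smul_ne_zero (C_ne_zero.1 hg0) hw
  | succ n ih =>
    obtain ⟨a, ha⟩ := IsAlgClosed.exists_root g fun h => by
      have := natDegree_eq_zero_iff_degree_le_zero.2 h.le
      omega
    obtain ⟨h, rfl⟩ := dvd_iff_isRoot.2 ha
    have h0 : h ≠ 0 := right_ne_zero_of_mul hg0
    rw [(monic_X_sub_C a).natDegree_mul' h0, natDegree_X_sub_C] at hn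
    have hG := ih h0 (by omega)
    intro hzero
    refine d.wedge_nabla_ne_zero hd hg hG (mul_left_cancel₀ (RatFunc.X_ne_zero (K := ℂ)) ?_)
    rw [sub_eq_add_neg, ← map_neg C, aeval_theta_X_add_C_mul_apply, theta_apply] at hzero
    set G := aeval d.θ h w
    have hfst := congrArg Prod.fst hzero
    have hsnd := congrArg Prod.snd hzero
    simp only [Prod.fst_add, Prod.snd_add, Prod.smul_fst, Prod.smul_snd, smul_eq_mul,
      Prod.fst_zero, Prod.snd_zero] at hfst hsnd
    linear_combination G.1 * hsnd - G.2 * hfst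

/-- If `f₁, f₂` stand for the images of `f` under `z (z - 1) d/dz` and its square, this is the image
of `f` under `(z - 1) (z (θ + α) (θ + β) - θ (θ + γ - 1))` with `θ = z d/dz`. -/
def hyp (d : Datum M ℂ) (f₂ f₁ f : ℂ[X]) : ℂ[X] :=
  f₂ + (d.lin - (d.N : ℂ[X]) * X) * f₁ + C (d.α * d.β) * (X * (X - 1)) * f

theorem lin_sub_eq (d : Datum M ℂ) :
    d.lin - (d.N : ℂ[X]) * X = C (d.α + d.β - 1) * X + C (1 - d.γ) := by
  simp only [lin, δ, map_add, map_sub, map_one, map_natCast]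
  ring

theorem IsStep.iota_hyp {d : Datum M ℂ} {A B A₁ B₁ A₂ B₂ : ℂ[X]} (h : d.IsStep A B A₁ B₁)
    (h' : d.IsStep A₁ B₁ A₂ B₂) :
    d.iota (d.hyp A₂ A₁ A) (d.hyp B₂ B₁ B) = (RatFunc.X - 1 : RatFunc ℂ) •
      ((RatFunc.X : RatFunc ℂ) • aeval d.θ ((X + C d.α) * (X + C d.β)) (d.iota A B)
        - aeval d.θ (X * (X + C (d.γ - 1))) (d.iota A B)) := by
  have hmul : X * (X + C (d.γ - 1)) = (X + C (d.γ - 1)) * X := mul_comm _ _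
  rw [hyp, hyp, iota_add, iota_add, iota_mul, iota_mul, ← h'.θ_iota, ← h.θ_iota, lin_sub_eq,
    theta_smul, hmul, aeval_theta_X_add_C_mul_apply, aeval_theta_X_add_C_mul_apply,
    aeval_theta_X_add_C_apply, aeval_X]
  simp only [map_add, map_sub, map_mul, map_one, theta_smul, RatFunc.algebraMap_X,
    RatFunc.algebraMap_C, ddz_X, ddz_one, ddz_C]
  ext <;> simp only [Prod.fst_add, Prod.snd_add, Prod.fst_sub, Prod.snd_sub, Prod.smul_fst,
    Prod.smul_snd, smul_eq_mul] <;> ring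

section HypDegree

variable {f₂ f₁ f : ℂ[X]} {k : ℕ}

theorem natDegree_hyp_le (d : Datum M ℂ) (h₂ : f₂.natDegree ≤ k + 2) (h₁ : f₁.natDegree ≤ k + 1)
    (h : f.natDegree ≤ k) : (d.hyp f₂ f₁ f).natDegree ≤ k + 2 := by
  have hlin : (d.lin - (d.N : ℂ[X]) * X).natDegree ≤ 1 := d.lin_sub_eq ▸ natDegree_linear_le
  have hquad : (C (d.α * d.β) * (X * (X - 1))).natDegree ≤ 2 :=
    (natDegree_C_mul_le _ _).trans natDegree_X_mul_X_sub_one_le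
  exact (natDegree_add_le _ _).trans (max_le ((natDegree_add_le _ _).trans (max_le h₂
    (natDegree_mul_le.trans (by omega)))) (natDegree_mul_le.trans (by omega)))

theorem coeff_hyp (d : Datum M ℂ) (h₁ : f₁.natDegree ≤ k + 1) (h : f.natDegree ≤ k) :
    (d.hyp f₂ f₁ f).coeff (k + 2) = f₂.coeff (k + 2) + (d.α + d.β - 1) * f₁.coeff (k + 1)
      + d.α * d.β * f.coeff k := by
  have hlin : (d.lin - (d.N : ℂ[X]) * X).natDegree ≤ 1 := d.lin_sub_eq ▸ natDegree_linear_le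
  have hquad : (C (d.α * d.β) * (X * (X - 1))).natDegree ≤ 2 :=
    (natDegree_C_mul_le _ _).trans natDegree_X_mul_X_sub_one_le
  rw [hyp, coeff_add, coeff_add, show k + 2 = 1 + (k + 1) by ring,
    coeff_mul_add_eq_of_natDegree_le hlin h₁, show 1 + (k + 1) = 2 + k by ring,
    coeff_mul_add_eq_of_natDegree_le hquad h, lin_sub_eq, coeff_add, coeff_C_mul, coeff_C_mul,
    coeff_X_one, coeff_C_of_ne_zero one_ne_zero, coeff_X_mul_X_sub_one, add_zero, mul_one, mul_one]

variable {d : Datum M ℂ} {A B A₁ B₁ A₂ B₂ : ℂ[X]} {n : ℕ}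

theorem IsStep.natDegree_hyp_fst_le (h : d.IsStep A B A₁ B₁) (h' : d.IsStep A₁ B₁ A₂ B₂)
    (hN : d.N = n + 1) (hA : A.natDegree ≤ n + 1) (hB : B.natDegree ≤ n) :
    (d.hyp A₂ A₁ A).natDegree ≤ n + 2 := by
  have hA₁ := h.natDegree_fst_le hA hB
  have hB₁ := h.natDegree_snd_le hA hB
  refine natDegree_le_pred (d.natDegree_hyp_le (h'.natDegree_fst_le hA₁ hB₁) hA₁ hA) ?_
  rw [d.coeff_hyp hA₁ hA, h'.coeff_fst hA₁ hB₁, h.coeff_fst hA hB, h.coeff_snd hB, hN]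
  push_cast
  ring

theorem IsStep.natDegree_hyp_snd_le (h : d.IsStep A B A₁ B₁) (h' : d.IsStep A₁ B₁ A₂ B₂)
    (hN : d.N = n + 1) (hA : A.natDegree ≤ n + 1) (hB : B.natDegree ≤ n) :
    (d.hyp B₂ B₁ B).natDegree ≤ n + 1 := by
  have hA₁ := h.natDegree_fst_le hA hB
  have hB₁ := h.natDegree_snd_le hA hB
  refine natDegree_le_pred (d.natDegree_hyp_le (h'.natDegree_snd_le hA₁ hB₁) hB₁ hB) ?_
  rw [d.coeff_hyp hB₁ hB, h'.coeff_snd hB₁, h.coeff_fst hA hB, h.coeff_snd hB, hN]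
  push_cast
  ring

end HypDegree

theorem eval_ric_of_mul_sub_one_eq_zero (d : Datum M ℂ) (U : ℂ[X]) {c : ℂ}
    (hc : c * (c - 1) = 0) :
    (d.ric U).eval c = d.T.eval c * (U.eval c ^ 2 + d.lin.eval c * U.eval c) := by
  simp only [ric, eval_add, eval_sub, eval_mul, eval_X, eval_one, eval_pow, hc]
  ring

/-- At `c = 0, 1` the operator `z (z - 1) d/dz` acts on the values of `(B, D)` by a matrix of
determinant zero whose trace is minus the value of the linear coefficient of `hyp`. -/
theorem eval_hyp_eq_zero (d : Datum M ℂ) {U V Om : ℂ[X]} {c : ℂ} (hc : c * (c - 1) = 0)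
    (hT : d.T.eval c ≠ 0) (hV : d.ric U = d.T * Om * V)
    (hU : c * (U.eval c + d.lin.eval c) = 0) {B₂ D₂ B₁ D₁ B D : ℂ[X]}
    (hB₁ : B₁ = Om * D - U * B + X * (X - 1) * derivative B - d.lin * B)
    (hD₁ : D₁ = X * (X - 1) * derivative D + (U + (d.N : ℂ[X]) * X) * D - V * B)
    (hB₂ : B₂ = Om * D₁ - U * B₁ + X * (X - 1) * derivative B₁ - d.lin * B₁)
    (hD₂ : D₂ = X * (X - 1) * derivative D₁ + (U + (d.N : ℂ[X]) * X) * D₁ - V * B₁) :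
    (d.hyp B₂ B₁ B).eval c = 0 ∧ (d.hyp D₂ D₁ D).eval c = 0 := by
  have hdet : U.eval c ^ 2 + d.lin.eval c * U.eval c = Om.eval c * V.eval c := by
    have h := congrArg (eval c) hV
    rw [eval_ric_of_mul_sub_one_eq_zero d U hc, eval_mul, eval_mul, mul_assoc] at h
    exact mul_left_cancel₀ hT h
  have b₁ := congrArg (eval c) hB₁
  have d₁ := congrArg (eval c) hD₁
  have b₂ := congrArg (eval c) hB₂
  have d₂ := congrArg (eval c) hD₂
  simp only [eval_add, eval_sub, eval_mul, eval_X, eval_one, eval_natCast, hc, zero_mul,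
    add_zero, zero_add] at b₁ d₁ b₂ d₂
  simp only [hyp, eval_add, eval_sub, eval_mul, eval_C, eval_X, eval_one, eval_natCast, hc,
    mul_zero, zero_mul, add_zero]
  constructor
  · rw [b₂, d₁, b₁]
    linear_combination B.eval c * hdet + d.N * B.eval c * hU
  · rw [d₂, d₁, b₁]
    linear_combination D.eval c * hdet + d.N * D.eval c * hU

/-- Both products have degree at most `2 n + 3`, but their difference is divisible by
`z (z - 1) Om`. -/
theorem mul_eq_mul_of_dvd {Om U A B D A' B' D' : ℂ[X]} {n : ℕ} (hOm : Om.Monic)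
    (hdeg : Om.natDegree = 2 * (n + 1)) (h : A = Om * D - U * B) (h' : A' = Om * D' - U * B')
    (hB'dvd : X * (X - 1) ∣ B') (hD'dvd : X * (X - 1) ∣ D') (hA : A.natDegree ≤ n + 2)
    (hB : B.natDegree ≤ n + 1) (hA' : A'.natDegree ≤ n + 2) (hB' : B'.natDegree ≤ n + 1) :
    A * B' - A' * B = 0 := by
  refine eq_zero_of_dvd_of_natDegree_lt (p := Om * (X * (X - 1))) ?_ ?_
  · obtain ⟨b, rfl⟩ := hB'dvd
    obtain ⟨e, rfl⟩ := hD'dvd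
    refine ⟨D * b - e * B, ?_⟩
    rw [h, h']
    ring
  · have hX : (X * (X - 1) : ℂ[X]).natDegree = 2 := by
      rw [monic_X.natDegree_mul monic_X_sub_one, natDegree_X, natDegree_X_sub_one]
    rw [hOm.natDegree_mul (monic_X.mul monic_X_sub_one), hdeg, hX]
    have h1 := natDegree_mul_le_of_le hA hB'
    have h2 := natDegree_mul_le_of_le hA' hB
    have h3 := natDegree_sub_le (A * B') (A' * B)
    omega

theorem hyp_eq_mul_sub_mul (d : Datum M ℂ) {Om U A B D A₁ B₁ D₁ A₂ B₂ D₂ : ℂ[X]}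
    (h : A = Om * D - U * B) (h₁ : A₁ = Om * D₁ - U * B₁) (h₂ : A₂ = Om * D₂ - U * B₂) :
    d.hyp A₂ A₁ A = Om * d.hyp D₂ D₁ D - U * d.hyp B₂ B₁ B := by
  rw [hyp, hyp, hyp, h, h₁, h₂]
  ring

theorem monic_Pi_mul_pow (d : Datum M ℂ) (i : ℕ) : (d.Pi * (X - 1) ^ i).Monic :=
  d.monic_Pi.mul (monic_X_sub_one.pow _)

theorem natDegree_Pi_mul_pow (d : Datum M ℂ) (i : ℕ) :
    (d.Pi * (X - 1) ^ i).natDegree = d.N + i := by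
  rw [d.monic_Pi.natDegree_mul (monic_X_sub_one.pow _), monic_X_sub_one.natDegree_pow,
    natDegree_X_sub_one, d.natDegree_Pi, mul_one]

theorem hyp_eq_zero (d : Datum M ℂ) (hd : d.Distinct) (hg : d.Generic) {n : ℕ}
    (hN : d.N = n + 1) {U V A B D : ℂ[X]} (hU : U.eval 1 = 1 - d.δ)
    (hV : d.ric U = d.T * (d.Pi * (X - 1) ^ d.N) * V) (hne : A ≠ 0 ∨ B ≠ 0)
    (hA : A.natDegree ≤ n + 1) (hB : B.natDegree ≤ n)
    (hD : A = d.Pi * (X - 1) ^ d.N * D - U * B) {A₁ B₁ D₁ A₂ B₂ D₂ : ℂ[X]}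
    (h : d.IsStep A B A₁ B₁) (h₁ : A₁ = d.Pi * (X - 1) ^ d.N * D₁ - U * B₁)
    (hD₁ : D₁ = X * (X - 1) * derivative D + (U + (d.N : ℂ[X]) * X) * D - V * B)
    (h' : d.IsStep A₁ B₁ A₂ B₂) (h₂ : A₂ = d.Pi * (X - 1) ^ d.N * D₂ - U * B₂)
    (hD₂ : D₂ = X * (X - 1) * derivative D₁ + (U + (d.N : ℂ[X]) * X) * D₁ - V * B₁) :
    d.hyp A₂ A₁ A = 0 ∧ d.hyp B₂ B₁ B = 0 := by
  have hOm := d.monic_Pi_mul_pow d.N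
  have hOmdeg : (d.Pi * (X - 1) ^ d.N).natDegree = 2 * (n + 1) := by
    rw [natDegree_Pi_mul_pow, hN]
    ring
  have hB₁ := h.snd
  have hB₂ := h'.snd
  rw [hD] at hB₁
  rw [h₁] at hB₂
  obtain ⟨hB0, hD0⟩ := d.eval_hyp_eq_zero (c := 0) (by simp) (d.eval_T_ne_zero hd.ne_zero) hV
    (by simp) hB₁ hD₁ hB₂ hD₂
  obtain ⟨hB1, hD1⟩ := d.eval_hyp_eq_zero (c := 1) (by simp) (d.eval_T_ne_zero hd.ne_one) hV
    (by rw [hU, eval_lin_one]; ring) hB₁ hD₁ hB₂ hD₂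
  have hBdvd := X_mul_X_sub_one_dvd hB0 hB1
  have hDdvd := X_mul_X_sub_one_dvd hD0 hD1
  have hhyp := d.hyp_eq_mul_sub_mul hD h₁ h₂
  have hA' := h.natDegree_hyp_fst_le h' hN hA hB
  have hB' := h.natDegree_hyp_snd_le h' hN hA hB
  have hz := mul_eq_mul_of_dvd hOm hOmdeg hD hhyp hBdvd hDdvd (by omega) (by omega) hA' hB'
  have hz₁ := mul_eq_mul_of_dvd hOm hOmdeg h₁ hhyp hBdvd hDdvd (h.natDegree_fst_le hA hB)
    (h.natDegree_snd_le hA hB) hA' hB'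
  have hdet := h.mul_sub_mul_ne_zero hd hg hne
  constructor <;> refine (mul_eq_zero.1 ?_).resolve_right hdet
  · linear_combination A₁ * hz - A * hz₁
  · linear_combination B₁ * hz - B * hz₁

theorem exists_iota_hypergeometric (d : Datum M ℂ) (hd : d.Distinct) (hg : d.Generic)
    (ha : ∀ k, d.ApparentAt k) {n : ℕ} (hN : d.N = n + 1) :
    ∃ U V A B D : ℂ[X], U.eval 1 = 1 - d.δ ∧ d.ric U = d.T * (d.Pi * (X - 1) ^ d.N) * V ∧
      d.iota A B ≠ 0 ∧ A.natDegree ≤ n + 1 ∧ B.natDegree ≤ n ∧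
      A = d.Pi * (X - 1) ^ d.N * D - U * B ∧
      aeval d.θ (X * (X + C (d.γ - 1))) (d.iota A B) =
        (RatFunc.X : RatFunc ℂ) • aeval d.θ ((X + C d.α) * (X + C d.β)) (d.iota A B) := by
  obtain ⟨U, V, hU, hV⟩ := d.exists_ric_eq_mul hd hg.δ_ne ha
  have hOm := d.monic_Pi_mul_pow d.N
  have hOmdeg : (d.Pi * (X - 1) ^ d.N).natDegree = 2 * (n + 1) := by
    rw [natDegree_Pi_mul_pow, hN]
    ring
  obtain ⟨A, B, D, hne, hA, hB, hD⟩ := exists_eq_mul_sub_mul U hOm hOmdeg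
  obtain ⟨A₁, B₁, D₁, h, h₁, hD₁⟩ := d.exists_isStep hV hD
  obtain ⟨A₂, B₂, D₂, h', h₂, hD₂⟩ := d.exists_isStep hV h₁
  obtain ⟨hA0, hB0⟩ := d.hyp_eq_zero hd hg hN hU hV hne hA hB hD h h₁ hD₁ h' h₂ hD₂
  refine ⟨U, V, A, B, D, hU, hV, d.iota_ne_zero hne, hA, hB, hD, ?_⟩
  have hiota := h.iota_hyp h'
  have hzero : d.iota (0 : ℂ[X]) 0 = 0 := by simp [iota]
  rw [hA0, hB0, hzero, eq_comm, smul_eq_zero_iff_right ratFunc_X_sub_one_ne_zero,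
    sub_eq_zero] at hiota
  exact hiota.symm

theorem natDegree_le_of_natDegree_X_sub_one_mul_le {f : ℂ[X]} {k : ℕ}
    (h : ((X - 1) * f).natDegree ≤ k + 1) : f.natDegree ≤ k := by
  by_cases h0 : f = 0
  · simp [h0]
  · rw [monic_X_sub_one.natDegree_mul' h0, natDegree_X_sub_one] at h
    omega

/-- The exponent `0` of `L` at `z = 1` makes `z d/dz` cost only one factor `z - 1` of the
congruence which cuts out the lattice. -/
theorem exists_θ_iota (d : Datum M ℂ) {U V : ℂ[X]} (hU : U.eval 1 = 1 - d.δ) {i n : ℕ}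
    (hV : d.ric U = d.T * (d.Pi * (X - 1) ^ (i + 1)) * V) {A B D : ℂ[X]}
    (hA : A.natDegree ≤ n + 1) (hB : B.natDegree ≤ n)
    (hD : A = d.Pi * (X - 1) ^ (i + 1) * D - U * B) :
    ∃ A' B' D' : ℂ[X], A'.natDegree ≤ n + 1 ∧ B'.natDegree ≤ n ∧
      A' = d.Pi * (X - 1) ^ i * D' - U * B' ∧ d.θ (d.iota A B) = d.iota A' B' := by
  obtain ⟨A₁, B₁, D₁, hs, hD₁, -⟩ := d.exists_isStep hV hD
  have hdvd {f : ℂ[X]} (hf : f.eval 1 = 0) : X - 1 ∣ f := by simpa using dvd_iff_isRoot.2 hf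
  have hB1 : B₁.eval 1 = 0 := by
    rw [hs.snd, hD]
    simp only [eval_add, eval_sub, eval_mul, eval_pow, eval_X, eval_one, sub_self, hU,
      eval_lin_one, zero_pow (Nat.succ_ne_zero i)]
    ring
  have hA1 : A₁.eval 1 = 0 := by simp [hD₁, hB1]
  obtain ⟨A', rfl⟩ := hdvd hA1
  obtain ⟨B', rfl⟩ := hdvd hB1
  refine ⟨A', B', D₁, natDegree_le_of_natDegree_X_sub_one_mul_le (hs.natDegree_fst_le hA hB),
    natDegree_le_of_natDegree_X_sub_one_mul_le (hs.natDegree_snd_le hA hB),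
    mul_left_cancel₀ X_sub_one_ne_zero ?_, ?_⟩
  · linear_combination hD₁
  · have hX1 := RatFunc.algebraMap_ne_zero X_sub_one_ne_zero
    have h := hs.θ_iota
    rw [iota_mul] at h
    refine smul_right_injective _ hX1 (Eq.trans ?_ h)
    simp only [map_sub, map_one, RatFunc.algebraMap_X]

theorem exists_θ_pow_iota (d : Datum M ℂ) {U V A B D : ℂ[X]} {n : ℕ} (hU : U.eval 1 = 1 - d.δ)
    (hV : d.ric U = d.T * (d.Pi * (X - 1) ^ d.N) * V) (hA : A.natDegree ≤ n + 1)
    (hB : B.natDegree ≤ n) (hD : A = d.Pi * (X - 1) ^ d.N * D - U * B) {j : ℕ} (hj : j ≤ d.N) :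
    ∃ A' B' D' : ℂ[X], A'.natDegree ≤ n + 1 ∧ B'.natDegree ≤ n ∧
      A' = d.Pi * (X - 1) ^ (d.N - j) * D' - U * B' ∧
      (d.θ ^ j) (d.iota A B) = d.iota A' B' := by
  induction j with
  | zero => exact ⟨A, B, D, hA, hB, hD, rfl⟩
  | succ j ih =>
    obtain ⟨A', B', D', hA', hB', hD', hθ⟩ := ih (by omega)
    rw [show d.N - j = d.N - (j + 1) + 1 by omega] at hD'
    have hV' : d.ric U = d.T * (d.Pi * (X - 1) ^ (d.N - (j + 1) + 1)) * ((X - 1) ^ j * V) := by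
      conv_lhs => rw [hV, show d.N = d.N - (j + 1) + 1 + j by omega, pow_add]
      ring
    obtain ⟨A'', B'', D'', hA'', hB'', hD'', h⟩ := d.exists_θ_iota hU hV' hA' hB' hD'
    exact ⟨A'', B'', D'', hA'', hB'', hD'', by rw [pow_succ', Module.End.mul_apply, hθ, h]⟩

theorem exists_sum_coeff_mul_eq_zero {n : ℕ} {b : ℕ → ℂ[X]}
    (hb : ∀ j < n + 2, (b j).natDegree ≤ n) :
    ∃ E : ℂ[X], E ≠ 0 ∧ E.natDegree ≤ n + 1 ∧
      ∑ j ∈ Finset.range (n + 2), C (E.coeff j) * b j = 0 := by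
  let f : degreeLT ℂ (n + 2) →ₗ[ℂ] degreeLT ℂ (n + 1) :=
    ∑ j : Fin (n + 2), ((lcoeff ℂ j).comp (degreeLT ℂ (n + 2)).subtype).smulRight
      ⟨b j, mem_degreeLT_succ_iff.2 (hb j j.2)⟩
  have hker : LinearMap.ker f ≠ ⊥ :=
    LinearMap.ker_ne_bot_of_finrank_lt (by rw [finrank_degreeLT, finrank_degreeLT]; omega)
  obtain ⟨⟨E, hE⟩, hEker, hE0⟩ := (Submodule.ne_bot_iff _).1 hker
  refine ⟨E, fun h => hE0 (Subtype.ext h), mem_degreeLT_succ_iff.1 hE, ?_⟩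
  have h := congrArg Subtype.val (LinearMap.mem_ker.1 hEker)
  simpa [f, Finset.sum_range, smul_eq_C_mul] using h

theorem iota_sum (d : Datum M ℂ) (s : Finset ℕ) (x : ℕ → ℂ) (a b : ℕ → ℂ[X]) :
    d.iota (∑ j ∈ s, C (x j) * a j) (∑ j ∈ s, C (x j) * b j) =
      ∑ j ∈ s, x j • d.iota (a j) (b j) := by
  induction s using Finset.induction_on with
  | empty => simp [iota]
  | insert i s hi ih =>
    rw [Finset.sum_insert hi, Finset.sum_insert hi, Finset.sum_insert hi, iota_add, ih, iota_mul]
    congr 1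
    ext <;> simp [RatFunc.smul_eq_C_mul]

theorem iota_Pi_mul_C (d : Datum M ℂ) (c : ℂ) : d.iota (d.Pi * C c) 0 = c • (1, 0) := by
  have hPi := RatFunc.algebraMap_ne_zero d.monic_Pi.ne_zero
  ext <;> simp [iota, RatFunc.smul_eq_C_mul, hPi]

theorem exists_aeval_θ_iota_eq (d : Datum M ℂ) {U V A B D : ℂ[X]} {n : ℕ} (hN : d.N = n + 1)
    (hU : U.eval 1 = 1 - d.δ) (hV : d.ric U = d.T * (d.Pi * (X - 1) ^ d.N) * V)
    (hA : A.natDegree ≤ n + 1) (hB : B.natDegree ≤ n)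
    (hD : A = d.Pi * (X - 1) ^ d.N * D - U * B) :
    ∃ (E : ℂ[X]) (c : ℂ), E ≠ 0 ∧ E.natDegree ≤ d.N ∧
      aeval d.θ E (d.iota A B) = c • (1, 0) := by
  choose! a b e ha hb he hθ using fun j (hj : j ≤ d.N) => d.exists_θ_pow_iota hU hV hA hB hD hj
  obtain ⟨E, hE0, hEdeg, hEb⟩ := exists_sum_coeff_mul_eq_zero fun j hj => hb j (by omega)
  have hdvd : d.Pi ∣ ∑ j ∈ Finset.range (n + 2), C (E.coeff j) * a j := by
    have h := congrArg (U * ·) hEb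
    simp only [mul_zero, Finset.mul_sum] at h
    rw [← add_zero (∑ j ∈ _, _), ← h, ← Finset.sum_add_distrib]
    refine Finset.dvd_sum fun j hj => ⟨C (E.coeff j) * (X - 1) ^ (d.N - j) * e j, ?_⟩
    rw [he j (by rw [Finset.mem_range] at hj; omega)]
    ring
  obtain ⟨f, hf⟩ := hdvd
  have hfdeg : f.natDegree = 0 := by
    by_cases h0 : f = 0
    · simp [h0]
    have h : (∑ j ∈ Finset.range (n + 2), C (E.coeff j) * a j).natDegree ≤ n + 1 :=
      natDegree_sum_le_of_forall_le _ _ fun j hj => (natDegree_C_mul_le _ _).trans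
        (ha j (by rw [Finset.mem_range] at hj; omega))
    rw [hf, d.monic_Pi.natDegree_mul' h0, d.natDegree_Pi] at h
    omega
  obtain ⟨c, rfl⟩ := natDegree_eq_zero.1 hfdeg
  refine ⟨E, c, hE0, hN ▸ hEdeg, ?_⟩
  rw [← iota_Pi_mul_C, ← hf, ← hEb, iota_sum, aeval_eq_sum_range' (n := n + 2) (by omega),
    LinearMap.sum_apply]
  refine Finset.sum_congr rfl fun j hj => ?_
  rw [LinearMap.smul_apply, hθ j (by rw [Finset.mem_range] at hj; omega)]

theorem exists_hypergeometric (d : Datum M ℂ) (hd : d.Distinct) (hg : d.Generic)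
    (ha : ∀ k, d.ApparentAt k) {n : ℕ} (hN : d.N = n + 1) :
    ∃ (F : RatFunc ℂ × RatFunc ℂ) (E : ℂ[X]) (c : ℂ), F ≠ 0 ∧ E ≠ 0 ∧ E.natDegree ≤ d.N ∧
      aeval d.θ (X * (X + C (d.γ - 1))) F =
        (RatFunc.X : RatFunc ℂ) • aeval d.θ ((X + C d.α) * (X + C d.β)) F ∧
      c ≠ 0 ∧ aeval d.θ E F = c • (1, 0) := by
  obtain ⟨U, V, A, B, D, hU, hV, hF0, hA, hB, hD, hF⟩ := d.exists_iota_hypergeometric hd hg ha hN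
  obtain ⟨E, c, hE0, hEdeg, hE⟩ := d.exists_aeval_θ_iota_eq hN hU hV hA hB hD
  refine ⟨_, E, c, hF0, hE0, hEdeg, hF, ?_, hE⟩
  rintro rfl
  exact d.aeval_θ_ne_zero hd hg hE0 hF0 (hE.trans (zero_smul _ _))

end Datum

/-! ### Linear conditions on the Euler polynomial -/

theorem aeval_theta_X_smul (P Q : RatFunc ℂ) (g : ℂ[X]) (w : RatFunc ℂ × RatFunc ℂ) :
    aeval (theta P Q) g ((RatFunc.X : RatFunc ℂ) • w) =
      (RatFunc.X : RatFunc ℂ) • aeval (theta P Q) (g.comp (X + 1)) w := by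
  induction g using Polynomial.induction_on generalizing w with
  | C a => rw [C_comp, aeval_C, Module.algebraMap_end_apply, Module.algebraMap_end_apply, smul_comm]
  | add f g hf hg =>
    rw [add_comp, map_add, map_add, LinearMap.add_apply, LinearMap.add_apply, hf, hg, smul_add]
  | monomial n a ih =>
    have hθ : theta P Q ((RatFunc.X : RatFunc ℂ) • w) =
        (RatFunc.X : RatFunc ℂ) • aeval (theta P Q) (X + 1 : ℂ[X]) w := by
      rw [theta_smul, ddz_X, mul_one, ← smul_add, map_add, aeval_X, map_one, LinearMap.add_apply,
        Module.End.one_apply, add_comm]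
    rw [pow_succ, ← mul_assoc, mul_comp, X_comp, map_mul _ _ X, map_mul _ _ (X + 1),
      Module.End.mul_apply, Module.End.mul_apply, aeval_X, hθ, ih]

theorem aeval_theta_X_pow_smul (P Q : RatFunc ℂ) (g : ℂ[X]) (j : ℕ) (w : RatFunc ℂ × RatFunc ℂ) :
    aeval (theta P Q) g ((RatFunc.X ^ j : RatFunc ℂ) • w) =
      (RatFunc.X ^ j : RatFunc ℂ) • aeval (theta P Q) (g.comp (X + (j : ℂ[X]))) w := by
  induction j generalizing g with
  | zero => simp
  | succ j ih =>
    rw [pow_succ', mul_smul, aeval_theta_X_smul, ih, comp_assoc, mul_smul, add_comp, X_comp,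
      one_comp, add_assoc, Nat.cast_succ]

theorem pow_smul_theta (P Q : RatFunc ℂ) (r : ℂ[X]) (j : ℕ) (w : RatFunc ℂ × RatFunc ℂ) :
    algebraMap ℂ[X] (RatFunc ℂ) (r ^ (j + 1)) • theta P Q w =
      algebraMap ℂ[X] (RatFunc ℂ) r • theta P Q (algebraMap ℂ[X] (RatFunc ℂ) (r ^ j) • w)
        - algebraMap ℂ[X] (RatFunc ℂ) ((j : ℂ[X]) * X * derivative r) •
          algebraMap ℂ[X] (RatFunc ℂ) (r ^ j) • w := by
  have h : r * (X * derivative (r ^ j)) = (j : ℂ[X]) * X * derivative r * r ^ j := by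
    rw [derivative_pow]
    cases j with
    | zero => simp
    | succ j => rw [Nat.add_sub_cancel, pow_succ, map_natCast]; ring
  rw [theta_smul, ddz_algebraMap, ← RatFunc.algebraMap_X, smul_add, smul_smul, smul_smul,
    smul_smul, ← map_mul, ← map_mul, ← map_mul, ← map_mul, h, ← pow_succ', add_sub_cancel_left]

namespace Datum

variable {M : ℕ}

section Conditions

variable {A : Type*} [CommRing A]

/-- The indicial polynomial, in `z d/dz`, at the origin of the Gauss hypergeometric equation. -/
def H₁ (d : Datum M A) : A[X] := X * (X + C (d.γ - 1))

/-- The indicial polynomial, in `z d/dz`, at infinity of the Gauss hypergeometric equation. -/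
def H₂ (d : Datum M A) : A[X] := (X + C d.α) * (X + C d.β)

/-- The coordinates of `((z - 1) T) ^ j (z d/dz) ^ j` applied to the generator; in this form they
are polynomials over the ring of coefficients. -/
def thetaIter (d : Datum M A) : ℕ → A[X] × A[X]
  | 0 => (1, 0)
  | j + 1 =>
    (d.q * derivative (d.thetaIter j).1 - d.S * (d.thetaIter j).2
        - (j : A[X]) * X * derivative ((X - 1) * d.T) * (d.thetaIter j).1,
      d.q * ((d.thetaIter j).1 + derivative (d.thetaIter j).2) - d.p * (d.thetaIter j).2
        - (j : A[X]) * X * derivative ((X - 1) * d.T) * (d.thetaIter j).2)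

/-- The coefficient of `(z d/dz) ^ j` in `H₁ E(· - 1) - z H₂ E(· + 1)`. -/
def opCoeff (d : Datum M A) (E : A[X]) (j : ℕ) : A[X] :=
  C ((d.H₁ * E.comp (X - 1)).coeff j) - X * C ((d.H₂ * E.comp (X + 1)).coeff j)

/-- The remainder of the hypergeometric operator with Euler polynomial `E` on division by the second
order operator, multiplied by `((z - 1) T) ^ (N + 2)` to clear denominators. -/
def rem (d : Datum M A) (E : A[X]) : A[X] × A[X] :=
  (∑ j ∈ Finset.range (d.N + 3),
      d.opCoeff E j * ((X - 1) * d.T) ^ (d.N + 2 - j) * (d.thetaIter j).1,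
    ∑ j ∈ Finset.range (d.N + 3),
      d.opCoeff E j * ((X - 1) * d.T) ^ (d.N + 2 - j) * (d.thetaIter j).2)

/-- The second order operator times `z ^ 2 (z - 1) T` is the sum over `j` of `z ^ j` times this
polynomial in `z d/dz`. -/
def eulerPart (d : Datum M A) (j : ℕ) : A[X] :=
  C (((X - 1) * d.T).coeff j) * (X ^ 2 - X) + C (d.p.coeff j) * X + C ((X * d.S).coeff j)

/-- Applied to a Gauss hypergeometric function `F`, this polynomial in `z d/dz` gives the same
as `shiftFactor 0` applied to `z ^ j F`. -/
def shiftFactor (d : Datum M A) (j : ℕ) : A[X] :=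
  (∏ i ∈ Finset.range j, d.H₁.comp (X - (i : A[X]))) *
    ∏ i ∈ Finset.Ico j (M + 1), d.H₂.comp (X - ((i + 1 : ℕ) : A[X]))

/-- If `E(z d/dz) F` solves the second order equation for a Gauss hypergeometric function `F`, this
polynomial in `z d/dz` annihilates `F`. -/
def indicial (d : Datum M A) (E : A[X]) : A[X] :=
  ∑ j ∈ Finset.range (M + 2), (d.eulerPart j * E).comp (X - (j : A[X])) * d.shiftFactor j

end Conditions

theorem algebraMap_q_mul_P (d : Datum M ℂ) :
    algebraMap ℂ[X] (RatFunc ℂ) d.q * d.P = algebraMap ℂ[X] (RatFunc ℂ) d.p :=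
  mul_div_cancel₀ _ d.algebraMap_q_ne_zero

theorem algebraMap_q_mul_Q (d : Datum M ℂ) :
    algebraMap ℂ[X] (RatFunc ℂ) d.q * d.Q = algebraMap ℂ[X] (RatFunc ℂ) d.S :=
  mul_div_cancel₀ _ d.algebraMap_q_ne_zero

theorem algebraMap_q (d : Datum M ℂ) : algebraMap ℂ[X] (RatFunc ℂ) d.q =
    RatFunc.X * algebraMap ℂ[X] (RatFunc ℂ) ((X - 1) * d.T) := by
  rw [q, mul_assoc, map_mul, RatFunc.algebraMap_X]

theorem pow_smul_θ_pow (d : Datum M ℂ) (j : ℕ) :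
    algebraMap ℂ[X] (RatFunc ℂ) (((X - 1) * d.T) ^ j) • (d.θ ^ j) (1, 0) =
      (algebraMap ℂ[X] (RatFunc ℂ) (d.thetaIter j).1,
        algebraMap ℂ[X] (RatFunc ℂ) (d.thetaIter j).2) := by
  induction j with
  | zero => simp [thetaIter]
  | succ j ih =>
    have hP := d.algebraMap_q_mul_P
    have hQ := d.algebraMap_q_mul_Q
    rw [algebraMap_q] at hP hQ
    rw [pow_succ' d.θ, Module.End.mul_apply, pow_smul_theta, ih, theta_apply, nabla_apply]
    ext
    · simp only [thetaIter, ddz_algebraMap, Prod.fst_sub, Prod.smul_fst, smul_eq_mul, map_sub,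
        map_mul _ d.q, map_mul _ d.S, map_mul _ _ (d.thetaIter j).1, algebraMap_q]
      linear_combination (-algebraMap ℂ[X] (RatFunc ℂ) (d.thetaIter j).2) * hQ
    · simp only [thetaIter, ddz_algebraMap, Prod.snd_sub, Prod.smul_snd, smul_eq_mul, map_sub,
        map_mul _ d.q, map_mul _ d.p, map_mul _ _ (d.thetaIter j).2, map_add, algebraMap_q]
      linear_combination (-algebraMap ℂ[X] (RatFunc ℂ) (d.thetaIter j).2) * hP

theorem natDegree_H₁_mul_comp_le (d : Datum M ℂ) {E : ℂ[X]} {n : ℕ} (hE : E.natDegree ≤ n) :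
    (d.H₁ * E.comp (X - 1)).natDegree ≤ n + 2 := by
  have hH : d.H₁.natDegree ≤ 2 := by
    rw [H₁, monic_X.natDegree_mul (monic_X_add_C _), natDegree_X, natDegree_X_add_C]
  have hcomp : (E.comp (X - 1)).natDegree ≤ n := by
    rwa [natDegree_comp, natDegree_X_sub_one, mul_one]
  exact (natDegree_mul_le_of_le hH hcomp).trans (by omega)

theorem natDegree_H₂_mul_comp_le (d : Datum M ℂ) {E : ℂ[X]} {n : ℕ} (hE : E.natDegree ≤ n) :
    (d.H₂ * E.comp (X + 1)).natDegree ≤ n + 2 := by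
  have hH : d.H₂.natDegree ≤ 2 := by
    rw [H₂, (monic_X_add_C _).natDegree_mul (monic_X_add_C _), natDegree_X_add_C,
      natDegree_X_add_C]
  have hcomp : (E.comp (X + 1)).natDegree ≤ n := by
    rwa [natDegree_comp, ← map_one C, natDegree_X_add_C, mul_one]
  exact (natDegree_mul_le_of_le hH hcomp).trans (by omega)

theorem aeval_θ_eq_sum (d : Datum M ℂ) {g : ℂ[X]} {n : ℕ} (hg : g.natDegree < n)
    (w : RatFunc ℂ × RatFunc ℂ) : aeval d.θ g w =
      ∑ j ∈ Finset.range n, algebraMap ℂ[X] (RatFunc ℂ) (C (g.coeff j)) • (d.θ ^ j) w := by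
  rw [aeval_eq_sum_range' hg, LinearMap.sum_apply]
  refine Finset.sum_congr rfl fun j _ => ?_
  ext <;> simp [RatFunc.smul_eq_C_mul]

theorem algebraMap_rem (d : Datum M ℂ) {E : ℂ[X]} (hE : E.natDegree ≤ d.N) :
    (algebraMap ℂ[X] (RatFunc ℂ) (d.rem E).1, algebraMap ℂ[X] (RatFunc ℂ) (d.rem E).2) =
      algebraMap ℂ[X] (RatFunc ℂ) (((X - 1) * d.T) ^ (d.N + 2)) •
        (aeval d.θ (d.H₁ * E.comp (X - 1)) (1, 0)
          - (RatFunc.X : RatFunc ℂ) • aeval d.θ (d.H₂ * E.comp (X + 1)) (1, 0)) := by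
  have h₁ := d.natDegree_H₁_mul_comp_le hE
  have h₂ := d.natDegree_H₂_mul_comp_le hE
  rw [d.aeval_θ_eq_sum (Nat.lt_succ_of_le h₁), d.aeval_θ_eq_sum (Nat.lt_succ_of_le h₂),
    Finset.smul_sum, ← Finset.sum_sub_distrib, Finset.smul_sum]
  have hterm : ∀ j ∈ Finset.range (d.N + 2 + 1),
      algebraMap ℂ[X] (RatFunc ℂ) (d.opCoeff E j * ((X - 1) * d.T) ^ (d.N + 2 - j)) •
        (algebraMap ℂ[X] (RatFunc ℂ) (d.thetaIter j).1,
          algebraMap ℂ[X] (RatFunc ℂ) (d.thetaIter j).2) =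
      algebraMap ℂ[X] (RatFunc ℂ) (((X - 1) * d.T) ^ (d.N + 2)) •
        (algebraMap ℂ[X] (RatFunc ℂ) (C ((d.H₁ * E.comp (X - 1)).coeff j)) • (d.θ ^ j) (1, 0)
        - (RatFunc.X : RatFunc ℂ) • algebraMap ℂ[X] (RatFunc ℂ)
          (C ((d.H₂ * E.comp (X + 1)).coeff j)) • (d.θ ^ j) (1, 0)) := by
    intro j hj
    rw [← pow_smul_θ_pow, smul_smul, ← map_mul, mul_assoc, ← pow_add,
      Nat.sub_add_cancel (Nat.lt_succ_iff.1 (Finset.mem_range.1 hj)), smul_smul, ← sub_smul,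
      smul_smul, opCoeff, ← RatFunc.algebraMap_X, ← map_mul, ← map_sub, ← map_mul, mul_comm]
  rw [← Finset.sum_congr rfl hterm]
  ext
  · simp only [rem, map_sum, map_mul, Prod.fst_sum, Prod.smul_fst, smul_eq_mul]
  · simp only [rem, map_sum, map_mul, Prod.snd_sum, Prod.smul_snd, smul_eq_mul]

theorem rem_eq_zero_iff (d : Datum M ℂ) {E : ℂ[X]} (hE : E.natDegree ≤ d.N) :
    d.rem E = 0 ↔ aeval d.θ (d.H₁ * E.comp (X - 1)) (1, 0) =
      (RatFunc.X : RatFunc ℂ) • aeval d.θ (d.H₂ * E.comp (X + 1)) (1, 0) := by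
  have h0 : algebraMap ℂ[X] (RatFunc ℂ) (((X - 1) * d.T) ^ (d.N + 2)) ≠ 0 :=
    RatFunc.algebraMap_ne_zero ((monic_X_sub_one.mul d.monic_T).pow _).ne_zero
  rw [← sub_eq_zero (b := _ • _)]
  refine Iff.trans ?_ (smul_eq_zero_iff_right h0)
  rw [← d.algebraMap_rem hE, Prod.ext_iff, Prod.ext_iff]
  have hinj := RatFunc.algebraMap_injective ℂ
  exact and_congr (map_eq_zero_iff _ hinj).symm (map_eq_zero_iff _ hinj).symm

theorem rem_eq_zero_of_hypergeometric (d : Datum M ℂ) {F : RatFunc ℂ × RatFunc ℂ} {E : ℂ[X]}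
    {c : ℂ} (hE : E.natDegree ≤ d.N)
    (hF : aeval d.θ d.H₁ F = (RatFunc.X : RatFunc ℂ) • aeval d.θ d.H₂ F) (hc : c ≠ 0)
    (hEF : aeval d.θ E F = c • (1, 0)) : d.rem E = 0 := by
  rw [d.rem_eq_zero_iff hE]
  refine smul_right_injective _ hc ?_
  dsimp only
  rw [← map_smul, smul_comm, ← map_smul, ← hEF, ← Module.End.mul_apply, ← Module.End.mul_apply,
    ← map_mul, ← map_mul, mul_assoc, mul_comm d.H₁, map_mul, Module.End.mul_apply, hF,
    aeval_theta_X_smul, ← Module.End.mul_apply, ← map_mul, mul_comp, comp_assoc, sub_comp, X_comp,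
    one_comp, add_sub_cancel_right, comp_X]
  congr 3
  ring

theorem aeval_prod_H₁_apply (d : Datum M ℂ) {F : RatFunc ℂ × RatFunc ℂ}
    (hF : aeval d.θ d.H₁ F = (RatFunc.X : RatFunc ℂ) • aeval d.θ d.H₂ F) (j : ℕ) :
    aeval d.θ (∏ i ∈ Finset.range j, d.H₁.comp (X - (i : ℂ[X]))) F =
      (RatFunc.X ^ j : RatFunc ℂ) •
        aeval d.θ (∏ i ∈ Finset.range j, d.H₂.comp (X + (i : ℂ[X]))) F := by
  induction j with
  | zero => simp
  | succ j ih =>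
    rw [Finset.prod_range_succ, mul_comm, map_mul, Module.End.mul_apply, ih,
      aeval_theta_X_pow_smul, comp_assoc, ← Module.End.mul_apply, ← map_mul, mul_comm]
    simp only [sub_comp, X_comp, natCast_comp, add_sub_cancel_right, comp_X]
    rw [map_mul, Module.End.mul_apply, hF, aeval_theta_X_smul, ← Module.End.mul_apply, ← map_mul,
      smul_smul, ← pow_succ, Finset.prod_range_succ', prod_comp]
    simp [comp_assoc, add_assoc, add_comm (1 : ℂ[X])]

theorem aeval_shiftFactor_apply (d : Datum M ℂ) {F : RatFunc ℂ × RatFunc ℂ}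
    (hF : aeval d.θ d.H₁ F = (RatFunc.X : RatFunc ℂ) • aeval d.θ d.H₂ F) {j : ℕ}
    (hj : j ≤ M + 1) : aeval d.θ (d.shiftFactor j) F =
      aeval d.θ (d.shiftFactor 0) ((RatFunc.X ^ j : RatFunc ℂ) • F) := by
  rw [shiftFactor, mul_comm, map_mul, Module.End.mul_apply, d.aeval_prod_H₁_apply hF,
    aeval_theta_X_pow_smul, aeval_theta_X_pow_smul, ← Module.End.mul_apply, ← map_mul]
  congr 3
  rw [shiftFactor, Finset.prod_range_zero, one_mul, ← Finset.range_eq_Ico,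
    ← Finset.prod_range_mul_prod_Ico _ hj, mul_comp, mul_comm]
  congr 1
  rw [prod_comp, ← Finset.prod_range_reflect]
  refine Finset.prod_congr rfl fun i hi => ?_
  have h : ((j - 1 - i : ℕ) : ℂ[X]) = j - ((i + 1 : ℕ) : ℂ[X]) := by
    rw [eq_sub_iff_add_eq, ← Nat.cast_add]
    congr 1
    have := Finset.mem_range.1 hi
    omega
  rw [comp_assoc, h, sub_comp, X_comp, natCast_comp]
  congr 1
  ring

theorem algebraMap_eq_sum_X_pow_mul_C {f : ℂ[X]} {n : ℕ} (hf : f.natDegree < n) :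
    algebraMap ℂ[X] (RatFunc ℂ) f =
      ∑ j ∈ Finset.range n, RatFunc.X ^ j * RatFunc.C (f.coeff j) := by
  conv_lhs => rw [f.as_sum_range' n hf, map_sum]
  refine Finset.sum_congr rfl fun j _ => ?_
  rw [← C_mul_X_pow_eq_monomial, map_mul, map_pow, RatFunc.algebraMap_C, RatFunc.algebraMap_X,
    mul_comm]

theorem natDegree_X_sub_one_mul_T_lt (d : Datum M ℂ) : ((X - 1) * d.T).natDegree < M + 2 := by
  rw [monic_X_sub_one.natDegree_mul d.monic_T, natDegree_X_sub_one, natDegree_T]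
  omega

theorem X_pow_smul_aeval_eulerPart (d : Datum M ℂ) (j : ℕ) (w : RatFunc ℂ × RatFunc ℂ) :
    (RatFunc.X ^ j : RatFunc ℂ) • aeval d.θ (d.eulerPart j) w =
      (RatFunc.X ^ j * RatFunc.C (((X - 1) * d.T).coeff j)) • (d.θ (d.θ w) - d.θ w)
        + (RatFunc.X ^ j * RatFunc.C (d.p.coeff j)) • d.θ w
        + (RatFunc.X ^ j * RatFunc.C ((X * d.S).coeff j)) • w := by
  have h (c : ℂ) (v : RatFunc ℂ × RatFunc ℂ) : c • v = RatFunc.C c • v := by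
    ext <;> simp [RatFunc.smul_eq_C_mul]
  simp only [eulerPart, map_add, map_sub, map_mul, aeval_C, aeval_X, LinearMap.add_apply,
    LinearMap.sub_apply, Module.End.mul_apply, Module.algebraMap_end_apply, pow_two, h, smul_add,
    smul_sub, smul_smul]

theorem sum_X_pow_smul_aeval_eulerPart (d : Datum M ℂ) :
    ∑ j ∈ Finset.range (M + 2),
      (RatFunc.X ^ j : RatFunc ℂ) • aeval d.θ (d.eulerPart j) (1, 0) = 0 := by
  have hS : (X * d.S).natDegree < M + 2 :=
    (natDegree_mul_le_of_le natDegree_X_le d.natDegree_S_le).trans_lt (by omega)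
  have hP := d.algebraMap_q_mul_P
  have hQ := d.algebraMap_q_mul_Q
  rw [algebraMap_q] at hP hQ
  simp only [X_pow_smul_aeval_eulerPart, Finset.sum_add_distrib, ← Finset.sum_smul]
  rw [← algebraMap_eq_sum_X_pow_mul_C d.natDegree_X_sub_one_mul_T_lt,
    ← algebraMap_eq_sum_X_pow_mul_C (Nat.lt_succ_of_le d.natDegree_p_le),
    ← algebraMap_eq_sum_X_pow_mul_C hS, map_mul _ X, RatFunc.algebraMap_X, ← hP, ← hQ]
  have hddz : ddz (0 : RatFunc ℂ) = 0 := map_zero _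
  ext <;> simp [theta_apply, nabla_apply, hddz, ddz_one, ddz_X] <;> ring

theorem indicial_eq_zero_of_hypergeometric (d : Datum M ℂ) (hd : d.Distinct) (hg : d.Generic)
    {F : RatFunc ℂ × RatFunc ℂ} {E : ℂ[X]} {c : ℂ} (hF0 : F ≠ 0)
    (hF : aeval d.θ d.H₁ F = (RatFunc.X : RatFunc ℂ) • aeval d.θ d.H₂ F)
    (hEF : aeval d.θ E F = c • (1, 0)) : d.indicial E = 0 := by
  by_contra h0
  refine d.aeval_θ_ne_zero hd hg h0 hF0 ?_
  have hterm : ∀ j ∈ Finset.range (M + 2),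
      aeval d.θ ((d.eulerPart j * E).comp (X - (j : ℂ[X])) * d.shiftFactor j) F
      = aeval d.θ (d.shiftFactor 0) (c • (RatFunc.X ^ j : RatFunc ℂ) •
        aeval d.θ (d.eulerPart j) (1, 0)) := by
    intro j hj
    rw [map_mul, Module.End.mul_apply,
      d.aeval_shiftFactor_apply hF (Nat.lt_succ_iff.1 (Finset.mem_range.1 hj)),
      ← Module.End.mul_apply, ← map_mul, mul_comm, map_mul, Module.End.mul_apply,
      aeval_theta_X_pow_smul, comp_assoc, sub_comp, X_comp, natCast_comp, add_sub_cancel_right,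
      comp_X, map_mul, Module.End.mul_apply, hEF, (aeval d.θ (d.eulerPart j)).map_smul, smul_comm]
  rw [indicial, map_sum, LinearMap.sum_apply, Finset.sum_congr rfl hterm, ← map_sum,
    ← Finset.smul_sum, sum_X_pow_smul_aeval_eulerPart, smul_zero, map_zero]

theorem exists_rem_indicial_eq_zero_of_generic (d : Datum M ℂ) (hd : d.Distinct) (hg : d.Generic)
    (ha : ∀ k, d.ApparentAt k) {n : ℕ} (hN : d.N = n + 1) :
    ∃ E : ℂ[X], E ≠ 0 ∧ E.natDegree ≤ d.N ∧ d.rem E = 0 ∧ d.indicial E = 0 := by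
  obtain ⟨F, E, c, hF0, hE0, hE, hF, hc, hEF⟩ := d.exists_hypergeometric hd hg ha hN
  exact ⟨E, hE0, hE, d.rem_eq_zero_of_hypergeometric hE hF hc hEF,
    d.indicial_eq_zero_of_hypergeometric hd hg hF0 hF hEF⟩

end Datum

/-! ### The degree of the Euler polynomial -/

section HasTop

variable {R : Type*} [CommRing R] {f g : R[X]} {a b a' b' : R} {n m : ℕ}

/-- `f = a z ^ n + b z ^ (n - 1) + ⋯`; reversing the coefficients gives a meaning to `b = 0` when
`n = 0`. -/
def HasTop (n : ℕ) (f : R[X]) (a b : R) : Prop :=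
  f.natDegree ≤ n ∧ (f.reflect n).coeff 0 = a ∧ (f.reflect n).coeff 1 = b

theorem HasTop.mul (hf : HasTop n f a b) (hg : HasTop m g a' b') :
    HasTop (n + m) (f * g) (a * a') (a * b' + b * a') := by
  obtain ⟨hf, rfl, rfl⟩ := hf
  obtain ⟨hg, rfl, rfl⟩ := hg
  refine ⟨natDegree_mul_le_of_le hf hg, ?_, ?_⟩
  · rw [reflect_mul f g hf hg, mul_coeff_zero]
  · rw [reflect_mul f g hf hg, mul_coeff_one]

theorem hasTop_one : HasTop 0 (1 : R[X]) 1 0 := by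
  simp [HasTop, reflect_one, coeff_one]

theorem hasTop_X_add_C (c : R) : HasTop 1 (X + C c) 1 c := by
  refine ⟨(natDegree_add_C (p := X)).trans_le natDegree_X_le, ?_, ?_⟩ <;>
    simp [reflect_add, coeff_one]

theorem hasTop_quadratic (a b c : R) : HasTop 2 (C a * X ^ 2 + C b * X + C c) a b :=
  ⟨natDegree_quadratic_le, by simp [coeff_reflect, coeff_X],
    by simp [coeff_reflect, revAt_le]⟩

theorem HasTop.C_mul (c : R) (hf : HasTop n f a b) : HasTop n (C c * f) (c * a) (c * b) := by
  obtain ⟨hf, rfl, rfl⟩ := hf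
  exact ⟨(natDegree_C_mul_le c f).trans hf, by simp [reflect_C_mul], by simp [reflect_C_mul]⟩

theorem HasTop.sum {ι : Type*} {s : Finset ι} {f : ι → R[X]} {a b : ι → R}
    (h : ∀ i ∈ s, HasTop n (f i) (a i) (b i)) :
    HasTop n (∑ i ∈ s, f i) (∑ i ∈ s, a i) (∑ i ∈ s, b i) := by
  refine ⟨natDegree_sum_le_of_forall_le _ _ fun i hi => (h i hi).1, ?_, ?_⟩ <;>
    simp only [coeff_reflect, finsetSum_coeff]
  · exact Finset.sum_congr rfl fun i hi => by rw [← (h i hi).2.1, coeff_reflect]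
  · exact Finset.sum_congr rfl fun i hi => by rw [← (h i hi).2.2, coeff_reflect]

theorem HasTop.prod {ι : Type*} {s : Finset ι} {f : ι → R[X]} {b : ι → R}
    (h : ∀ i ∈ s, HasTop n (f i) 1 (b i)) :
    HasTop (s.card * n) (∏ i ∈ s, f i) 1 (∑ i ∈ s, b i) := by
  classical
  induction s using Finset.induction_on with
  | empty => simpa using hasTop_one
  | insert i s hi ih =>
    rw [Finset.prod_insert hi, Finset.sum_insert hi, Finset.card_insert_of_notMem hi, add_one_mul,
      add_comm _ n]
    simpa [add_comm] using (h i (Finset.mem_insert_self i s)).mul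
      (ih fun j hj => h j (Finset.mem_insert_of_mem hj))

theorem hasTop_multiset_prod_X_sub_C (s : Multiset R) :
    HasTop s.card (s.map fun r => X - C r).prod 1 (-s.sum) := by
  induction s using Multiset.induction_on with
  | empty => simpa using hasTop_one
  | cons r s ih =>
    rw [Multiset.map_cons, Multiset.prod_cons, Multiset.sum_cons, Multiset.card_cons, add_comm _ 1]
    simpa [sub_eq_add_neg, add_comm] using (hasTop_X_add_C (-r)).mul ih

end HasTop

theorem hasTop_comp_X_sub (E : ℂ[X]) (j : ℕ) :
    HasTop E.natDegree (E.comp (X - (j : ℂ[X]))) E.leadingCoeff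
      (-(E.leadingCoeff * (E.roots.sum + E.natDegree * j))) := by
  have hE := IsAlgClosed.splits E
  have hcard : (E.roots.map fun r => r + (j : ℂ)).card = E.natDegree := by
    rw [Multiset.card_map, hE.natDegree_eq_card_roots]
  have hsum : (E.roots.map fun r => r + (j : ℂ)).sum = E.roots.sum + E.natDegree * j := by
    simp [Multiset.sum_map_add, hE.natDegree_eq_card_roots]
  have hcomp : E.comp (X - (j : ℂ[X])) = C E.leadingCoeff *
      ((E.roots.map fun r => r + (j : ℂ)).map fun r => X - C r).prod := by
    conv_lhs => rw [hE.eq_prod_roots]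
    rw [mul_comp, C_comp, multiset_prod_comp, Multiset.map_map, Multiset.map_map]
    congr 3
    funext r
    simp [sub_sub, add_comm]
  have := (hasTop_multiset_prod_X_sub_C (E.roots.map fun r => r + (j : ℂ))).C_mul E.leadingCoeff
  rwa [hcard, hsum, ← hcomp, mul_one, mul_neg] at this

namespace Datum

variable {M : ℕ}

section

variable {A : Type*} [CommRing A]

theorem hasTop_H₁_comp (d : Datum M A) (i : ℕ) :
    HasTop 2 (d.H₁.comp (X - (i : A[X]))) 1 (d.γ - 1 - 2 * i) := by
  convert (hasTop_X_add_C (-(i : A))).mul (hasTop_X_add_C (d.γ - 1 - i)) using 1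
  · simp [H₁]; ring
  · ring
  · ring

theorem hasTop_H₂_comp (d : Datum M A) (i : ℕ) :
    HasTop 2 (d.H₂.comp (X - (i : A[X]))) 1 (d.α + d.β - 2 * i) := by
  convert (hasTop_X_add_C (d.α - i)).mul (hasTop_X_add_C (d.β - i)) using 1
  · simp [H₂]; ring
  · ring
  · ring

theorem hasTop_shiftFactor (d : Datum M A) {j : ℕ} (hj : j ≤ M + 1) :
    HasTop (2 * (M + 1)) (d.shiftFactor j) 1
      (∑ i ∈ Finset.range (M + 1), (d.α + d.β - 2 * ((i + 1 : ℕ) : A)) +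
        j * (d.γ + 1 - d.α - d.β)) := by
  convert (HasTop.prod fun i (_ : i ∈ Finset.range j) => d.hasTop_H₁_comp i).mul
    (HasTop.prod fun i (_ : i ∈ Finset.Ico j (M + 1)) => d.hasTop_H₂_comp (i + 1)) using 1
  · rw [Finset.card_range, Nat.card_Ico]; omega
  · rfl
  · rw [one_mul]
  · have : ∑ i ∈ Finset.range j, (d.γ - 1 - 2 * (i : A)) =
        ∑ i ∈ Finset.range j, (d.α + d.β - 2 * ((i + 1 : ℕ) : A)) +
          j * (d.γ + 1 - d.α - d.β) := by
      rw [Finset.sum_congr rfl fun (i : ℕ) _ => show d.γ - 1 - 2 * (i : A) =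
          d.α + d.β - 2 * ((i + 1 : ℕ) : A) + (d.γ + 1 - d.α - d.β) by push_cast; ring,
        Finset.sum_add_distrib, Finset.sum_const, Finset.card_range, nsmul_eq_mul]
    rw [← Finset.sum_range_add_sum_Ico _ hj, this]
    ring

theorem hasTop_eulerPart_comp (d : Datum M A) (j : ℕ) :
    HasTop 2 ((d.eulerPart j).comp (X - (j : A[X]))) (((X - 1) * d.T).coeff j)
      (d.p.coeff j - (2 * j + 1) * ((X - 1) * d.T).coeff j) := by
  convert hasTop_quadratic _ _ (((X - 1) * d.T).coeff j * (j ^ 2 + j) - d.p.coeff j * j +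
    (X * d.S).coeff j) using 1
  simp only [eulerPart, add_comp, mul_comp, C_comp, sub_comp, pow_comp, X_comp, map_add, map_sub,
    map_mul, map_pow, map_natCast, map_one, map_ofNat]
  ring

end

theorem sum_coeff_X_sub_one_mul_T (d : Datum M ℂ) :
    ∑ j ∈ Finset.range (M + 2), ((X - 1) * d.T).coeff j = 0 := by
  simpa using (eval_eq_sum_range' d.natDegree_X_sub_one_mul_T_lt 1).symm

theorem sum_coeff_p (d : Datum M ℂ) :
    ∑ j ∈ Finset.range (M + 2), d.p.coeff j = d.δ * d.T.eval 1 := by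
  simpa [p] using (eval_eq_sum_range' (Nat.lt_succ_of_le d.natDegree_p_le) 1).symm

theorem sum_mul_coeff_X_sub_one_mul_T (d : Datum M ℂ) :
    ∑ j ∈ Finset.range (M + 2), (j : ℂ) * ((X - 1) * d.T).coeff j = d.T.eval 1 := by
  have h := derivative_eval ((X - 1) * d.T) 1
  rw [sum_over_range' _ (by simp) _ d.natDegree_X_sub_one_mul_T_lt] at h
  simpa [mul_comm] using h.symm

theorem natDegree_eq_of_indicial (d : Datum M ℂ) (hd : d.Distinct) {E : ℂ[X]} (hE : E ≠ 0)
    (h : d.indicial E = 0) : E.natDegree = d.N := by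
  have hterm : ∀ j ∈ Finset.range (M + 2), HasTop (2 + E.natDegree + 2 * (M + 1))
      ((d.eulerPart j * E).comp (X - (j : ℂ[X])) * d.shiftFactor j) _ _ := fun j hj => by
    rw [mul_comp]
    exact ((d.hasTop_eulerPart_comp j).mul (hasTop_comp_X_sub E j)).mul
      (d.hasTop_shiftFactor (Nat.lt_succ_iff.1 (Finset.mem_range.1 hj)))
  have hcoeff := (HasTop.sum hterm).2.2
  rw [← indicial, h, reflect_zero, coeff_zero] at hcoeff
  have hsum : d.T.eval 1 * E.leadingCoeff * (d.N - E.natDegree) = 0 := by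
    generalize ∑ i ∈ Finset.range (M + 1), (d.α + d.β - 2 * ((i + 1 : ℕ) : ℂ)) = g at hcoeff
    rw [Finset.sum_congr rfl fun (j : ℕ) _ => show _ =
        ((X - 1) * d.T).coeff j * (E.leadingCoeff * (g - E.roots.sum - 1)) +
        (j : ℂ) * ((X - 1) * d.T).coeff j *
          (E.leadingCoeff * (d.γ - 1 - d.α - d.β - E.natDegree)) +
        d.p.coeff j * E.leadingCoeff by ring, Finset.sum_add_distrib, Finset.sum_add_distrib,
      ← Finset.sum_mul, ← Finset.sum_mul, ← Finset.sum_mul, d.sum_coeff_X_sub_one_mul_T,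
      d.sum_mul_coeff_X_sub_one_mul_T, d.sum_coeff_p, δ] at hcoeff
    linear_combination -hcoeff
  exact_mod_cast (sub_eq_zero.1 ((mul_eq_zero.1 hsum).resolve_left (mul_ne_zero
    (d.eval_T_ne_zero hd.ne_one) (leadingCoeff_ne_zero.2 hE)))).symm

end Datum

/-! ### Polynomial systems with isolated solutions -/

section Height

variable {R : Type*} [CommRing R] [IsNoetherianRing R] [IsJacobsonRing R]

theorem height_eq_add_one_of_equiv_polynomial {S : Type*} [CommRing S] {n : ℕ∞}
    (hR : ∀ p : Ideal R, p.IsMaximal → p.height = n) (e : S ≃+* R[X]) (P : Ideal S)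
    [P.IsMaximal] : P.height = n + 1 := by
  have hPe : (P.map e).IsMaximal := Ideal.map_isMaximal_of_equiv _
  have hunder : ((P.map e).under R).IsMaximal := isMaximal_comap_C_of_isJacobsonRing (P.map e)
  rw [← RingEquiv.height_map e, Polynomial.height_eq_height_add_one ((P.map e).under R) (P.map e),
    hR _ hunder]

theorem height_eq_add_card_of_isMaximal {n : ℕ∞}
    (hR : ∀ p : Ideal R, p.IsMaximal → p.height = n) (ι : Type*) [Finite ι]
    (P : Ideal (MvPolynomial ι R)) [P.IsMaximal] : P.height = n + Nat.card ι := by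
  induction ι using Finite.induction_empty_option with
  | of_equiv e ih =>
    have hPe : (P.map (MvPolynomial.renameEquiv R e.symm).toRingEquiv).IsMaximal :=
      Ideal.map_isMaximal_of_equiv _
    rw [← RingEquiv.height_map (MvPolynomial.renameEquiv R e.symm).toRingEquiv, ih,
      Nat.card_congr e]
  | h_empty =>
    have hPe : (P.map (MvPolynomial.isEmptyAlgEquiv R PEmpty).toRingEquiv).IsMaximal :=
      Ideal.map_isMaximal_of_equiv _
    rw [← RingEquiv.height_map (MvPolynomial.isEmptyAlgEquiv R PEmpty).toRingEquiv, hR _ hPe]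
    simp
  | @h_option ι _ ih =>
    rw [height_eq_add_one_of_equiv_polynomial (fun p hp => ih p)
      (MvPolynomial.optionEquivLeft R ι).toRingEquiv P]
    simp [add_assoc]

end Height

section TotalDegree

variable {σ A : Type*} [CommRing A] {n m : ℕ} {f g : MvPolynomial σ A}

variable (σ A n) in
/-- The polynomials of total degree less than `n`, the multivariate `Polynomial.degreeLT`. The
strict inequality makes this zero for `n = 0`. -/
def totalDegreeLT : Submodule A (MvPolynomial σ A) :=
  MvPolynomial.restrictSupport A {e | e.degree < n}

theorem mem_totalDegreeLT : f ∈ totalDegreeLT σ A n ↔ ∀ e, n ≤ e.degree → f.coeff e = 0 := by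
  rw [totalDegreeLT, MvPolynomial.mem_restrictSupport_iff, Set.subset_def]
  refine forall_congr' fun e => ?_
  rw [Finset.mem_coe, MvPolynomial.mem_support_iff, Set.mem_ofPred_eq, ← not_le, not_imp_not]

theorem totalDegreeLT_mono (h : n ≤ m) : totalDegreeLT σ A n ≤ totalDegreeLT σ A m :=
  MvPolynomial.restrictSupport_mono A fun _ he => lt_of_lt_of_le he h

theorem mul_mem_totalDegreeLT (hf : f ∈ totalDegreeLT σ A n) (hg : g ∈ totalDegreeLT σ A (m + 1)) :
    f * g ∈ totalDegreeLT σ A (n + m) := by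
  classical
  rw [mem_totalDegreeLT] at hf hg ⊢
  intro e he
  rw [MvPolynomial.coeff_mul]
  refine Finset.sum_eq_zero fun x hx => ?_
  have hdeg : x.1.degree + x.2.degree = e.degree := by
    rw [← Finset.HasAntidiagonal.mem_antidiagonal.1 hx, map_add]
  rcases Nat.lt_or_ge x.1.degree n with h | h
  · rw [hg _ (by omega), mul_zero]
  · rw [hf _ h, zero_mul]

theorem monomial_mem_totalDegreeLT {e : σ →₀ ℕ} (he : e.degree < n) (a : A) :
    MvPolynomial.monomial e a ∈ totalDegreeLT σ A n := by
  classical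
  refine mem_totalDegreeLT.2 fun e' he' => ?_
  rw [MvPolynomial.coeff_monomial, if_neg]
  rintro rfl
  omega

theorem C_mem_totalDegreeLT (a : A) : MvPolynomial.C a ∈ totalDegreeLT σ A 1 :=
  monomial_mem_totalDegreeLT (by simp) a

theorem X_mem_totalDegreeLT (i : σ) : MvPolynomial.X i ∈ totalDegreeLT σ A 2 :=
  monomial_mem_totalDegreeLT (by simp) 1

end TotalDegree

section Finite

variable {σ A : Type*} [CommRing A] {F : σ → MvPolynomial σ A} {m : σ → ℕ} {a : σ → Aˣ}

theorem monomial_mem_sup_of_leadingForm [Fintype σ]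
    (hF : ∀ k, F k - MvPolynomial.C (a k : A) * MvPolynomial.X k ^ (m k + 1) ∈
      totalDegreeLT σ A (m k + 1))
    {I : Ideal (MvPolynomial σ A)} (hI : ∀ k, F k ∈ I) (e : σ →₀ ℕ) :
    MvPolynomial.monomial e 1 ∈
      MvPolynomial.restrictTotalDegree σ A (∑ k, m k) ⊔ I.restrictScalars A := by
  induction hn : e.degree using Nat.strong_induction_on generalizing e with
  | _ n ih =>
  subst hn
  let W := MvPolynomial.restrictTotalDegree σ A (∑ k, m k) ⊔ I.restrictScalars A
  rcases Nat.lt_or_ge (∑ k, m k) e.degree with hgt | hle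
  swap
  · exact Submodule.mem_sup_left ((MvPolynomial.mem_restrictTotalDegree _ _ _).2
      ((MvPolynomial.totalDegree_monomial_le e 1).trans hle))
  obtain ⟨k, hk⟩ : ∃ k, m k < e k := by
    by_contra! h
    rw [Finsupp.degree_eq_sum] at hgt
    exact (Finset.sum_le_sum fun k _ => h k).not_gt hgt
  obtain ⟨e', rfl⟩ : ∃ e', e = e' + Finsupp.single k (m k + 1) :=
    ⟨_, (tsub_add_cancel_of_le (Finsupp.single_le_iff.2 hk)).symm⟩
  have hlower : totalDegreeLT σ A (e' + Finsupp.single k (m k + 1)).degree ≤ W := by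
    rw [totalDegreeLT, MvPolynomial.restrictSupport_eq_span, Submodule.span_le]
    rintro _ ⟨e'', he'', rfl⟩
    exact ih _ he'' e'' rfl
  have hmem := W.smul_mem (↑(a k)⁻¹ : A) (W.sub_mem
    (Submodule.mem_sup_right (I.mul_mem_left (MvPolynomial.monomial e' 1) (hI k)))
    (hlower (totalDegreeLT_mono (by rw [map_add, Finsupp.degree_single]; omega)
      (mul_mem_totalDegreeLT (monomial_mem_totalDegreeLT (Nat.lt_succ_self e'.degree) 1) (hF k)))))
  rwa [← mul_sub, sub_sub_cancel, MvPolynomial.X_pow_eq_monomial, MvPolynomial.C_mul_monomial,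
    MvPolynomial.monomial_mul, one_mul, mul_one, MvPolynomial.smul_monomial, smul_eq_mul,
    Units.inv_mul] at hmem

theorem finite_quotient_of_leadingForm [Finite σ]
    (hF : ∀ k, F k - MvPolynomial.C (a k : A) * MvPolynomial.X k ^ (m k + 1) ∈
      totalDegreeLT σ A (m k + 1))
    {I : Ideal (MvPolynomial σ A)} (hI : ∀ k, F k ∈ I) :
    Module.Finite A (MvPolynomial σ A ⧸ I) := by
  have := Fintype.ofFinite σ
  have htop : MvPolynomial.restrictTotalDegree σ A (∑ k, m k) ⊔ I.restrictScalars A = ⊤ := by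
    rw [eq_top_iff, ← MvPolynomial.restrictSupport_univ, MvPolynomial.restrictSupport_eq_span,
      Submodule.span_le]
    rintro _ ⟨e, -, rfl⟩
    exact monomial_mem_sup_of_leadingForm hF hI e
  refine Module.Finite.of_surjective ((Ideal.Quotient.mkₐ A I).toLinearMap.comp
    (MvPolynomial.restrictTotalDegree σ A (∑ k, m k)).subtype) fun x => ?_
  obtain ⟨f, rfl⟩ := Ideal.Quotient.mk_surjective x
  obtain ⟨g, hg, h, hh, rfl⟩ := Submodule.mem_sup.1 (htop ▸ Submodule.mem_top : f ∈ _)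
  exact ⟨⟨g, hg⟩, (by simp [Ideal.Quotient.eq_zero_iff_mem.2 (show h ∈ I from hh)])⟩

end Finite

theorem algebraMap_injective_of_not_isField {R B : Type*} [CommRing R] [Ring.DimensionLEOne R]
    [CommRing B] [IsDomain B] [Algebra R B] [Algebra.IsIntegral R B] (hB : ¬ IsField B) :
    Function.Injective (algebraMap R B) := by
  by_contra h
  rw [RingHom.injective_iff_ker_eq_bot] at h
  have hprime := RingHom.ker_isPrime (algebraMap R B)
  exact hB (Ring.isField_iff_maximal_bot.2
    (Ideal.isMaximal_of_isIntegral_of_isMaximal_comap (⊥ : Ideal B) (hprime.isMaximal h)))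

section Points

variable {k : Type*} [Field k] [IsAlgClosed k]
  {B : Type*} [CommRing B] [Algebra k[X] B] [Algebra k B] [IsScalarTower k k[X] B]
  [Module.Finite k[X] B]

theorem exists_algHom_algebraMap_X_eq (hinj : Function.Injective (algebraMap k[X] B)) (ε : k) :
    ∃ φ : B →ₐ[k] k, φ (algebraMap k[X] B X) = ε := by
  have hmax : (Ideal.span {X - C ε} : Ideal k[X]).IsMaximal :=
    PrincipalIdealRing.isMaximal_of_irreducible (irreducible_X_sub_C ε)
  obtain ⟨n, hn, hnε⟩ := Ideal.exists_ideal_over_maximal_of_isIntegral (S := B)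
    (Ideal.span {X - C ε}) (by rw [(RingHom.injective_iff_ker_eq_bot _).1 hinj]; exact bot_le)
  let _ : Field (B ⧸ n) := Ideal.Quotient.field n
  have hB : Algebra.FiniteType k B :=
    Algebra.FiniteType.trans (S := k[X]) inferInstance inferInstance
  have hfin : Module.Finite k (B ⧸ n) := finite_of_finite_type_of_isJacobsonRing _ _
  let e : (B ⧸ n) ≃ₐ[k] k := (AlgEquiv.ofBijective (Algebra.ofId k _)
    IsAlgClosed.algebraMap_bijective_of_isIntegral).symm
  refine ⟨(e : (B ⧸ n) →ₐ[k] k).comp (Ideal.Quotient.mkₐ k n), ?_⟩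
  have hX : X - C ε ∈ n.comap (algebraMap k[X] B) := hnε ▸ Ideal.mem_span_singleton_self _
  have hXn := Ideal.Quotient.eq_zero_iff_mem.2 (Ideal.mem_comap.1 hX)
  rw [map_sub, map_sub, sub_eq_zero, ← algebraMap_eq, ← IsScalarTower.algebraMap_apply] at hXn
  exact (congrArg e hXn).trans (e.commutes ε)

theorem exists_algHom_of_not_isField [IsDomain B] (hB : ¬ IsField B) {b : B} (hb : b ≠ 0)
    {s : Set k} (hs : sᶜ.Infinite) :
    ∃ φ : B →ₐ[k] k, φ b ≠ 0 ∧ φ (algebraMap k[X] B X) ∉ s := by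
  have hinj := algebraMap_injective_of_not_isField (R := k[X]) hB
  obtain ⟨c, hc, hc0⟩ := Submodule.exists_mem_ne_zero_of_ne_bot
    (Ideal.comap_ne_bot_of_integral_mem hb (Ideal.mem_span_singleton_self b)
      (Algebra.IsIntegral.isIntegral (R := k[X]) b))
  obtain ⟨ε, hεs, hεc⟩ := (hs.sdiff (rootSet_finite c k)).nonempty
  obtain ⟨φ, hφ⟩ := exists_algHom_algebraMap_X_eq hinj ε
  refine ⟨φ, fun hφb => hεc ?_, hφ ▸ hεs⟩
  obtain ⟨b', hb'⟩ := Ideal.mem_span_singleton'.1 (Ideal.mem_comap.1 hc)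
  have heval : (φ.comp (IsScalarTower.toAlgHom k k[X] B)) = aeval ε :=
    Polynomial.algHom_ext (by simpa using hφ)
  have : aeval ε c = 0 := by
    rw [← heval]
    simp [← hb', hφb]
  exact (mem_rootSet.2 ⟨hc0, this⟩)

end Points

theorem exists_generic_point {ι : Type*} [Finite ι] {F : ι → MvPolynomial ι ℂ[X]}
    {m : ι → ℕ} {a : ι → ℂ[X]ˣ}
    (hF : ∀ k, F k - MvPolynomial.C (a k : ℂ[X]) * MvPolynomial.X k ^ (m k + 1) ∈
      totalDegreeLT ι ℂ[X] (m k + 1))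
    {φ₀ : MvPolynomial ι ℂ[X] →ₐ[ℂ] ℂ} (hφ₀ : ∀ k, φ₀ (F k) = 0)
    {r : MvPolynomial ι ℂ[X]} (hr : φ₀ r ≠ 0) {s : Set ℂ} (hs : s.Countable) :
    ∃ φ : MvPolynomial ι ℂ[X] →ₐ[ℂ] ℂ, (∀ k, φ (F k) = 0) ∧ φ r ≠ 0 ∧
      φ (MvPolynomial.C X) ∉ s := by
  have hker : (RingHom.ker φ₀).IsMaximal := RingHom.ker_isMaximal_of_surjective φ₀ fun c =>
    ⟨algebraMap ℂ _ c, φ₀.commutes c⟩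
  have hle : Ideal.span (Set.range F) ≤ RingHom.ker φ₀ := by
    rw [Ideal.span_le]
    rintro _ ⟨k, rfl⟩
    exact hφ₀ k
  obtain ⟨p, hp, hpk⟩ := Ideal.exists_minimalPrimes_le hle
  have hprime : p.IsPrime := hp.1.1
  have hFp : ∀ k, F k ∈ p := fun k => hp.1.2 (Ideal.subset_span ⟨k, rfl⟩)
  have hfin := finite_quotient_of_leadingForm hF hFp
  have hnot : ¬ p.IsMaximal := fun hmax => by
    have hheight := height_eq_add_card_of_isMaximal (R := ℂ[X]) (n := 1) (fun q _ =>
      IsPrincipalIdealRing.height_eq_one_of_isMaximal q (Polynomial.not_isField ℂ)) ι p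
    have hle := Ideal.height_le_card_of_mem_minimalPrimes_span (Set.finite_range F) hp
    have hcard : (Set.range F).ncard ≤ Nat.card ι := by
      rw [← Set.image_univ, ← Set.ncard_univ]
      exact Set.ncard_image_le Set.finite_univ
    rw [hheight] at hle
    have : 1 + Nat.card ι ≤ (Set.range F).ncard := by exact_mod_cast hle
    omega
  obtain ⟨φ, hφr, hφs⟩ := exists_algHom_of_not_isField (B := MvPolynomial ι ℂ[X] ⧸ p)
    (fun h => hnot (Ideal.Quotient.maximal_of_isField p h))
    (fun h => hr (hpk (Ideal.Quotient.eq_zero_iff_mem.1 h)) : Ideal.Quotient.mk p r ≠ 0)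
    fun h => not_countable_complex (Set.union_compl_self s ▸ hs.union h.countable)
  refine ⟨φ.comp (Ideal.Quotient.mkₐ ℂ p), fun k => ?_, hφr, hφs⟩
  simp [Ideal.Quotient.eq_zero_iff_mem.2 (hFp k)]

/-! ### Specialization -/

section LinearIndependent

variable {R ι κ : Type*} [CommRing R] [Algebra ℂ R]

theorem exists_linearIndependent_col_map [Finite ι] [Finite κ] (A : Matrix ι κ R) {φ₀ : R →ₐ[ℂ] ℂ}
    (h : LinearIndependent ℂ (A.map φ₀).col) :
    ∃ r : R, φ₀ r ≠ 0 ∧ ∀ φ : R →ₐ[ℂ] ℂ, φ r ≠ 0 → LinearIndependent ℂ (A.map φ).col := by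
  classical
  cases nonempty_fintype ι
  cases nonempty_fintype κ
  obtain ⟨g, hg⟩ := LinearMap.exists_leftInverse_of_injective (A.map φ₀).mulVecLin
    (LinearMap.ker_eq_bot.2 (Matrix.mulVec_injective_iff.2 h))
  have hBA : LinearMap.toMatrix' g * A.map φ₀ = 1 := by
    have := congrArg LinearMap.toMatrix' hg
    rwa [LinearMap.toMatrix'_comp, ← Matrix.toLin'_apply', LinearMap.toMatrix'_toLin',
      LinearMap.toMatrix'_id] at this
  let B := LinearMap.toMatrix' g
  have hdet (φ : R →ₐ[ℂ] ℂ) : φ (B.map (algebraMap ℂ R) * A).det = (B * A.map φ).det := by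
    rw [AlgHom.map_det, AlgHom.mapMatrix_apply, Matrix.map_mul, Matrix.map_map]
    congr 2
    ext i j
    exact φ.commutes _
  refine ⟨(B.map (algebraMap ℂ R) * A).det, ?_, fun φ hφ => Matrix.mulVec_injective_iff.1 ?_⟩
  · rw [hdet, hBA, Matrix.det_one]
    exact one_ne_zero
  · rw [hdet] at hφ
    have hinj : Function.Injective (B * A.map φ).mulVec :=
      Matrix.mulVec_injective_of_isUnit ((Matrix.isUnit_iff_isUnit_det _).2 hφ.isUnit)
    refine Function.Injective.of_comp (f := B.mulVec) ?_
    simpa only [Function.comp_def, Matrix.mulVec_mulVec] using hinj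

theorem linearIndependent_coeff_iff {v : κ → ι → ℂ[X]} {n : ℕ}
    (hv : ∀ j i, (v j i).degree < n) :
    LinearIndependent ℂ (fun j (p : ι × Fin n) => (v j p.1).coeff p.2) ↔ LinearIndependent ℂ v := by
  let w (j : κ) (i : ι) : degreeLT ℂ n := ⟨v j i, mem_degreeLT.2 (hv j i)⟩
  let f : (ι → degreeLT ℂ n) →ₗ[ℂ] ι → ℂ[X] := LinearMap.compLeft (degreeLT ℂ n).subtype ι
  let g : (ι → degreeLT ℂ n) →ₗ[ℂ] ι × Fin n → ℂ :=
    (LinearEquiv.curry ℂ ℂ ι (Fin n)).symm ∘ₗ LinearMap.compLeft (degreeLTEquiv ℂ n).toLinearMap ι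
  have hf : LinearMap.ker f = ⊥ := LinearMap.ker_eq_bot.2 Subtype.val_injective.comp_left
  have hg : LinearMap.ker g = ⊥ := LinearMap.ker_eq_bot.2
    ((LinearEquiv.curry ℂ ℂ ι (Fin n)).symm.injective.comp
      (degreeLTEquiv ℂ n).injective.comp_left)
  exact (LinearMap.linearIndependent_iff g hg (v := w)).trans
    (LinearMap.linearIndependent_iff f hf (v := w)).symm

theorem exists_linearIndependent_map [Finite ι] [Finite κ] (v : κ → ι → R[X]) {φ₀ : R →ₐ[ℂ] ℂ}
    (h : LinearIndependent ℂ fun j i => (v j i).map (φ₀ : R →+* ℂ)) :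
    ∃ r : R, φ₀ r ≠ 0 ∧ ∀ φ : R →ₐ[ℂ] ℂ, φ r ≠ 0 →
      LinearIndependent ℂ fun j i => (v j i).map (φ : R →+* ℂ) := by
  cases nonempty_fintype ι
  cases nonempty_fintype κ
  obtain ⟨n, hn⟩ : ∃ n : ℕ, ∀ j i, (v j i).degree < n :=
    ⟨(Finset.univ.sup fun p : κ × ι => (v p.1 p.2).natDegree) + 1, fun j i =>
      degree_le_natDegree.trans_lt (Nat.cast_lt.2 (Nat.lt_succ_of_le
        (Finset.le_sup (f := fun p : κ × ι => (v p.1 p.2).natDegree) (Finset.mem_univ (j, i)))))⟩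
  have hcol (φ : R →ₐ[ℂ] ℂ) : LinearIndependent ℂ
      ((Matrix.of fun (p : ι × Fin n) j => (v j p.1).coeff p.2).map φ).col ↔
        LinearIndependent ℂ fun j i => (v j i).map (φ : R →+* ℂ) := by
    rw [← linearIndependent_coeff_iff fun j i => degree_map_le.trans_lt (hn j i)]
    simp only [coeff_map]
    rfl
  simp only [← hcol] at h ⊢
  exact exists_linearIndependent_col_map _ h

theorem linearIndependent_X_pow_iff {A V : Type*} [CommRing A] [AddCommGroup V] [Module A V]
    (L : A[X] →ₗ[A] V) {n : ℕ} : LinearIndependent A (fun j : Fin n => L (X ^ (j : ℕ))) ↔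
      ∀ E ∈ degreeLT A n, L E = 0 → E = 0 := by
  have h : Fintype.linearCombination A (fun j : Fin n => L (X ^ (j : ℕ))) =
      L ∘ₗ (degreeLT A n).subtype ∘ₗ (degreeLT.basis A n).equivFun.symm.toLinearMap := by
    ext j
    simp
  rw [linearIndependent_iff_injective_fintypeLinearCombination, h, ← LinearMap.comp_assoc,
    LinearMap.coe_comp, LinearEquiv.coe_coe, EquivLike.injective_comp, injective_iff_map_eq_zero]
  simp

end LinearIndependent

namespace Datum

section Map

variable {M : ℕ} {A B : Type*} [CommRing A] [CommRing B] (d : Datum M A) (f : A →+* B)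

/-- Base change of the parameters. -/
@[simps]
def map : Datum M B where
  t k := f (d.t k)
  m := d.m
  α := f d.α
  β := f d.β
  γ := f d.γ
  η k := f (d.η k)

theorem map_N : (d.map f).N = d.N := rfl

theorem map_δ : (d.map f).δ = f d.δ := by
  simp [δ, map_N]

theorem map_T : (d.map f).T = d.T.map f := by
  simp [T, Polynomial.map_prod]

theorem map_Tk (k : Fin M) : (d.map f).Tk k = (d.Tk k).map f := by
  simp [Tk, Polynomial.map_prod]

theorem map_mT : (d.map f).mT = d.mT.map f := by
  simp [mT, map_Tk, Polynomial.map_sum]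

theorem map_q : (d.map f).q = d.q.map f := by
  simp [q, map_T]

theorem map_p : (d.map f).p = d.p.map f := by
  simp [p, map_T, map_mT, map_δ]

theorem map_S : (d.map f).S = d.S.map f := by
  simp [S, map_T, map_Tk, Polynomial.map_sum]

theorem map_H₁ : (d.map f).H₁ = d.H₁.map f := by
  simp [H₁]

theorem map_H₂ : (d.map f).H₂ = d.H₂.map f := by
  simp [H₂]

theorem map_thetaIter (j : ℕ) :
    (d.map f).thetaIter j = ((d.thetaIter j).1.map f, (d.thetaIter j).2.map f) := by
  induction j with
  | zero => simp [thetaIter]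
  | succ j ih =>
    have h : (X - 1) * d.T.map f = ((X - 1) * d.T).map f := by simp
    simp only [thetaIter, ih, map_q, map_p, map_S, map_T, h, derivative_map]
    simp only [Polynomial.map_sub, Polynomial.map_add, Polynomial.map_mul, map_X,
      Polynomial.map_natCast]

theorem map_opCoeff (E : A[X]) (j : ℕ) :
    (d.map f).opCoeff (E.map f) j = (d.opCoeff E j).map f := by
  have h₁ : d.H₁.map f * (E.map f).comp (X - 1) = (d.H₁ * E.comp (X - 1)).map f := by
    simp [Polynomial.map_comp]
  have h₂ : d.H₂.map f * (E.map f).comp (X + 1) = (d.H₂ * E.comp (X + 1)).map f := by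
    simp [Polynomial.map_comp]
  rw [opCoeff, map_H₁, map_H₂, h₁, h₂, coeff_map, coeff_map, opCoeff, Polynomial.map_sub,
    Polynomial.map_mul, map_X, map_C, map_C]

theorem map_rem (E : A[X]) :
    (d.map f).rem (E.map f) = ((d.rem E).1.map f, (d.rem E).2.map f) := by
  simp [rem, map_opCoeff, map_T, map_thetaIter, map_N, Polynomial.map_sum]

theorem map_eulerPart (j : ℕ) : (d.map f).eulerPart j = (d.eulerPart j).map f := by
  have h₁ : (X - 1) * d.T.map f = ((X - 1) * d.T).map f := by simp
  have h₂ : X * d.S.map f = (X * d.S).map f := by simp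
  rw [eulerPart, map_T, map_p, map_S, h₁, h₂, coeff_map, coeff_map, coeff_map, eulerPart]
  simp only [Polynomial.map_sub, Polynomial.map_add, Polynomial.map_mul, Polynomial.map_pow, map_X,
    map_C]

theorem map_shiftFactor (j : ℕ) : (d.map f).shiftFactor j = (d.shiftFactor j).map f := by
  simp [shiftFactor, Polynomial.map_prod, Polynomial.map_comp, map_H₁, map_H₂]

theorem map_indicial (E : A[X]) : (d.map f).indicial (E.map f) = (d.indicial E).map f := by
  simp [indicial, Polynomial.map_sum, map_eulerPart, map_shiftFactor, Polynomial.map_comp]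

end Map

section Condition

variable {M : ℕ} {A : Type*} [CommRing A] (d : Datum M A)

theorem opCoeff_add (E E' : A[X]) (j : ℕ) :
    d.opCoeff (E + E') j = d.opCoeff E j + d.opCoeff E' j := by
  simp only [opCoeff, add_comp, mul_add, coeff_add, C_add]
  ring

theorem opCoeff_smul (c : A) (E : A[X]) (j : ℕ) : d.opCoeff (c • E) j = c • d.opCoeff E j := by
  simp only [opCoeff, smul_comp, mul_smul_comm, coeff_smul, smul_eq_mul, C_mul]
  rw [smul_eq_C_mul]
  ring

/-- The linear conditions on the Euler polynomial: the remainder and the indicial polynomial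
vanish. -/
def condition : A[X] →ₗ[A] Fin 3 → A[X] where
  toFun E := ![(d.rem E).1, (d.rem E).2, d.indicial E]
  map_add' E E' := by
    simp [rem, indicial, opCoeff_add, add_mul, mul_add, Finset.sum_add_distrib]
  map_smul' c E := by
    simp [rem, indicial, opCoeff_smul, Finset.smul_sum]

theorem map_condition {B : Type*} [CommRing B] (f : A →+* B) (E : A[X]) (i : Fin 3) :
    (d.map f).condition (E.map f) i = (d.condition E i).map f := by
  fin_cases i <;> simp [condition, map_rem, map_indicial]

theorem condition_eq_zero_iff {E : A[X]} :
    d.condition E = 0 ↔ d.rem E = 0 ∧ d.indicial E = 0 := by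
  simp [condition, Prod.ext_iff, and_assoc]

end Condition

end Datum

section LocalCoeff

variable {A : Type*} [CommRing A]

/-- The coefficient of `(z - t) ^ n` in the Taylor expansion at `t`. -/
def localCoeff (t : A) (n : ℕ) : A[X] →ₗ[A] A := lcoeff A n ∘ₗ taylor t

theorem localCoeff_pow_mul (t : A) (n : ℕ) (f : A[X]) :
    localCoeff t n ((X - C t) ^ n * f) = f.eval t := by
  have h : taylor t (X - C t) = X := by simp
  rw [localCoeff, LinearMap.comp_apply, lcoeff_apply, taylor_mul, taylor_pow, h]
  simpa only [zero_add, taylor_coeff_zero] using coeff_X_pow_mul (taylor t f) n 0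

theorem map_localCoeff {B : Type*} [CommRing B] (φ : A →+* B) (t : A) (n : ℕ) (f : A[X]) :
    localCoeff (φ t) n (f.map φ) = φ (localCoeff t n f) := by
  simp [localCoeff, ← map_taylor]

theorem pow_succ_dvd_iff_localCoeff {t : A} {n : ℕ} {f : A[X]} (h : (X - C t) ^ n ∣ f) :
    (X - C t) ^ (n + 1) ∣ f ↔ localCoeff t n f = 0 := by
  constructor
  · rintro ⟨g, rfl⟩
    rw [pow_succ, mul_assoc, localCoeff_pow_mul, eval_mul, eval_sub, eval_X, eval_C, sub_self,
      zero_mul]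
  · obtain ⟨g, rfl⟩ := h
    rw [localCoeff_pow_mul, pow_succ]
    exact fun h0 => mul_dvd_mul_left _ (dvd_iff_isRoot.2 h0)

end LocalCoeff

/-! ### Obstructions to apparent singularities -/

namespace Datum

section Oper

variable {M : ℕ} {A : Type*} [CommRing A] (d : Datum M A)

/-- The second order operator with polynomial coefficients. -/
def oper : A[X] →ₗ[A] A[X] :=
  LinearMap.mulLeft A d.q ∘ₗ derivative ∘ₗ derivative + LinearMap.mulLeft A d.p ∘ₗ derivative +
    LinearMap.mulLeft A d.S

theorem oper_apply (f : A[X]) :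
    d.oper f = d.q * derivative (derivative f) + d.p * derivative f + d.S * f := rfl

theorem map_oper {B : Type*} [CommRing B] (φ : A →+* B) (f : A[X]) :
    (d.map φ).oper (f.map φ) = (d.oper f).map φ := by
  simp only [oper_apply, map_q, map_p, map_S, derivative_map, Polynomial.map_add,
    Polynomial.map_mul]

/-- The derivative of `q` at `t_k`. -/
def weight (k : Fin M) : A := d.t k * (d.t k - 1) * (d.Tk k).eval (d.t k)

theorem eval_p_t (k : Fin M) : d.p.eval (d.t k) = -(d.m k * d.weight k) := by
  simp only [p, eval_sub, eval_add, eval_mul, eval_C, eval_X, eval_one, eval_T_t, eval_mT_t, weight]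
  ring

theorem exists_oper_pow_mul (k : Fin M) (n : ℕ) (h : A[X]) :
    ∃ w, d.oper ((X - C (d.t k)) ^ (n + 1) * h) = (X - C (d.t k)) ^ n * w ∧
      w.eval (d.t k) = (n + 1) * (n - d.m k) * d.weight k * h.eval (d.t k) := by
  set x := X - C (d.t k) with hx
  refine ⟨X * (X - 1) * d.Tk k * (((n : A[X]) + 1) * (n : A[X]) * h
    + 2 * ((n : A[X]) + 1) * x * derivative h + x ^ 2 * derivative (derivative h))
    + d.p * (((n : A[X]) + 1) * h + x * derivative h) + d.S * x * h, ?_, ?_⟩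
  · have hD : x * derivative (x ^ n) = n * x ^ n := by
      rw [hx, derivative_X_sub_C_pow]
      cases n with
      | zero => simp
      | succ n => rw [Nat.add_sub_cancel, pow_succ, map_natCast]; ring
    have hD' : derivative (x ^ (n + 1)) = (n + 1) * x ^ n := by
      rw [hx, derivative_X_sub_C_pow, Nat.add_sub_cancel]; simp
    simp only [oper_apply, derivative_add, derivative_mul, derivative_natCast, derivative_one, hD',
      q, ← d.X_sub_C_mul_Tk k, ← hx]
    linear_combination X * (X - 1) * d.Tk k * (n + 1) * h * hD
  · simp only [hx, eval_add, eval_mul, eval_sub, eval_pow, eval_X, eval_C, eval_one, eval_natCast,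
      eval_ofNat, eval_p_t, weight]
    ring

theorem pow_dvd_oper_pow_mul (k : Fin M) (n : ℕ) (h : A[X]) :
    (X - C (d.t k)) ^ n ∣ d.oper ((X - C (d.t k)) ^ (n + 1) * h) := by
  obtain ⟨w, hw, -⟩ := d.exists_oper_pow_mul k n h
  exact ⟨w, hw⟩

theorem localCoeff_oper_pow_mul (k : Fin M) (n : ℕ) (h : A[X]) :
    localCoeff (d.t k) n (d.oper ((X - C (d.t k)) ^ (n + 1) * h)) =
      (n + 1) * (n - d.m k) * d.weight k * h.eval (d.t k) := by
  obtain ⟨w, hw, heval⟩ := d.exists_oper_pow_mul k n h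
  rw [hw, localCoeff_pow_mul, heval]

variable [Algebra ℂ A]

/-- The Frobenius approximations to the local solution with exponent zero at `t_k`, where `κ` is the
weight of `t_k`; it is a separate argument because it has to be inverted. -/
def frob (κ : ℂ) (k : Fin M) : ℕ → A[X]
  | 0 => 1
  | n + 1 => frob κ k n - (((n + 1) * (n - d.m k) * κ)⁻¹ •
      localCoeff (d.t k) n (d.oper (frob κ k n))) • (X - C (d.t k)) ^ (n + 1)

/-- The coefficient of the logarithmic term at `t_k`, up to a constant. -/
def obstruction (κ : ℂ) (k : Fin M) : A :=
  localCoeff (d.t k) (d.m k) (d.oper (d.frob κ k (d.m k)))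

theorem eval_frob (κ : ℂ) (k : Fin M) (n : ℕ) : (d.frob κ k n).eval (d.t k) = 1 := by
  induction n with
  | zero => simp [frob]
  | succ n ih => simp [frob, ih]

variable {B : Type*} [CommRing B] [Algebra ℂ B] (φ : A →ₐ[ℂ] B)

theorem map_frob (κ : ℂ) (k : Fin M) (n : ℕ) :
    (d.map (φ : A →+* B)).frob κ k n = (d.frob κ k n).map (φ : A →+* B) := by
  induction n with
  | zero => simp [frob]
  | succ n ih =>
    simp only [frob, ih, map_oper, map_t, map_m, map_localCoeff, Polynomial.map_sub,
      Polynomial.map_smul, Polynomial.map_pow, map_X, map_C]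
    simp only [RingHom.coe_coe, _root_.map_smul]

theorem map_obstruction (κ : ℂ) (k : Fin M) :
    (d.map (φ : A →+* B)).obstruction κ k = φ (d.obstruction κ k) := by
  rw [obstruction, map_frob, map_oper, map_t, map_m, map_localCoeff, obstruction, RingHom.coe_coe]

end Oper

variable {M : ℕ} (d : Datum M ℂ)

theorem frob_denom_ne_zero (hd : d.Distinct) (k : Fin M) {n : ℕ} (hn : n < d.m k) :
    ((n + 1) * (n - d.m k) * d.weight k : ℂ) ≠ 0 := by
  have hm : (n - d.m k : ℂ) ≠ 0 := sub_ne_zero.2 (Nat.cast_injective.ne hn.ne)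
  exact mul_ne_zero (mul_ne_zero (Nat.cast_add_one_ne_zero n) hm) (mul_ne_zero
    (mul_ne_zero (hd.ne_zero k) (sub_ne_zero.2 (hd.ne_one k))) (d.eval_Tk_self_ne_zero hd.inj k))

theorem pow_dvd_oper_frob (hd : d.Distinct) (k : Fin M) {n : ℕ} (hn : n ≤ d.m k) :
    (X - C (d.t k)) ^ n ∣ d.oper (d.frob (d.weight k) k n) := by
  induction n with
  | zero => simp
  | succ n ih =>
    have hdvd := d.pow_dvd_oper_pow_mul k n 1
    have hcoeff := d.localCoeff_oper_pow_mul k n 1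
    rw [mul_one] at hdvd hcoeff
    rw [eval_one, mul_one] at hcoeff
    rw [frob, map_sub, map_smul, pow_succ_dvd_iff_localCoeff
      (dvd_sub (ih (by omega)) (dvd_smul_of_dvd _ hdvd)), map_sub, map_smul, hcoeff, smul_eq_mul,
      smul_eq_mul, mul_right_comm, inv_mul_cancel₀ (d.frob_denom_ne_zero hd k hn), one_mul,
      sub_self]

theorem pow_succ_dvd_of_pow_dvd_oper (hd : d.Distinct) (k : Fin M) {n : ℕ} (hn : n < d.m k)
    {f : ℂ[X]} (hf : (X - C (d.t k)) ^ (n + 1) ∣ f)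
    (hoper : (X - C (d.t k)) ^ (n + 1) ∣ d.oper f) : (X - C (d.t k)) ^ (n + 2) ∣ f := by
  obtain ⟨g, rfl⟩ := hf
  rw [pow_succ_dvd_iff_localCoeff (d.pow_dvd_oper_pow_mul k n g), localCoeff_oper_pow_mul] at hoper
  rw [pow_succ_dvd_iff_localCoeff (dvd_mul_right _ _), localCoeff_pow_mul]
  exact (mul_eq_zero.1 hoper).resolve_left (d.frob_denom_ne_zero hd k hn)

theorem pow_succ_dvd_sub_frob (hd : d.Distinct) (k : Fin M) {f : ℂ[X]} (hf : f.eval (d.t k) = 1)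
    (h : (X - C (d.t k)) ^ (d.m k + 1) ∣ d.oper f) {n : ℕ} (hn : n ≤ d.m k) :
    (X - C (d.t k)) ^ (n + 1) ∣ f - d.frob (d.weight k) k n := by
  induction n with
  | zero => simp [frob, dvd_iff_isRoot, hf]
  | succ n ih =>
    refine d.pow_succ_dvd_of_pow_dvd_oper hd k hn ?_ ?_
    · rw [frob, ← sub_add]
      exact dvd_add (ih (by omega)) (dvd_smul_of_dvd _ dvd_rfl)
    · rw [map_sub]
      exact dvd_sub ((pow_dvd_pow _ (by omega)).trans h) (d.pow_dvd_oper_frob hd k hn)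

theorem obstruction_eq_zero_iff (hd : d.Distinct) (k : Fin M) :
    d.obstruction (d.weight k) k = 0 ↔ d.ApparentAt k := by
  have hfrob := pow_succ_dvd_iff_localCoeff (d.pow_dvd_oper_frob hd k le_rfl)
  constructor
  · exact fun h => ⟨_, by rw [eval_frob]; exact one_ne_zero, hfrob.2 h⟩
  · rintro ⟨f, hf, h⟩
    have h' : (X - C (d.t k)) ^ (d.m k + 1) ∣ d.oper ((f.eval (d.t k))⁻¹ • f) := by
      rw [map_smul]
      exact dvd_smul_of_dvd _ h
    obtain ⟨g, hg⟩ := d.pow_succ_dvd_sub_frob hd k (by simp [hf]) h' le_rfl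
    have hdiff := d.localCoeff_oper_pow_mul k (d.m k) g
    rw [← hg, map_sub, map_sub, sub_self, mul_zero, zero_mul, zero_mul, sub_eq_zero] at hdiff
    rw [obstruction, ← hdiff]
    exact (pow_succ_dvd_iff_localCoeff ((pow_dvd_pow _ (Nat.le_succ _)).trans h')).1 h'

end Datum

/-! ### The leading form of the obstruction -/

section CoeffsTotalDegreeLT

variable {σ A : Type*} [CommRing A] {n m : ℕ} {f g : (MvPolynomial σ A)[X]}

variable (σ A n) in
/-- The polynomials all of whose coefficients have total degree less than `n`. -/
def coeffsTotalDegreeLT : Submodule A (MvPolynomial σ A)[X] where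
  carrier := {f | ∀ i, f.coeff i ∈ totalDegreeLT σ A n}
  add_mem' hf hg i := by
    rw [coeff_add]
    exact add_mem (hf i) (hg i)
  zero_mem' i := by
    rw [coeff_zero]
    exact zero_mem _
  smul_mem' a f hf i := by
    rw [coeff_smul]
    exact Submodule.smul_mem _ a (hf i)

theorem coeffsTotalDegreeLT_mono (h : n ≤ m) :
    coeffsTotalDegreeLT σ A n ≤ coeffsTotalDegreeLT σ A m :=
  fun _ hf i => totalDegreeLT_mono h (hf i)

theorem mul_mem_coeffsTotalDegreeLT (hf : f ∈ coeffsTotalDegreeLT σ A n)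
    (hg : g ∈ coeffsTotalDegreeLT σ A (m + 1)) : f * g ∈ coeffsTotalDegreeLT σ A (n + m) :=
  fun i => by
    rw [coeff_mul]
    exact sum_mem fun x _ => mul_mem_totalDegreeLT (hf x.1) (hg x.2)

theorem smul_mem_coeffsTotalDegreeLT {c : MvPolynomial σ A} (hc : c ∈ totalDegreeLT σ A n)
    (hf : f ∈ coeffsTotalDegreeLT σ A (m + 1)) : c • f ∈ coeffsTotalDegreeLT σ A (n + m) :=
  fun i => by
    rw [coeff_smul]
    exact mul_mem_totalDegreeLT hc (hf i)

theorem map_C_mem_coeffsTotalDegreeLT (f : A[X]) :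
    f.map MvPolynomial.C ∈ coeffsTotalDegreeLT σ A 1 :=
  fun i => by
    rw [coeff_map]
    exact C_mem_totalDegreeLT _

theorem hasseDeriv_mem_coeffsTotalDegreeLT (k : ℕ) (hf : f ∈ coeffsTotalDegreeLT σ A n) :
    hasseDeriv k f ∈ coeffsTotalDegreeLT σ A n :=
  fun i => by
    rw [hasseDeriv_coeff, ← nsmul_eq_mul]
    exact nsmul_mem (hf _) _

theorem eval_mem_totalDegreeLT (hf : f ∈ coeffsTotalDegreeLT σ A n) (t : A) :
    f.eval (MvPolynomial.C t) ∈ totalDegreeLT σ A n := by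
  rw [eval_eq_sum]
  refine sum_mem fun i _ => mul_mem_totalDegreeLT (m := 0) (hf i) ?_
  rw [← map_pow]
  exact C_mem_totalDegreeLT _

theorem localCoeff_mem_totalDegreeLT (hf : f ∈ coeffsTotalDegreeLT σ A n) (t : A) (i : ℕ) :
    localCoeff (MvPolynomial.C t) i f ∈ totalDegreeLT σ A n := by
  rw [localCoeff, LinearMap.comp_apply, lcoeff_apply, taylor_coeff]
  exact eval_mem_totalDegreeLT (hasseDeriv_mem_coeffsTotalDegreeLT i hf) t

theorem derivative_mem_coeffsTotalDegreeLT (hf : f ∈ coeffsTotalDegreeLT σ A n) :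
    derivative f ∈ coeffsTotalDegreeLT σ A n := by
  rw [← hasseDeriv_one]
  exact hasseDeriv_mem_coeffsTotalDegreeLT 1 hf

theorem X_sub_C_pow_mem_coeffsTotalDegreeLT (t : A) (n : ℕ) :
    (X - C (MvPolynomial.C t)) ^ n ∈ coeffsTotalDegreeLT σ A 1 := by
  have h := map_C_mem_coeffsTotalDegreeLT (σ := σ) ((X - C t) ^ n)
  rwa [Polynomial.map_pow, Polynomial.map_sub, map_X, map_C] at h

end CoeffsTotalDegreeLT

namespace Datum

variable {M : ℕ} (d : Datum M ℂ)

/-- The deformation of the exponents in the direction `(1, 1, 3)`, which is transversal to all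
hyperplanes excluded by `Generic`; the accessory parameters are zero. -/
def exponents : Datum M ℂ[X] where
  t k := C (d.t k)
  m := d.m
  α := C d.α + X
  β := C d.β + X
  γ := C d.γ + 3 * X
  η _ := 0

/-- The deformation of the exponents with free accessory parameters. -/
def universal : Datum M (MvPolynomial (Fin M) ℂ[X]) :=
  { d.exponents.map MvPolynomial.C with η := MvPolynomial.X }

theorem universal_T : d.universal.T = d.exponents.T.map MvPolynomial.C :=
  d.exponents.map_T MvPolynomial.C

theorem universal_Tk (k : Fin M) : d.universal.Tk k = (d.exponents.Tk k).map MvPolynomial.C :=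
  d.exponents.map_Tk MvPolynomial.C k

theorem universal_p : d.universal.p = d.exponents.p.map MvPolynomial.C :=
  d.exponents.map_p MvPolynomial.C

theorem universal_q : d.universal.q = d.exponents.q.map MvPolynomial.C :=
  d.exponents.map_q MvPolynomial.C

theorem eval_exponents_Tk (k : Fin M) :
    (d.exponents.Tk k).eval (C (d.t k)) = C ((d.Tk k).eval (d.t k)) := by
  simp [Tk, eval_prod, exponents]

theorem eval_universal_S (k : Fin M) :
    d.universal.S.eval (d.universal.t k)
      = MvPolynomial.X k * MvPolynomial.C (C ((d.Tk k).eval (d.t k))) := by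
  rw [eval_S_t, universal_Tk, ← eval_exponents_Tk]
  exact congrArg _ (eval_map_apply _ _)

theorem universal_S_mem_coeffsTotalDegreeLT :
    d.universal.S ∈ coeffsTotalDegreeLT (Fin M) ℂ[X] 2 := by
  refine add_mem ?_ (sum_mem fun k _ => ?_)
  · have hαβ : d.universal.α * d.universal.β = MvPolynomial.C (d.exponents.α * d.exponents.β) := by
      rw [map_mul]
      rfl
    rw [universal_T, hαβ, ← smul_eq_C_mul]
    exact smul_mem_coeffsTotalDegreeLT (m := 0) (totalDegreeLT_mono one_le_two
      (C_mem_totalDegreeLT _)) (map_C_mem_coeffsTotalDegreeLT _)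
  · rw [universal_Tk, ← smul_eq_C_mul]
    exact smul_mem_coeffsTotalDegreeLT (m := 0) (X_mem_totalDegreeLT k)
      (map_C_mem_coeffsTotalDegreeLT _)

theorem mem_coeffsTotalDegreeLT_succ {k : Fin M} {n : ℕ} {a : ℂ[X]}
    {f : (MvPolynomial (Fin M) ℂ[X])[X]}
    (hf : f - MvPolynomial.monomial (Finsupp.single k n) a • (X - C (d.universal.t k)) ^ n ∈
      coeffsTotalDegreeLT (Fin M) ℂ[X] n) :
    f ∈ coeffsTotalDegreeLT (Fin M) ℂ[X] (n + 1) := by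
  rw [← sub_add_cancel f]
  exact add_mem (coeffsTotalDegreeLT_mono n.le_succ hf) (smul_mem_coeffsTotalDegreeLT (m := 0)
    (monomial_mem_totalDegreeLT (by simp) a) (X_sub_C_pow_mem_coeffsTotalDegreeLT _ n))

theorem localCoeff_oper_universal_sub_mem (k : Fin M) {n : ℕ} {a : ℂ[X]}
    {f : (MvPolynomial (Fin M) ℂ[X])[X]}
    (hf : f - MvPolynomial.monomial (Finsupp.single k n) a • (X - C (d.universal.t k)) ^ n ∈
      coeffsTotalDegreeLT (Fin M) ℂ[X] n) :
    localCoeff (d.universal.t k) n (d.universal.oper f) -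
        MvPolynomial.monomial (Finsupp.single k (n + 1)) (a * C ((d.Tk k).eval (d.t k))) ∈
      totalDegreeLT (Fin M) ℂ[X] (n + 1) := by
  set x := X - C (d.universal.t k)
  set c := MvPolynomial.monomial (Finsupp.single k n) a with hc
  have hf' := d.mem_coeffsTotalDegreeLT_succ hf
  have hlow : d.universal.q * derivative (derivative f) + d.universal.p * derivative f
      + (f - c • x ^ n) * d.universal.S ∈ coeffsTotalDegreeLT (Fin M) ℂ[X] (n + 1) := by
    rw [universal_q, universal_p, mul_comm (Polynomial.map _ _),
      mul_comm (Polynomial.map _ _)]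
    exact add_mem (add_mem
      (mul_mem_coeffsTotalDegreeLT (m := 0)
        (derivative_mem_coeffsTotalDegreeLT (derivative_mem_coeffsTotalDegreeLT hf'))
        (map_C_mem_coeffsTotalDegreeLT _))
      (mul_mem_coeffsTotalDegreeLT (m := 0) (derivative_mem_coeffsTotalDegreeLT hf')
        (map_C_mem_coeffsTotalDegreeLT _)))
      (mul_mem_coeffsTotalDegreeLT hf d.universal_S_mem_coeffsTotalDegreeLT)
  have hoper : d.universal.oper f = (d.universal.q * derivative (derivative f)
      + d.universal.p * derivative f + (f - c • x ^ n) * d.universal.S)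
      + c • (x ^ n * d.universal.S) := by
    rw [oper_apply, smul_eq_C_mul, smul_eq_C_mul]
    ring
  have hmonomial : c * d.universal.S.eval (d.universal.t k) =
      MvPolynomial.monomial (Finsupp.single k (n + 1)) (a * C ((d.Tk k).eval (d.t k))) := by
    rw [eval_universal_S, hc, mul_comm (MvPolynomial.X k), MvPolynomial.C_mul_X_eq_monomial,
      MvPolynomial.monomial_mul, ← Finsupp.single_add]
  rw [hoper, map_add, map_smul, localCoeff_pow_mul, smul_eq_mul, hmonomial, add_sub_cancel_right]
  exact localCoeff_mem_totalDegreeLT hlow _ _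

theorem exists_frob_universal_sub_mem (hd : d.Distinct) (k : Fin M) {n : ℕ} (hn : n ≤ d.m k) :
    ∃ a : ℂ, a ≠ 0 ∧ d.universal.frob (d.weight k) k n -
        MvPolynomial.monomial (Finsupp.single k n) (C a) • (X - C (d.universal.t k)) ^ n ∈
      coeffsTotalDegreeLT (Fin M) ℂ[X] n := by
  induction n with
  | zero => exact ⟨1, one_ne_zero, by simp [frob]⟩
  | succ n ih =>
    obtain ⟨a, ha, hf⟩ := ih (by omega)
    have hdenom := d.frob_denom_ne_zero hd k hn
    have hlow := Submodule.smul_of_tower_mem _ (-((n + 1) * (n - d.m k) * d.weight k : ℂ)⁻¹)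
      (d.localCoeff_oper_universal_sub_mem k hf)
    refine ⟨-((n + 1) * (n - d.m k) * d.weight k : ℂ)⁻¹ * (a * (d.Tk k).eval (d.t k)),
      mul_ne_zero (neg_ne_zero.2 (inv_ne_zero hdenom))
        (mul_ne_zero ha (d.eval_Tk_self_ne_zero hd.inj k)), ?_⟩
    convert add_mem (d.mem_coeffsTotalDegreeLT_succ hf) (smul_mem_coeffsTotalDegreeLT (m := 0) hlow
      (X_sub_C_pow_mem_coeffsTotalDegreeLT (C (d.t k)) (n + 1))) using 1
    rw [smul_sub, sub_smul, MvPolynomial.smul_monomial, ← C_mul, smul_C, smul_eq_mul, neg_smul,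
      neg_smul, ← add_sub_assoc, ← sub_eq_add_neg]
    rfl

theorem exists_obstruction_universal_sub_mem (hd : d.Distinct) (k : Fin M) :
    ∃ a : ℂ, a ≠ 0 ∧ d.universal.obstruction (d.weight k) k -
        MvPolynomial.C (C a) * MvPolynomial.X k ^ (d.m k + 1) ∈
      totalDegreeLT (Fin M) ℂ[X] (d.m k + 1) := by
  obtain ⟨a, ha, hf⟩ := d.exists_frob_universal_sub_mem hd k le_rfl
  refine ⟨a * (d.Tk k).eval (d.t k), mul_ne_zero ha (d.eval_Tk_self_ne_zero hd.inj k), ?_⟩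
  rw [MvPolynomial.C_mul_X_pow_eq_monomial, C_mul]
  exact d.localCoeff_oper_universal_sub_mem k hf

end Datum

/-! ### Passage to the limit -/

namespace Datum

variable {M : ℕ} (d : Datum M ℂ)

section Point

variable (φ : MvPolynomial (Fin M) ℂ[X] →ₐ[ℂ] ℂ)

/-- The member of the universal deformation with parameters `φ`. -/
def point : Datum M ℂ := d.universal.map (φ : MvPolynomial (Fin M) ℂ[X] →+* ℂ)

theorem point_t : (d.point φ).t = d.t := funext fun k => φ.commutes (d.t k)

theorem point_α : (d.point φ).α = d.α + φ (MvPolynomial.C X) := by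
  change φ (MvPolynomial.C (C d.α + X)) = _
  rw [map_add, map_add]
  exact congrArg (· + _) (φ.commutes d.α)

theorem point_β : (d.point φ).β = d.β + φ (MvPolynomial.C X) := by
  change φ (MvPolynomial.C (C d.β + X)) = _
  rw [map_add, map_add]
  exact congrArg (· + _) (φ.commutes d.β)

theorem point_γ : (d.point φ).γ = d.γ + 3 * φ (MvPolynomial.C X) := by
  change φ (MvPolynomial.C (C d.γ + 3 * X)) = _
  rw [map_add, map_add, map_mul, map_mul, map_ofNat, map_ofNat]
  exact congrArg (· + _) (φ.commutes d.γ)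

theorem point_δ : (d.point φ).δ = d.δ - φ (MvPolynomial.C X) := by
  have hN : (d.point φ).N = d.N := rfl
  rw [δ, point_α, point_β, point_γ, hN, δ]
  ring

theorem Distinct.point {d : Datum M ℂ} (hd : d.Distinct) : (d.point φ).Distinct where
  inj := by rw [point_t]; exact hd.inj
  ne_zero := by rw [point_t]; exact hd.ne_zero
  ne_one := by rw [point_t]; exact hd.ne_one

theorem apparentAt_point_iff (hd : d.Distinct) (k : Fin M) :
    (d.point φ).ApparentAt k ↔ φ (d.universal.obstruction (d.weight k) k) = 0 := by
  have hweight : (d.point φ).weight k = d.weight k := by simp only [weight, Tk, point_t]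
  rw [← obstruction_eq_zero_iff _ (hd.point φ), hweight, point, map_obstruction]

/-- The values of the deformation parameter at which `Generic` fails. -/
def nongeneric : Set ℂ :=
  ⋃ n : ℤ, {n - d.α, n - d.β, (d.α - d.γ - n) / 2, (d.β - d.γ - n) / 2, d.δ - n}

theorem countable_nongeneric : d.nongeneric.Countable :=
  Set.countable_iUnion fun _ => (Set.toFinite _).countable

theorem generic_point (h : φ (MvPolynomial.C X) ∉ d.nongeneric) : (d.point φ).Generic := by
  simp only [nongeneric, Set.mem_iUnion, Set.mem_insert_iff, Set.mem_singleton_iff, not_exists,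
    not_or] at h
  constructor
  all_goals
    intro n hn
    simp only [point_α, point_β, point_γ, point_δ] at hn
    obtain ⟨h₁, h₂, h₃, h₄, h₅⟩ := h n
    grind

theorem linearIndependent_universal_condition_iff {n : ℕ} :
    (LinearIndependent ℂ fun (j : Fin n) i => (d.universal.condition (X ^ (j : ℕ)) i).map
      (φ : MvPolynomial (Fin M) ℂ[X] →+* ℂ)) ↔
    ∀ E ∈ degreeLT ℂ n, (d.point φ).condition E = 0 → E = 0 := by
  rw [← linearIndependent_X_pow_iff]
  have h (j : Fin n) : (d.point φ).condition (X ^ (j : ℕ)) = fun i =>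
      (d.universal.condition (X ^ (j : ℕ)) i).map (φ : MvPolynomial (Fin M) ℂ[X] →+* ℂ) := by
    ext1 i
    rw [← map_condition, Polynomial.map_pow, map_X, point]
  simp only [h]

end Point

/-- The parameters of `d` itself in its universal deformation. -/
def basePoint : MvPolynomial (Fin M) ℂ[X] →ₐ[ℂ] ℂ :=
  MvPolynomial.aevalTower (Polynomial.aeval (0 : ℂ)) d.η

theorem point_basePoint : d.point d.basePoint = d := by
  obtain ⟨t, m, α, β, γ, η⟩ := d
  simp [point, basePoint, universal, exponents, Datum.map]

theorem exists_condition_eq_zero (hd : d.Distinct) (ha : ∀ k, d.ApparentAt k) {n : ℕ}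
    (hN : d.N = n + 1) : ∃ E : ℂ[X], E ≠ 0 ∧ d.condition E = 0 := by
  by_contra! hcon
  have hinj : ∀ E ∈ degreeLT ℂ (d.N + 1), (d.point d.basePoint).condition E = 0 → E = 0 := by
    intro E _ hE
    rw [point_basePoint] at hE
    exact by_contra fun hE₀ => hcon E hE₀ hE
  obtain ⟨r, hr, hopen⟩ := exists_linearIndependent_map
    (fun j : Fin (d.N + 1) => d.universal.condition (X ^ (j : ℕ)))
    ((d.linearIndependent_universal_condition_iff d.basePoint).2 hinj)
  choose a ha₀ hlead using d.exists_obstruction_universal_sub_mem hd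
  obtain ⟨φ, hφ, hφr, hφX⟩ := exists_generic_point
    (a := fun k => (isUnit_C.2 (ha₀ k).isUnit).unit) hlead
    (fun k => (d.apparentAt_point_iff d.basePoint hd k).1 (by rw [point_basePoint]; exact ha k))
    hr d.countable_nongeneric
  obtain ⟨E, hE₀, hE, hrem, hind⟩ := (d.point φ).exists_rem_indicial_eq_zero_of_generic
    (hd.point φ) (d.generic_point φ hφX)
    (fun k => (d.apparentAt_point_iff φ hd k).2 (hφ k)) hN
  have hE : E ∈ degreeLT ℂ (d.N + 1) :=
    mem_degreeLT.2 ((natDegree_lt_iff_degree_lt hE₀).1 (Nat.lt_succ_of_le hE))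
  exact hE₀ ((d.linearIndependent_universal_condition_iff φ).1 (hopen φ hφr) E hE
    ((condition_eq_zero_iff _).2 ⟨hrem, hind⟩))

variable {d}

theorem S_eq_of_N_eq_zero (hd : d.Distinct) (ha : ∀ k, d.ApparentAt k) (hN : d.N = 0) :
    d.S = C (d.α * d.β) * d.T := by
  have hm : ∀ k, d.m k = 0 := by simpa [N] using hN
  rw [S, add_eq_left]
  refine Finset.sum_eq_zero fun k _ => ?_
  obtain ⟨f, hf, hdvd⟩ := ha k
  have hη : d.η k = 0 := by
    rw [hm, zero_add, pow_one, dvd_iff_isRoot, IsRoot.def] at hdvd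
    simpa [q, eval_T_t, eval_p_t, hm, eval_S_t, hf, d.eval_Tk_self_ne_zero hd.inj] using hdvd
  rw [hη, C_0, zero_mul]

theorem rem_one_eq_zero (hd : d.Distinct) (ha : ∀ k, d.ApparentAt k) (hN : d.N = 0) :
    d.rem 1 = 0 := by
  have hmT : d.mT = 0 := Finset.sum_eq_zero fun k _ => by
    have hm : ∀ k, d.m k = 0 := by simpa [N] using hN
    simp [hm]
  have hX : (RatFunc.X : RatFunc ℂ) ≠ 0 := RatFunc.X_ne_zero
  have hX1 := ratFunc_X_sub_one_ne_zero
  have hT : algebraMap ℂ[X] (RatFunc ℂ) d.T ≠ 0 := RatFunc.algebraMap_ne_zero d.monic_T.ne_zero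
  have hP : d.P = RatFunc.C d.γ / RatFunc.X +
      (RatFunc.C d.α + RatFunc.C d.β - RatFunc.C d.γ + 1) / (RatFunc.X - 1) := by
    simp only [P, p, q, hmT, δ, hN, map_add, map_sub, map_mul, map_one, Nat.cast_zero,
      mul_zero, sub_zero, add_zero, RatFunc.algebraMap_X, RatFunc.algebraMap_C]
    field_simp
  have hQ : d.Q = RatFunc.C d.α * RatFunc.C d.β / (RatFunc.X * (RatFunc.X - 1)) := by
    simp only [Q, q, S_eq_of_N_eq_zero hd ha hN, map_mul, map_sub, map_one,
      RatFunc.algebraMap_X, RatFunc.algebraMap_C]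
    field_simp
  rw [d.rem_eq_zero_iff (by simp), one_comp, one_comp, mul_one, mul_one, H₁, H₂]
  simp only [map_mul, Module.End.mul_apply, aeval_X, aeval_theta_X_add_C_apply, theta_apply,
    nabla_apply, hP, hQ]
  ext <;> simp only [ddz_one, ddz_X, ddz_C, map_sub, map_one, map_zero, Prod.smul_mk,
    Prod.mk_add_mk, smul_eq_mul, mul_zero, mul_one, add_zero, zero_add, sub_zero, zero_sub] <;>
    field_simp <;> ring

theorem exists_rem_eq_zero (hd : d.Distinct) (ha : ∀ k, d.ApparentAt k) :
    ∃ E : ℂ[X], E.Monic ∧ E.natDegree = d.N ∧ d.rem E = 0 := by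
  rcases hN : d.N with _ | n
  · exact ⟨1, monic_one, natDegree_one, rem_one_eq_zero hd ha hN⟩
  obtain ⟨E, hE₀, hE⟩ := d.exists_condition_eq_zero hd ha hN
  have hmonic : (E.leadingCoeff⁻¹ • E).Monic := by
    rw [smul_eq_C_mul, mul_comm]
    exact monic_mul_leadingCoeff_inv hE₀
  have hE' : d.condition (E.leadingCoeff⁻¹ • E) = 0 := by rw [map_smul, hE, smul_zero]
  rw [condition_eq_zero_iff] at hE'
  exact ⟨_, hmonic, hN ▸ d.natDegree_eq_of_indicial hd hmonic.ne_zero hE'.2, hE'.1⟩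

end Datum

/-! ### Analytic solutions -/

theorem exists_eventually_eq_eval_add {f : ℂ → ℂ} {t : ℂ} (hf : AnalyticAt ℂ f t) (n : ℕ) :
    ∃ (r : ℂ[X]) (g : ℂ → ℂ), AnalyticAt ℂ g t ∧
      ∀ᶠ z in 𝓝 t, f z = r.eval z + (z - t) ^ n * g z := by
  have hf₀ : AnalyticAt ℂ (fun z => f (z + t)) 0 :=
    AnalyticAt.fun_comp (by rwa [zero_add]) (analyticAt_id.add analyticAt_const)
  obtain ⟨F, hF, h⟩ := hf₀.exists_eventuallyEq_sum_add_pow_mul n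
  set a := fun i => iteratedDeriv i (fun z => f (z + t)) 0
  refine ⟨∑ i ∈ Finset.range n, C (a i / i.factorial) * (X - C t) ^ i, fun z => F (z - t),
    AnalyticAt.fun_comp (by rwa [sub_self]) (analyticAt_id.sub analyticAt_const), ?_⟩
  have htendsto : Tendsto (fun z => z - t) (𝓝 t) (𝓝 0) := by
    simpa using (continuous_sub_right t).tendsto t
  filter_upwards [htendsto.eventually h] with z hz
  rw [sub_add_cancel] at hz
  rw [hz, eval_finsetSum]
  congr 1
  refine Finset.sum_congr rfl fun i _ => ?_
  simp only [eval_mul, eval_C, eval_pow, eval_sub, eval_X, smul_eq_mul]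
  ring

theorem exists_eventually_deriv_eq_eval_add {f g : ℂ → ℂ} {t : ℂ} {r : ℂ[X]} {n : ℕ}
    (hg : AnalyticAt ℂ g t) (h : ∀ᶠ z in 𝓝 t, f z = r.eval z + (z - t) ^ (n + 1) * g z) :
    ∃ u : ℂ → ℂ, AnalyticAt ℂ u t ∧
      ∀ᶠ z in 𝓝 t, deriv f z = (derivative r).eval z + (z - t) ^ n * u z := by
  refine ⟨fun z => (n + 1) * g z + (z - t) * deriv g z, ?_, ?_⟩
  · have := hg.deriv
    fun_prop
  · filter_upwards [h.eventually_nhds, hg.eventually_analyticAt] with z hz hgz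
    have hpow := ((hasDerivAt_id z).sub_const t).fun_pow (n + 1)
    have hderiv := (r.hasDerivAt z).fun_add (hpow.fun_mul hgz.differentiableAt.hasDerivAt)
    refine (Filter.EventuallyEq.deriv_eq hz).trans (hderiv.deriv.trans ?_)
    simp only [id, Nat.add_sub_cancel, Nat.cast_add, Nat.cast_one]
    ring

theorem pow_dvd_of_eventually {f : ℂ[X]} {t : ℂ} {n : ℕ} {u : ℂ → ℂ} (hu : ContinuousAt u t)
    (h : ∀ᶠ z in 𝓝[≠] t, f.eval z = (z - t) ^ n * u z) : (X - C t) ^ n ∣ f := by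
  induction n generalizing u with
  | zero => simp
  | succ n ih =>
    have hu' : ContinuousAt (fun z => (z - t) * u z) t := by fun_prop
    obtain ⟨g, rfl⟩ := ih hu' (h.mono fun z hz => by rw [hz, pow_succ, mul_assoc])
    have hg : (fun z => g.eval z) =ᶠ[𝓝[≠] t] fun z => (z - t) * u z := by
      filter_upwards [h, self_mem_nhdsWithin] with z hz hzt
      rw [eval_mul, eval_pow, eval_sub, eval_X, eval_C, pow_succ, mul_assoc] at hz
      exact mul_left_cancel₀ (pow_ne_zero n (sub_ne_zero.2 hzt)) hz
    have hgt : g.eval t = (t - t) * u t :=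
      ((g.continuous.continuousAt.eventuallyEq_nhds_iff_eventuallyEq_nhdsNE hu').1 hg).self_of_nhds
    rw [sub_self, zero_mul] at hgt
    exact pow_succ (X - C t) n ▸ mul_dvd_mul_left _ (dvd_iff_isRoot.2 hgt)

theorem eventually_eval_mul_eval {P : RatFunc ℂ} {p q : ℂ[X]}
    (h : P * algebraMap ℂ[X] (RatFunc ℂ) q = algebraMap ℂ[X] (RatFunc ℂ) p) (t : ℂ) :
    ∀ᶠ z in 𝓝[≠] t, P.eval (RingHom.id ℂ) z * q.eval z = p.eval z := by
  filter_upwards [nhdsNE_le_cofinite t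
    (finite_setOfPred_isRoot P.denom_ne_zero).eventually_cofinite_notMem] with z hz
  have heval := congrArg (RatFunc.eval (RingHom.id ℂ) z) h
  rw [RatFunc.eval_mul _ _ (by simpa [eval₂_id] using hz)
    (by simp [RatFunc.denom_algebraMap])] at heval
  simpa using heval

namespace Datum

variable {M : ℕ} {d : Datum M ℂ}

theorem apparentAt_of_isApparentAt {k : Fin M}
    (h : IsApparentAt d.P d.Q (d.t k) (d.m k)) : d.ApparentAt k := by
  obtain ⟨⟨f, hf, hft, hsol⟩, -⟩ := h
  obtain ⟨r, g, hg, h₀⟩ := exists_eventually_eq_eval_add hf (d.m k + 3)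
  obtain ⟨g₁, hg₁, h₁⟩ := exists_eventually_deriv_eq_eval_add hg h₀
  obtain ⟨g₂, hg₂, h₂⟩ := exists_eventually_deriv_eq_eval_add hg₁ h₁
  have hr : f (d.t k) = r.eval (d.t k) := by simpa using h₀.self_of_nhds
  have hq := d.algebraMap_q_ne_zero
  have hP := eventually_eval_mul_eval (P := d.P) (p := d.p) (div_mul_cancel₀ _ hq) (d.t k)
  have hQ := eventually_eval_mul_eval (P := d.Q) (p := d.S) (div_mul_cancel₀ _ hq) (d.t k)
  refine ⟨r, hr ▸ hft, pow_dvd_of_eventually (u := fun z => -(d.q.eval z * g₂ z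
    + d.p.eval z * ((z - d.t k) * g₁ z) + d.S.eval z * ((z - d.t k) ^ 2 * g z))) ?_ ?_⟩
  · have := hg.continuousAt
    have := hg₁.continuousAt
    have := hg₂.continuousAt
    fun_prop
  · filter_upwards [hsol, hP, hQ, nhdsWithin_le_nhds h₀, nhdsWithin_le_nhds h₁,
      nhdsWithin_le_nhds h₂] with z hz hPz hQz hz₀ hz₁ hz₂
    rw [hz₀, hz₁, hz₂] at hz
    simp only [eval_add, eval_mul]
    rw [← hPz, ← hQz]
    linear_combination d.q.eval z * hz

end Datum

/-! ### Division of the hypergeometric operator -/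

theorem exists_eq_prod_X_add_C {E : ℂ[X]} (hE : E.Monic) {n : ℕ} (hn : E.natDegree = n) :
    ∃ e : Fin n → ℂ, E = ∏ i, (X + C (e i)) := by
  obtain ⟨l, hl⟩ := Quot.exists_rep E.roots
  have hlen : l.length = n := by
    rw [← hn, (IsAlgClosed.splits E).natDegree_eq_card_roots, ← hl]
    rfl
  subst hlen
  refine ⟨fun i => -l[i], ?_⟩
  rw [(IsAlgClosed.splits E).eq_prod_roots_of_monic hE, ← hl]
  simp only [C_neg, ← sub_eq_add_neg]
  exact (Fin.prod_univ_fun_getElem l fun c => X - C c).symm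

namespace Datum

variable {M : ℕ} (d : Datum M ℂ)

theorem exists_ghgOp_eq (hd : d.Distinct) (ha : ∀ k, d.ApparentAt k) :
    ∃ (e : Fin d.N → ℂ) (D : Module.End ℂ (RatFunc ℂ)), IsDiffOpOfOrder d.N D ∧
      ghgOp (d.α :: d.β :: List.ofFn fun i => e i + 1) (d.γ :: List.ofFn e) =
        D * secondOrderOp d.P d.Q := by
  obtain ⟨E, hE, hN, hrem⟩ := exists_rem_eq_zero hd ha
  rw [d.rem_eq_zero_iff hN.le] at hrem
  obtain ⟨e, rfl⟩ := exists_eq_prod_X_add_C hE hN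
  refine ⟨e, exists_ghgOp_eq_mul d.P d.Q (by simp) (by simp) ?_⟩
  have hγ : ((d.γ :: List.ofFn e).map fun c => X + C (c - 1)).prod =
      (X + C (d.γ - 1)) * (∏ i, (X + C (e i))).comp (X - 1) := by
    simp [List.prod_ofFn, prod_comp, Function.comp_def, sub_add_eq_add_sub, ← add_sub_assoc]
  have hαβ : ((d.α :: d.β :: List.ofFn fun i => e i + 1).map fun c => X + C c).prod =
      d.H₂ * (∏ i, (X + C (e i))).comp (X + 1) := by
    simp [List.prod_ofFn, prod_comp, Function.comp_def, H₂, mul_assoc, add_right_comm X 1,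
      ← add_assoc]
  rw [H₁, mul_assoc, ← hγ, ← hαβ, map_mul, aeval_X, Module.End.mul_apply, theta_apply] at hrem
  exact smul_right_injective _ (RatFunc.X_ne_zero (K := ℂ)) hrem

/-! ### From the equation to its parameters -/

theorem coeffP_eq : coeffP d.γ d.δ d.m d.t = d.P := by
  have hX : (RatFunc.X : RatFunc ℂ) ≠ 0 := RatFunc.X_ne_zero
  have hX1 := ratFunc_X_sub_one_ne_zero
  have hT : algebraMap ℂ[X] (RatFunc ℂ) d.T ≠ 0 := RatFunc.algebraMap_ne_zero d.monic_T.ne_zero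
  have hsum : ∑ k, (d.m k : RatFunc ℂ) / (RatFunc.X - RatFunc.C (d.t k))
      = algebraMap ℂ[X] (RatFunc ℂ) d.mT / algebraMap ℂ[X] (RatFunc ℂ) d.T := by
    rw [mT, map_sum, Finset.sum_div]
    refine Finset.sum_congr rfl fun k _ => ?_
    have hTk : algebraMap ℂ[X] (RatFunc ℂ) (d.Tk k) ≠ 0 :=
      RatFunc.algebraMap_ne_zero (d.monic_Tk k).ne_zero
    rw [← d.X_sub_C_mul_Tk k, map_mul, map_mul, mul_div_mul_right _ _ hTk]
    simp
  rw [coeffP, hsum, P, p, q]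
  simp only [map_sub, map_add, map_mul, RatFunc.algebraMap_X, RatFunc.algebraMap_C, map_one]
  field_simp

variable {d} in
theorem S_eq_of_eval_t_eq (ht : Function.Injective d.t) {f : ℂ[X]} (hf : f.natDegree ≤ M)
    (hcoeff : f.coeff M = d.α * d.β)
    (heval : ∀ k, f.eval (d.t k) = d.η k * (d.Tk k).eval (d.t k)) : d.S = f := by
  rw [← sub_eq_zero]
  refine eq_zero_of_degree_lt_of_eval_index_eq_zero (v := d.t) Finset.univ ht.injOn ?_ fun k _ => ?_
  · rw [Finset.card_univ, Fintype.card_fin, degree_lt_iff_coeff_zero]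
    intro i hi
    rcases hi.eq_or_lt with rfl | hi
    · rw [coeff_sub, hcoeff, coeff_S, sub_self]
    · rw [coeff_sub, coeff_eq_zero_of_natDegree_lt (d.natDegree_S_le.trans_lt hi),
        coeff_eq_zero_of_natDegree_lt (hf.trans_lt hi), sub_zero]
  · rw [eval_sub, eval_S_t, heval, sub_self]

theorem exists_S_eq (m : Fin M → ℕ) {t : Fin M → ℂ} (ht : Function.Injective t) (γ δ : ℂ)
    {f : ℂ[X]} (hf : f.natDegree ≤ M) :
    ∃ d : Datum M ℂ, d.t = t ∧ d.m = m ∧ d.γ = γ ∧ d.δ = δ ∧ f.coeff M = d.α * d.β ∧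
      d.S = f := by
  set a := δ + γ - ((∑ k, m k : ℕ) : ℂ) - 1 with ha
  obtain ⟨r, hr⟩ := IsAlgClosed.exists_eq_mul_self (a ^ 2 - 4 * f.coeff M)
  let d₀ : Datum M ℂ := ⟨t, m, (a + r) / 2, (a - r) / 2, γ, 0⟩
  let d : Datum M ℂ := { d₀ with η := fun k => f.eval (t k) / (d₀.Tk k).eval (t k) }
  have hcoeff : f.coeff M = d.α * d.β := by
    change _ = (a + r) / 2 * ((a - r) / 2)
    linear_combination -hr / 4
  refine ⟨d, rfl, rfl, rfl, ?_, hcoeff, S_eq_of_eval_t_eq ht hf hcoeff fun k => ?_⟩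
  · change (a + r) / 2 + (a - r) / 2 - γ + ((∑ k, m k : ℕ) : ℂ) + 1 = δ
    rw [ha]
    ring
  · exact (div_mul_cancel₀ _ (d.eval_Tk_self_ne_zero ht k)).symm

theorem exists_coeffQ_eq (m : Fin M → ℕ) {t : Fin M → ℂ} (ht : Function.Injective t) (γ δ : ℂ)
    (s : Fin (M + 1) → ℂ) :
    ∃ d : Datum M ℂ, d.t = t ∧ d.m = m ∧ d.γ = γ ∧ d.δ = δ ∧ s (Fin.last M) = d.α * d.β ∧
      coeffQ s t = d.Q := by
  have hdeg : (∑ i : Fin (M + 1), C (s i) * X ^ (i : ℕ)).natDegree ≤ M :=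
    natDegree_sum_le_of_forall_le _ _ fun i _ =>
      (natDegree_C_mul_X_pow_le _ _).trans (Nat.lt_succ_iff.1 i.2)
  obtain ⟨d, rfl, hm, hγ, hδ, hαβ, hS⟩ := exists_S_eq m ht γ δ hdeg
  refine ⟨d, rfl, hm, hγ, hδ, ?_, ?_⟩
  · have hcoeff : (∑ i : Fin (M + 1), C (s i) * X ^ (i : ℕ)).coeff M = s (Fin.last M) := by
      rw [finsetSum_coeff, Finset.sum_eq_single (Fin.last M)]
      · simp
      · intro i _ hi
        rw [coeff_C_mul, coeff_X_pow, if_neg (fun h => hi (Fin.ext h.symm)), mul_zero]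
      · simp
    rw [← hcoeff, hαβ]
  · rw [coeffQ, Q, hS, q, T]
    simp [map_sum, map_prod]

end Datum

end Fuchsian

end

theorem mainTheorem1_general (M : ℕ) (m : Fin M → ℕ)
    (t : Fin M → ℂ) (ht : Function.Injective t) (ht0 : ∀ k, t k ≠ 0) (ht1 : ∀ k, t k ≠ 1)
    (γ δ : ℂ) (s : Fin (M + 1) → ℂ)
    (happ : ∀ k, Fuchsian.IsApparentAt (Fuchsian.coeffP γ δ m t) (Fuchsian.coeffQ s t)
      (t k) (m k)) :
    ∃ (α β : ℂ) (e : Fin (∑ k, m k) → ℂ) (D : Module.End ℂ (RatFunc ℂ)),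
      s (Fin.last M) = α * β ∧
      δ = α + β - γ + ((∑ k, m k : ℕ) : ℂ) + 1 ∧
      Fuchsian.IsDiffOpOfOrder (∑ k, m k) D ∧
      Fuchsian.ghgOp (α :: β :: List.ofFn fun i => e i + 1) (γ :: List.ofFn e) =
        D * Fuchsian.secondOrderOp (Fuchsian.coeffP γ δ m t) (Fuchsian.coeffQ s t) := by
  obtain ⟨d, rfl, rfl, rfl, rfl, hs, hQ⟩ := Fuchsian.Datum.exists_coeffQ_eq m ht γ δ s
  have hd : d.Distinct := ⟨ht, ht0, ht1⟩
  rw [d.coeffP_eq, hQ] at happ ⊢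
  obtain ⟨e, D, hD, h⟩ :=
    d.exists_ghgOp_eq hd fun k => Fuchsian.Datum.apparentAt_of_isApparentAt (happ k)
  exact ⟨d.α, d.β, e, D, hs, rfl, hD, h⟩

theorem mainTheorem1 (M : ℕ) (m : Fin M → ℕ) (hm : ∀ k, 1 ≤ m k)
    (hcase : (M = 1 ∧ ∑ k, m k ≤ 5) ∨ (M = 2 ∧ ∑ k, m k ≤ 4) ∨ (M = 3 ∧ ∀ k, m k = 1))
    (t : Fin M → ℂ) (ht : Function.Injective t) (ht0 : ∀ k, t k ≠ 0) (ht1 : ∀ k, t k ≠ 1)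
    (γ δ : ℂ) (s : Fin (M + 1) → ℂ)
    (happ : ∀ k, Fuchsian.IsApparentAt (Fuchsian.coeffP γ δ m t) (Fuchsian.coeffQ s t)
      (t k) (m k)) :
    ∃ (α β : ℂ) (e : Fin (∑ k, m k) → ℂ) (D : Module.End ℂ (RatFunc ℂ)),
      s (Fin.last M) = α * β ∧
      δ = α + β - γ + ((∑ k, m k : ℕ) : ℂ) + 1 ∧
      Fuchsian.IsDiffOpOfOrder (∑ k, m k) D ∧
      Fuchsian.ghgOp (α :: β :: List.ofFn fun i => e i + 1) (γ :: List.ofFn e) =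
        D * Fuchsian.secondOrderOp (Fuchsian.coeffP γ δ m t) (Fuchsian.coeffQ s t) :=
  mainTheorem1_general M m t ht ht0 ht1 γ δ s happ
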